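/- **Theorem 1.4.** Let $1\le m\le n$, let $(M,g)$ be a compact connected Hermitian manifold of complex dimension $m$, let $(N,h)$ be a Hermitian manifold of complex dimension $n$, and let $f:M\to N$ be holomorphic. *Conventions.* For a Hermitian metric $g$ let $R$ be the curvature tensor of the Chern connection, $$R_{i\bar jk\bar l}=-\frac{\partial^2 g_{k\bar l}}{\partial z^i\partial\bar z^j}+g^{p\bar q}\frac{\partial g_{k\bar q}}{\partial z^i}\frac{\partial g_{p\bar l}}{\partial\bar z^j},$$ let $Ric$ be the first Chern Ricci curvature, $R_{i\bar j}=g^{k\bar l}R_{i\bar jk\bar l}$, and $S=g^{i\bar j}g^{k\bar l}R_{i\bar jk\bar l}$ the Chern scalar curvature. For an $\ell$-dimensional subspace $\Sigma$ of the holomorphic tangent space at $p$, a unitary basis $E_1,\dots,E_\ell$ of $\Sigma$ and $v\in\Sigma$ put $$Ric^{(1)}_\ell(p,\Sigma)(v,\bar v)=\sum_{i=1}^{\ell}R(v,\bar v,E_i,\bar E_i),\qquad Ric^{(2)}_\ell(p,\Sigma)(v,\bar v)=\sum_{i=1}^{\ell}R(E_i,\bar E_i,v,\bar v),\qquad S_\ell(p,\Sigma)=\sum_{i,j=1}^{\ell}R(E_i,\bar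 E_i,E_j,\bar E_j).$$ A sign condition on $Ric^{(1)}_\ell$, $Ric^{(2)}_\ell$ or $S_\ell$ means that for all $p$ and all $\ell$-dimensional $\Sigma$ the Hermitian form on $\Sigma$, respectively the number, has that sign; if $g$ is Kähler, $Ric^{(1)}_\ell=Ric^{(2)}_\ell$ is denoted $Ric_\ell$. The real bisectional curvature is $$\widetilde B(e,a)=\frac1{|a|^2}\sum_{i,j}R(e_i,\bar e_i,e_j,\bar e_j)\,a_ia_j;$$ a sign condition on $\widetilde B$ is required for all unitary frames $e$ at all points and all nonnegative $a=(a_i)\neq 0$. The superscripts $M,N$ say which manifold is meant. The map $f$ is *degenerate* if $\dim_{\mathbb C} f(M)<m$, and $\operatorname{rank}(f)$ is the maximum over $x \in M$ of the complex rank of $\partial f_x:T'_xM\to T'_{f(x)}N$. (a) If $S^M\ge0$ and $Ric^{(1)}_m(N)<0$, or $S^M>0$ and $Ric^{(1)}_m(N)\le0$, then $f$ is degenerate. The same holds if $Ric^M\ge0$ and $S^N_m<0$, or $Ric^M>0$ and $S^N_m\le0$. (b) Let $g$ be Kähler and $1\le\ell<m$. If $S^M_\ell\ge0$ and $Ric^{(1)}_\ell(N)<0$,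 or $S^M_\ell>0$ and $Ric^{(1)}_\ell(N)\le0$, then $\operatorname{rank}(f)<\ell$. The same holds if $Ric^M_\ell\ge0$ and $S^N_\ell<0$, or $Ric^M_\ell>0$ and $S^N_\ell\le0$. (c) Let $1\le\ell\le m$. If $Ric^{(2)}_\ell(M)>0$ and $\widetilde B^N\le0$, or $Ric^{(2)}_\ell(M)\ge0$ and $\widetilde B^N<0$, then $f$ is constant. -/

import Mathlib

open scoped Manifold ContDiff

noncomputable section

namespace Herm

/-- Complex coordinate space of dimension `m`. -/
abbrev Cn (m : ℕ) : Type := EuclideanSpace ℂ (Fin m)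

/-- The `k`-th standard basis vector of `ℂ^m`. -/
abbrev stdVec {m : ℕ} (k : Fin m) : Cn m := EuclideanSpace.single k (1 : ℂ)

/-- The Wirtinger derivative `∂F/∂z^k = (1/2) (∂F/∂x^k - i ∂F/∂y^k)`. -/
def dz {m : ℕ} (k : Fin m) (F : Cn m → ℂ) (z : Cn m) : ℂ :=
  (1 / 2 : ℂ) *
    (fderiv ℝ F z (stdVec k) - Complex.I * fderiv ℝ F z (Complex.I • stdVec k))

/-- The Wirtinger derivative `∂F/∂z̄^k = (1/2) (∂F/∂x^k + i ∂F/∂y^k)`. -/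
def dzbar {m : ℕ} (k : Fin m) (F : Cn m → ℂ) (z : Cn m) : ℂ :=
  (1 / 2 : ℂ) *
    (fderiv ℝ F z (stdVec k) + Complex.I * fderiv ℝ F z (Complex.I • stdVec k))

section Metric

variable (m : ℕ) (M : Type*) [TopologicalSpace M] [ChartedSpace (Cn m) M]

/-- The holomorphic tangent space `T'_p M` of a complex manifold of dimension `m`. -/
abbrev Tan (p : M) : Type := TangentSpace 𝓘(ℂ, Cn m) p

variable {m M}

/-- The coordinate vector field `∂/∂z^k` of the chart `e`, at the point with coordinates `z`. -/
def coordVec (e : OpenPartialHomeomorph M (Cn m)) (z : Cn m) (k : Fin m) : Tan m M (e.symm z) :=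
  mfderiv 𝓘(ℂ, Cn m) 𝓘(ℂ, Cn m) e.symm z (stdVec k : Cn m)

/-- The `k`-th component of a tangent vector with respect to the coordinates of the chart `e`. -/
def coordComp (e : OpenPartialHomeomorph M (Cn m)) (p : M) (v : Tan m M p) (k : Fin m) : ℂ :=
  (EuclideanSpace.proj k : Cn m →L[ℂ] ℂ) (mfderiv 𝓘(ℂ, Cn m) 𝓘(ℂ, Cn m) e p v)

variable (m M)

/-- A Hermitian metric on a complex manifold: a positive definite Hermitian form on every
holomorphic tangent space (linear in the first, conjugate linear in the second variable), whose
coefficients `g_{k l̄}` in the charts of the atlas are smooth in the real sense. -/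
structure HermitianMetric where
  toForm : ∀ p : M, Tan m M p →ₗ[ℂ] Tan m M p →ₗ⋆[ℂ] ℂ
  conj_symm : ∀ (p : M) (u v : Tan m M p), toForm p v u = star (toForm p u v)
  pos : ∀ (p : M) (v : Tan m M p), v ≠ 0 → 0 < (toForm p v v).re
  smooth : ∀ e ∈ atlas (Cn m) M, ∀ k l : Fin m,
    ContDiffOn ℝ ∞ (fun z => toForm (e.symm z) (coordVec e z k) (coordVec e z l)) e.target

variable {m M}

/-- The matrix `(g_{k l̄})` of the metric in the chart `e`, as a function of the coordinates. -/
def coeff (g : HermitianMetric m M) (e : OpenPartialHomeomorph M (Cn m)) (z : Cn m) :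
    Matrix (Fin m) (Fin m) ℂ :=
  Matrix.of fun k l => g.toForm (e.symm z) (coordVec e z k) (coordVec e z l)

/-- The inverse coefficients `g^{p q̄}`, normalised by `∑_q g^{p q̄} g_{l q̄} = δ_{pl}`. -/
def invCoeff (g : HermitianMetric m M) (e : OpenPartialHomeomorph M (Cn m)) (z : Cn m)
    (p q : Fin m) : ℂ :=
  (coeff g e z)⁻¹ q p

/-- The real-linear form `dz^k`. -/
def formDz {m : ℕ} (k : Fin m) : Cn m →L[ℝ] ℂ :=
  (EuclideanSpace.proj k : Cn m →L[ℂ] ℂ).restrictScalars ℝ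

/-- The real-linear form `dz̄^k`. -/
def formDzbar {m : ℕ} (k : Fin m) : Cn m →L[ℝ] ℂ :=
  (Complex.conjCLE : ℂ →L[ℝ] ℂ).comp (formDz k)

/-- The two-form `dz^k ∧ dz̄^l`. -/
def wedgeForm {m : ℕ} (k l : Fin m) : Cn m [⋀^Fin 2]→L[ℝ] ℂ :=
  ContinuousMultilinearMap.alternatization
    ((ContinuousMultilinearMap.mkPiAlgebra ℝ (Fin 2) ℂ).compContinuousLinearMap
      ![formDz k, formDzbar l])

/-- The metric form `ω = √-1 ∑ g_{k l̄} dz^k ∧ dz̄^l` in the chart `e`. -/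
def metricForm (g : HermitianMetric m M) (e : OpenPartialHomeomorph M (Cn m)) (z : Cn m) :
    Cn m [⋀^Fin 2]→L[ℝ] ℂ :=
  Complex.I • ∑ k, ∑ l, coeff g e z k l • wedgeForm k l

/-- The metric is Kähler: `dω = 0`. -/
def IsKahler (g : HermitianMetric m M) : Prop :=
  ∀ e ∈ atlas (Cn m) M, ∀ z ∈ e.target, extDeriv (metricForm g e) z = 0

/-- The components
`R_{i j̄ k l̄} = - ∂²g_{k l̄}/∂z^i∂z̄^j + ∑ g^{p q̄} (∂g_{k q̄}/∂z^i) (∂g_{p l̄}/∂z̄^j)`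
of the curvature of the Chern connection in the chart `e`. -/
def chernComp (g : HermitianMetric m M) (e : OpenPartialHomeomorph M (Cn m)) (z : Cn m)
    (i j k l : Fin m) : ℂ :=
  - dz i (fun w => dzbar j (fun w' => coeff g e w' k l) w) z
    + ∑ p, ∑ q, invCoeff g e z p q *
        dz i (fun w => coeff g e w k q) z * dzbar j (fun w => coeff g e w p l) z

/-- The Chern curvature tensor `R(X, Ȳ, Z, W̄)` at `p`, computed in the preferred chart at `p`. -/
def chern (g : HermitianMetric m M) (p : M) (X Y Z W : Tan m M p) : ℂ :=
  ∑ i, ∑ j, ∑ k, ∑ l,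
    chernComp g (chartAt (Cn m) p) (chartAt (Cn m) p p) i j k l *
      coordComp (chartAt (Cn m) p) p X i * star (coordComp (chartAt (Cn m) p) p Y j) *
      coordComp (chartAt (Cn m) p) p Z k * star (coordComp (chartAt (Cn m) p) p W l)

/-- The (first) Chern Ricci curvature `Ric(v, v̄) = ∑ R_{i j̄} v^i v̄^j`, where
`R_{i j̄} = ∑ g^{k l̄} R_{i j̄ k l̄}`. It is a real number. -/
def ricci (g : HermitianMetric m M) (p : M) (v : Tan m M p) : ℝ :=
  (∑ i, ∑ j, (∑ k, ∑ l,
    invCoeff g (chartAt (Cn m) p) (chartAt (Cn m) p p) k l *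
      chernComp g (chartAt (Cn m) p) (chartAt (Cn m) p p) i j k l) *
    coordComp (chartAt (Cn m) p) p v i * star (coordComp (chartAt (Cn m) p) p v j)).re

/-- The Chern scalar curvature `S = ∑ g^{i j̄} g^{k l̄} R_{i j̄ k l̄}`. It is a real number. -/
def scalar (g : HermitianMetric m M) (p : M) : ℝ :=
  (∑ i, ∑ j, ∑ k, ∑ l,
    invCoeff g (chartAt (Cn m) p) (chartAt (Cn m) p p) i j *
    invCoeff g (chartAt (Cn m) p) (chartAt (Cn m) p p) k l *
      chernComp g (chartAt (Cn m) p) (chartAt (Cn m) p p) i j k l).re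

/-- `E` is a unitary family of tangent vectors at `p`. -/
def IsUnitary (g : HermitianMetric m M) (p : M) {ℓ : ℕ} (E : Fin ℓ → Tan m M p) : Prop :=
  ∀ i j, g.toForm p (E i) (E j) = if i = j then 1 else 0

/-- `E` is a unitary basis of the subspace `Σ` of the tangent space at `p`. -/
def IsUnitaryBasis (g : HermitianMetric m M) (p : M) (Sg : Submodule ℂ (Tan m M p)) {ℓ : ℕ}
    (E : Fin ℓ → Tan m M p) : Prop :=
  IsUnitary g p E ∧ Submodule.span ℂ (Set.range E) = Sg

/-- `Ric_ℓ^{(1)}(p, Σ)(v, v̄) = ∑_i R(v, v̄, E_i, Ē_i)` for a unitary basis `E` of `Σ`. -/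
def ric1 (g : HermitianMetric m M) (p : M) {ℓ : ℕ} (E : Fin ℓ → Tan m M p) (v : Tan m M p) : ℝ :=
  (∑ i, chern g p v v (E i) (E i)).re

/-- `Ric_ℓ^{(2)}(p, Σ)(v, v̄) = ∑_i R(E_i, Ē_i, v, v̄)` for a unitary basis `E` of `Σ`. -/
def ric2 (g : HermitianMetric m M) (p : M) {ℓ : ℕ} (E : Fin ℓ → Tan m M p) (v : Tan m M p) : ℝ :=
  (∑ i, chern g p (E i) (E i) v v).re

/-- `S_ℓ(p, Σ) = ∑_{i,j} R(E_i, Ē_i, E_j, Ē_j)` for a unitary basis `E` of `Σ`. -/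
def scal (g : HermitianMetric m M) (p : M) {ℓ : ℕ} (E : Fin ℓ → Tan m M p) : ℝ :=
  (∑ i, ∑ j, chern g p (E i) (E i) (E j) (E j)).re

/-- The real bisectional curvature
`B̃(e, a) = |a|⁻² ∑_{i,j} R(e_i, ē_i, e_j, ē_j) a_i a_j` of a unitary frame `e` at `p`. -/
def realBisec (g : HermitianMetric m M) (p : M) (e : Fin m → Tan m M p) (a : Fin m → ℝ) : ℝ :=
  (1 / ∑ i, a i ^ 2) * ∑ i, ∑ j, (chern g p (e i) (e i) (e j) (e j)).re * a i * a j

/-! Sign conditions. The predicate `P : ℝ → Prop` is one of `0 < ·`, `0 ≤ ·`, `· < 0`, `· ≤ 0`. -/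

/-- The Chern scalar curvature has the sign `P` at every point. -/
def ScalarSign (g : HermitianMetric m M) (P : ℝ → Prop) : Prop :=
  ∀ p : M, P (scalar g p)

/-- The Chern Ricci curvature has the sign `P`, as a Hermitian form at every point. -/
def RicciSign (g : HermitianMetric m M) (P : ℝ → Prop) : Prop :=
  ∀ (p : M) (v : Tan m M p), v ≠ 0 → P (ricci g p v)

/-- `Ric_ℓ^{(1)}` has the sign `P`: for all points `p` and all `ℓ`-dimensional subspaces `Σ` of the
tangent space at `p`, the Hermitian form `Ric_ℓ^{(1)}(p, Σ)` on `Σ` has the sign `P`. -/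
def Ric1Sign (g : HermitianMetric m M) (ℓ : ℕ) (P : ℝ → Prop) : Prop :=
  ∀ (p : M) (Sg : Submodule ℂ (Tan m M p)), Module.finrank ℂ Sg = ℓ →
    ∀ E : Fin ℓ → Tan m M p, IsUnitaryBasis g p Sg E → ∀ v ∈ Sg, v ≠ 0 → P (ric1 g p E v)

/-- `Ric_ℓ^{(2)}` has the sign `P`: for all points `p` and all `ℓ`-dimensional subspaces `Σ` of the
tangent space at `p`, the Hermitian form `Ric_ℓ^{(2)}(p, Σ)` on `Σ` has the sign `P`. -/
def Ric2Sign (g : HermitianMetric m M) (ℓ : ℕ) (P : ℝ → Prop) : Prop :=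
  ∀ (p : M) (Sg : Submodule ℂ (Tan m M p)), Module.finrank ℂ Sg = ℓ →
    ∀ E : Fin ℓ → Tan m M p, IsUnitaryBasis g p Sg E → ∀ v ∈ Sg, v ≠ 0 → P (ric2 g p E v)

/-- `S_ℓ` has the sign `P`: so does `S_ℓ(p, Σ)` for all points `p` and all `ℓ`-dimensional
subspaces `Σ` of the tangent space at `p`. -/
def ScalSign (g : HermitianMetric m M) (ℓ : ℕ) (P : ℝ → Prop) : Prop :=
  ∀ (p : M) (Sg : Submodule ℂ (Tan m M p)), Module.finrank ℂ Sg = ℓ →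
    ∀ E : Fin ℓ → Tan m M p, IsUnitaryBasis g p Sg E → P (scal g p E)

/-- The real bisectional curvature has the sign `P`: so does `B̃(e, a)` for all points, all unitary
frames `e`, and all nonnegative `a ≠ 0`. -/
def RealBisecSign (g : HermitianMetric m M) (P : ℝ → Prop) : Prop :=
  ∀ (p : M) (e : Fin m → Tan m M p), IsUnitary g p e →
    ∀ a : Fin m → ℝ, (∀ i, 0 ≤ a i) → 0 < ∑ i, a i ^ 2 → P (realBisec g p e a)

end Metric

section Maps

/-- The set `A` contains a (nonempty) `d`-dimensional complex submanifold piece: the image of a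
nonempty open set of `ℂ^d` under an injective holomorphic immersion. -/
def ContainsPiece {n : ℕ} {N : Type*} [TopologicalSpace N] [ChartedSpace (Cn n) N]
    (A : Set N) (d : ℕ) : Prop :=
  ∃ (U : Set (Cn d)) (φ : Cn d → N), IsOpen U ∧ U.Nonempty ∧
    ContMDiffOn 𝓘(ℂ, Cn d) 𝓘(ℂ, Cn n) ω φ U ∧ Set.InjOn φ U ∧
    (∀ z ∈ U, Function.Injective (mfderiv 𝓘(ℂ, Cn d) 𝓘(ℂ, Cn n) φ z)) ∧ φ '' U ⊆ A

/-- The complex dimension of a subset of a complex manifold: the largest dimension of a complex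
submanifold contained in it (`⊥` for the empty set). For an analytic subset this is its usual
dimension, the dimension at its regular points of highest dimension. -/
def complexDim {n : ℕ} {N : Type*} [TopologicalSpace N] [ChartedSpace (Cn n) N]
    (A : Set N) : WithBot ℕ∞ :=
  ⨆ (d : ℕ) (_ : ContainsPiece (n := n) A d), ((d : ℕ∞) : WithBot ℕ∞)

/-- A map from an `m`-dimensional to an `n`-dimensional complex manifold is degenerate if the
dimension of its image is less than `m`. -/
def IsDegenerate (m n : ℕ) {M N : Type*} [TopologicalSpace N] [ChartedSpace (Cn n) N]
    (f : M → N) : Prop :=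
  complexDim (n := n) (Set.range f) < ((m : ℕ∞) : WithBot ℕ∞)

/-- The rank of a map: the maximum over all points of the complex rank of its tangent map. -/
def mapRank (m n : ℕ) {M N : Type*} [TopologicalSpace M] [ChartedSpace (Cn m) M]
    [TopologicalSpace N] [ChartedSpace (Cn n) N] (f : M → N) : ℕ∞ :=
  ⨆ x : M, (Module.finrank ℂ
    (LinearMap.range (mfderiv 𝓘(ℂ, Cn m) 𝓘(ℂ, Cn n) f x).toLinearMap) : ℕ∞)

end Maps

end Herm

end

/-! ### The ring of mixed second order jets, and the second order test at an extremum. -/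

noncomputable section
namespace Herm
open Asymptotics Filter Topology
open scoped ComplexConjugate

/-! The proof is a maximum principle on unitary frames. For a frame E of ℓ tangent vectors at a
point of M let G be its Gram matrix for g, and H the Gram matrix for h of its image under the
tangent map f_*. Among all unitary frames over the compact M, choose one where det H (for (a) and
(b)) or tr H (for (c)) is largest, and rotate it so that H = diag(d) (`exists_max_frame`). By
homogeneity, maximality then reads det H ≤ (∏ d_i) det G, or tr(adj G · H) ≤ (∑ d_i) det G, for
every frame with det G ≠ 0, so comparison frames need not be unitary.

Compare with holomorphic fields A_i, A_i(0) = E_i, along a holomorphic disc in direction v, whose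
Chern covariant derivative vanishes at the centre. The z z̄ coefficient of G_ij is -R^M(v, v̄, E_i,
Ē_j); that of H_ij is -R^N(f_*v, f_*v̄, f_*E_i, f_*Ē_j) + ⟨D_i, D_j⟩, where D_i is the covariant
derivative of the image field (`local_gram_jets`). A function with a minimum at the centre has
nonnegative z z̄ coefficient (`HasJet.re_nonneg`), and the D terms have the favourable sign, in the
determinant case by Bessel's inequality. This gives ∑ R^M(v, v̄, E_i, Ē_i) ≤ ∑ d_i⁻¹ R^N(f_*v,
f_*v̄, f_*E_i, f_*Ē_i) (`det_bochner`) and ∑ d_i R^M(v, v̄, E_i, Ē_i) ≤ ∑ R^N(f_*v, f_*v̄, f_*E_i,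
f_*Ē_i) (`trace_bochner`). The computations take place in ℂ[ζ, ζ̄]/(ζ², ζ̄²), where determinants and
adjugates are plain algebra.

If f has rank at least ℓ somewhere, all d_i are positive at the determinant maximum, the e_i =
f_*E_i/√d_i are unitary, and Ric^(1)(E)(v) ≤ Ric^(1)(e)(f_*v) (`exists_ric1_le`). Summing over v =
E_i puts S_ℓ of M on the left; summing over v = E_i/√d_i puts S_ℓ of N on the right. Either sum
contradicts the sign hypotheses. Part (a) is ℓ = m, where contraction over a unitary frame is the
full trace. At the trace maximum, summing over v = E_j gives ∑ d_i Ric^(2)(E)(E_i) ≤ |a|² B̃(e, a),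
with a equal to d padded by zeros; this forces f_* = 0.

Rank below m everywhere yields degeneracy by measure: linear projections to ℂ^m of the image in a
chart are null sets, while a piece of dimension at least m has a projection containing an open set.
-/

/-- Jets `a + b ζ + b' ζ̄ + c ζ ζ̄` modulo `ζ²` and `ζ̄²`. -/
@[ext]
structure Jet where
  a : ℂ
  b : ℂ
  b' : ℂ
  c : ℂ

namespace Jet

instance : Zero Jet := ⟨⟨0, 0, 0, 0⟩⟩
instance : One Jet := ⟨⟨1, 0, 0, 0⟩⟩
instance : Add Jet := ⟨fun p q => ⟨p.a + q.a, p.b + q.b, p.b' + q.b', p.c + q.c⟩⟩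
instance : Neg Jet := ⟨fun p => ⟨-p.a, -p.b, -p.b', -p.c⟩⟩
instance : Mul Jet := ⟨fun p q => ⟨p.a * q.a, p.a * q.b + p.b * q.a, p.a * q.b' + p.b' * q.a,
  p.a * q.c + p.b * q.b' + p.b' * q.b + p.c * q.a⟩⟩

lemma zero_def : (0 : Jet) = ⟨0, 0, 0, 0⟩ := rfl
lemma one_def : (1 : Jet) = ⟨1, 0, 0, 0⟩ := rfl
lemma add_def (p q : Jet) : p + q = ⟨p.a + q.a, p.b + q.b, p.b' + q.b', p.c + q.c⟩ := rfl
lemma neg_def (p : Jet) : -p = ⟨-p.a, -p.b, -p.b', -p.c⟩ := rfl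
lemma mul_def (p q : Jet) : p * q = ⟨p.a * q.a, p.a * q.b + p.b * q.a, p.a * q.b' + p.b' * q.a,
  p.a * q.c + p.b * q.b' + p.b' * q.b + p.c * q.a⟩ := rfl

instance : CommRing Jet where
  add_assoc p q r := by simp only [add_def]; ext <;> ring
  zero_add p := by simp only [add_def, zero_def]; ext <;> ring
  add_zero p := by simp only [add_def, zero_def]; ext <;> ring
  add_comm p q := by simp only [add_def]; ext <;> ring
  neg_add_cancel p := by simp only [add_def, neg_def, zero_def]; ext <;> ring
  mul_assoc p q r := by simp only [mul_def]; ext <;> ring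
  one_mul p := by simp only [mul_def, one_def]; ext <;> ring
  mul_one p := by simp only [mul_def, one_def]; ext <;> ring
  mul_comm p q := by simp only [mul_def]; ext <;> ring
  left_distrib p q r := by simp only [mul_def, add_def]; ext <;> ring
  right_distrib p q r := by simp only [mul_def, add_def]; ext <;> ring
  zero_mul p := by simp only [mul_def, zero_def]; ext <;> ring
  mul_zero p := by simp only [mul_def, zero_def]; ext <;> ring
  nsmul := nsmulRec
  zsmul := zsmulRec

lemma sum_mk {ι : Type*} (s : Finset ι) (a b b' c : ι → ℂ) :
    ∑ i ∈ s, (⟨a i, b i, b' i, c i⟩ : Jet) =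
      ⟨∑ i ∈ s, a i, ∑ i ∈ s, b i, ∑ i ∈ s, b' i, ∑ i ∈ s, c i⟩ := by
  classical
  induction s using Finset.induction_on with
  | empty => rfl
  | insert i s hi ih => simp only [Finset.sum_insert hi, ih, add_def]

/-- Complex conjugation of jets. -/
def bar (q : Jet) : Jet := ⟨star q.a, star q.b', star q.b, star q.c⟩

end Jet

/-- `f` has the jet `q` at `0`: it agrees with `q`, up to multiples of `ζ²` and `ζ̄²`, to second
order. -/
def HasJet (f : ℂ → ℂ) (q : Jet) : Prop :=
  ∃ d e : ℂ, (fun z : ℂ => f z - (q.a + q.b * z + q.b' * conj z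
    + q.c * (z * conj z) + d * z ^ 2 + e * (conj z) ^ 2)) =o[𝓝 0] (fun z : ℂ => z ^ 2)

lemma HasJet.const (c : ℂ) : HasJet (fun _ => c) ⟨c, 0, 0, 0⟩ := by
  refine ⟨0, 0, ?_⟩
  simp

lemma HasJet.id : HasJet (fun z => z) ⟨0, 1, 0, 0⟩ := by
  refine ⟨0, 0, ?_⟩
  simp

lemma HasJet.add {f f' : ℂ → ℂ} {q q' : Jet} (hf : HasJet f q) (hf' : HasJet f' q') :
    HasJet (f + f') (q + q') := by
  obtain ⟨d, e, h1⟩ := hf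
  obtain ⟨d', e', h2⟩ := hf'
  refine ⟨d + d', e + e', (h1.add h2).congr_left fun z => ?_⟩
  simp only [Pi.add_apply, Jet.add_def]
  ring

lemma HasJet.neg {f : ℂ → ℂ} {q : Jet} (hf : HasJet f q) : HasJet (-f) (-q) := by
  obtain ⟨d, e, h1⟩ := hf
  refine ⟨-d, -e, h1.neg_left.congr_left fun z => ?_⟩
  simp only [Pi.neg_apply, Jet.neg_def]
  ring

lemma isBigO_conj_sq : (fun z : ℂ => (conj z) ^ 2) =O[𝓝 0] (fun z : ℂ => z ^ 2) :=
  IsBigO.of_bound 1 (Eventually.of_forall fun z => by simp)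

lemma isBigO_mul_conj : (fun z : ℂ => z * conj z) =O[𝓝 0] (fun z : ℂ => z ^ 2) :=
  IsBigO.of_bound 1 (Eventually.of_forall fun z => by simp [sq])

lemma isLittleO_one_of_continuous {f : ℂ → ℂ} (hf : Continuous f) (h0 : f 0 = 0) :
    f =o[𝓝 0] (fun _ : ℂ => (1 : ℂ)) := by
  rw [isLittleO_one_iff]
  simpa [h0] using hf.tendsto 0

lemma isBigO_one_of_continuous {f : ℂ → ℂ} (hf : Continuous f) :
    f =O[𝓝 0] (fun _ : ℂ => (1 : ℂ)) :=
  (hf.tendsto 0).isBigO_one ℂ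

/-- This is the shape of what the product of two quadratic polynomials in z and z̄ has beyond order
two. -/
lemma isLittleO_sq_of_split {f₁ f₂ f₃ : ℂ → ℂ} (h1 : Continuous f₁) (h2 : Continuous f₂)
    (h3 : Continuous f₃) (k1 : f₁ 0 = 0) (k2 : f₂ 0 = 0) (k3 : f₃ 0 = 0) :
    (fun z : ℂ => z ^ 2 * f₁ z + z * conj z * f₂ z + (conj z) ^ 2 * f₃ z)
      =o[𝓝 0] (fun z : ℂ => z ^ 2) := by
  have a1 := (isBigO_refl (fun z : ℂ => z ^ 2) (𝓝 0)).mul_isLittleO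
    (isLittleO_one_of_continuous h1 k1)
  have a2 := isBigO_mul_conj.mul_isLittleO (isLittleO_one_of_continuous h2 k2)
  have a3 := isBigO_conj_sq.mul_isLittleO (isLittleO_one_of_continuous h3 k3)
  simpa using (a1.add a2).add a3

lemma HasJet.mul {f f' : ℂ → ℂ} {q q' : Jet} (hf : HasJet f q) (hf' : HasJet f' q') :
    HasJet (f * f') (q * q') := by
  obtain ⟨d, e, h1⟩ := hf
  obtain ⟨D, E, h2⟩ := hf'
  set a := q.a with ha
  set b := q.b with hb
  set b' := q.b' with hb'
  set c := q.c with hc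
  set A := q'.a with hA
  set B := q'.b with hB
  set B' := q'.b' with hB'
  set C := q'.c with hC
  set P : ℂ → ℂ := fun z => a + b * z + b' * conj z + c * (z * conj z) + d * z ^ 2
    + e * (conj z) ^ 2 with hP
  set Q : ℂ → ℂ := fun z => A + B * z + B' * conj z + C * (z * conj z) + D * z ^ 2
    + E * (conj z) ^ 2 with hQ
  have cP : Continuous P := by fun_prop
  have cQ : Continuous Q := by fun_prop
  -- Uses f f' = P Q + (f - P) Q + P (f' - Q) + (f - P)(f' - Q): the last three terms are small
  -- here, and `k4` treats P Q.
  have k1 : (fun z => (f z - P z) * Q z) =o[𝓝 0] (fun z : ℂ => z ^ 2) := by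
    simpa using h1.mul_isBigO (isBigO_one_of_continuous cQ)
  have k2 : (fun z => P z * (f' z - Q z)) =o[𝓝 0] (fun z : ℂ => z ^ 2) := by
    simpa using (isBigO_one_of_continuous cP).mul_isLittleO h2
  have k3 : (fun z => (f z - P z) * (f' z - Q z)) =o[𝓝 0] (fun z : ℂ => z ^ 2) := by
    have := h1.mul_isBigO (h2.isBigO.trans (isBigO_one_of_continuous (f := fun z => z ^ 2)
      (by fun_prop)))
    simpa using this
  -- The terms of order three and four in P Q, sorted by a factor z², z z̄ or z̄².
  have k4 := isLittleO_sq_of_split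
    (f₁ := fun z => d * (B * z + B' * conj z + C * (z * conj z) + D * z ^ 2 + E * (conj z) ^ 2)
      + D * (b * z + b' * conj z))
    (f₂ := fun z => c * (B * z + B' * conj z + C * (z * conj z) + D * z ^ 2 + E * (conj z) ^ 2)
      + C * (b * z + b' * conj z))
    (f₃ := fun z => e * (B * z + B' * conj z + C * (z * conj z) + D * z ^ 2 + E * (conj z) ^ 2)
      + E * (b * z + b' * conj z))
    (by fun_prop) (by fun_prop) (by fun_prop) (by simp) (by simp) (by simp)
  refine ⟨a * D + b * B + d * A, a * E + b' * B' + e * A,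
    (((k1.add k2).add k3).add k4).congr_left fun z => ?_⟩
  simp only [Pi.mul_apply, Jet.mul_def, ← ha, ← hb, ← hb', ← hc, ← hA,
    ← hB, ← hB', ← hC, hP, hQ]
  ring

lemma HasJet.conj {f : ℂ → ℂ} {q : Jet} (hf : HasJet f q) :
    HasJet (fun z => conj (f z)) q.bar := by
  obtain ⟨d, e, h1⟩ := hf
  refine ⟨star e, star d, ?_⟩
  have h2 : (fun z => conj (f z - (q.a + q.b * z + q.b' * conj z
    + q.c * (z * conj z) + d * z ^ 2 + e * (conj z) ^ 2))) =o[𝓝 0] (fun z : ℂ => z ^ 2) := by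
    rw [← isLittleO_norm_left] at h1 ⊢
    simpa only [RCLike.norm_conj] using h1
  refine h2.congr_left fun z => ?_
  simp only [Jet.bar, map_add, map_sub, map_mul, map_pow,
    Complex.conj_conj, RCLike.star_def]
  ring

/-- The functions with a jet, together with their jets, form a ring. -/
def jetRing : Subring ((ℂ → ℂ) × Jet) where
  carrier := {p | HasJet p.1 p.2}
  mul_mem' := fun h h' => HasJet.mul h h'
  add_mem' := fun h h' => HasJet.add h h'
  neg_mem' := fun h => HasJet.neg h
  zero_mem' := HasJet.const 0
  one_mem' := HasJet.const 1

lemma HasJet.sum {ι : Type*} (s : Finset ι) {f : ι → ℂ → ℂ} {q : ι → Jet}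
    (h : ∀ i ∈ s, HasJet (f i) (q i)) : HasJet (fun z => ∑ i ∈ s, f i z) (∑ i ∈ s, q i) := by
  have := jetRing.sum_mem (t := s) (f := fun i => (f i, q i)) h
  have h2 : HasJet (∑ i ∈ s, (f i, q i)).1 (∑ i ∈ s, (f i, q i)).2 := this
  rw [Prod.fst_sum, Prod.snd_sum] at h2
  convert h2 using 1
  ext z
  simp

section Matrix
variable {ι : Type*} [Fintype ι] [DecidableEq ι]

/-- Evaluation of an element of the ring of functions with jets. -/
def jetEval (z : ℂ) : jetRing →+* ℂ :=
  (Pi.evalRingHom (fun _ : ℂ => ℂ) z).comp ((RingHom.fst (ℂ → ℂ) Jet).comp jetRing.subtype)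

/-- The jet of an element of the ring of functions with jets. -/
def jetOf : jetRing →+* Jet := (RingHom.snd (ℂ → ℂ) Jet).comp jetRing.subtype

lemma hasJet_jetOf (p : jetRing) : HasJet (fun z => jetEval z p) (jetOf p) := p.2

/-- Ring homomorphisms commute with determinants: form the determinant over `jetRing`, then apply
`jetEval z` and `jetOf`. -/
lemma HasJet.det {G : ℂ → Matrix ι ι ℂ} {Q : Matrix ι ι Jet}
    (h : ∀ i j, HasJet (fun z => G z i j) (Q i j)) : HasJet (fun z => (G z).det) Q.det := by
  let A : Matrix ι ι jetRing := fun i j => ⟨(fun z => G z i j, Q i j), h i j⟩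
  have h1 := hasJet_jetOf A.det
  have e1 : ∀ z, jetEval z A.det = (G z).det := fun z => (jetEval z).map_det A
  have e2 : jetOf A.det = Q.det := RingHom.map_det jetOf A
  simpa only [e1, e2] using h1

/-- The adjugate stands in for the inverse because it is polynomial in the entries, so ring
homomorphisms preserve it without any invertibility. -/
lemma HasJet.trace_adjugate_mul {G H : ℂ → Matrix ι ι ℂ} {Q P : Matrix ι ι Jet}
    (h : ∀ i j, HasJet (fun z => G z i j) (Q i j)) (h' : ∀ i j, HasJet (fun z => H z i j) (P i j)) :
    HasJet (fun z => ((G z).adjugate * H z).trace) (Q.adjugate * P).trace := by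
  let A : Matrix ι ι jetRing := fun i j => ⟨(fun z => G z i j, Q i j), h i j⟩
  let B : Matrix ι ι jetRing := fun i j => ⟨(fun z => H z i j, P i j), h' i j⟩
  have h1 := hasJet_jetOf (A.adjugate * B).trace
  have key : ∀ {R : Type} [CommRing R] (φ : jetRing →+* R),
      φ (A.adjugate * B).trace = ((φ.mapMatrix A).adjugate * φ.mapMatrix B).trace := by
    intro R _ φ
    have e1 : (φ.mapMatrix A).adjugate = φ.mapMatrix A.adjugate := (φ.map_adjugate A).symm
    rw [e1, ← map_mul]
    exact AddMonoidHom.map_trace φ _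
  have e1 : ∀ z, jetEval z (A.adjugate * B).trace = ((G z).adjugate * H z).trace :=
    fun z => key (jetEval z)
  have e2 : jetOf (A.adjugate * B).trace = (Q.adjugate * P).trace := key jetOf
  simpa only [e1, e2] using h1

end Matrix

/-- Summing f over t, -t, it, -it with t real cancels the linear terms and the z², z̄² terms. Only 4
q.c t² survives, up to o(t²). This is why jets may forget z² and z̄². -/
lemma HasJet.re_nonneg {f : ℂ → ℂ} {q : Jet} (hf : HasJet f q) (h0 : q.a.re = 0)
    (hpos : ∀ᶠ z in 𝓝 0, 0 ≤ (f z).re) : 0 ≤ q.c.re := by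
  obtain ⟨d, e, h1⟩ := hf
  set r : ℂ → ℂ := fun z => f z - (q.a + q.b * z + q.b' * conj z
    + q.c * (z * conj z) + d * z ^ 2 + e * (conj z) ^ 2) with hr
  by_contra! hc
  -- Any fraction of `-q.c.re` below 1 would do: the four errors must stay smaller than the main
  -- term.
  have h2 := h1.bound (c := -q.c.re / 8) (by linarith)
  have h3 : ∀ᶠ z : ℂ in 𝓝 0, ‖r z‖ ≤ -q.c.re / 8 * ‖z‖ ^ 2 ∧ 0 ≤ (f z).re := by
    filter_upwards [h2, hpos] with z hz hz'
    simp only [norm_pow] at hz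
    exact ⟨hz, hz'⟩
  obtain ⟨δ, hδ, hball⟩ := Metric.eventually_nhds_iff.1 h3
  have hb : ∀ z : ℂ, ‖z‖ = δ / 2 → ‖r z‖ ≤ -q.c.re / 8 * (δ / 2) ^ 2 ∧ 0 ≤ (f z).re := by
    intro z hz
    rw [← hz]
    exact hball (by rw [dist_zero_right, hz]; linarith)
  have hn : ‖((δ / 2 : ℝ) : ℂ)‖ = δ / 2 := by
    rw [Complex.norm_real, Real.norm_of_nonneg (by linarith)]
  set t : ℂ := ((δ / 2 : ℝ) : ℂ) with ht
  obtain ⟨a1, b1⟩ := hb t hn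
  obtain ⟨a2, b2⟩ := hb (-t) (by simpa using hn)
  obtain ⟨a3, b3⟩ := hb (Complex.I * t) (by simpa using hn)
  obtain ⟨a4, b4⟩ := hb (-(Complex.I * t)) (by simpa using hn)
  have hct : conj t = t := by rw [ht, Complex.conj_ofReal]
  have hsum : f t + f (-t) + f (Complex.I * t) + f (-(Complex.I * t)) =
      4 * q.a + 4 * (q.c * (t * t)) + (r t + r (-t) + r (Complex.I * t)
        + r (-(Complex.I * t))) := by
    simp only [hr, map_neg, map_mul, hct, Complex.conj_I]
    linear_combination (2 * (d + e) - 2 * q.c) * t ^ 2 * Complex.I_mul_I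
  have hre := congrArg Complex.re hsum
  have htt : (q.c * (t * t)).re = q.c.re * (δ / 2) ^ 2 := by
    rw [ht, ← Complex.ofReal_mul, Complex.re_mul_ofReal]; ring
  have e4 : (4 : ℂ) = ((4 : ℝ) : ℂ) := by norm_num
  simp only [Complex.add_re] at hre
  rw [e4, Complex.re_ofReal_mul, Complex.re_ofReal_mul, h0, htt] at hre
  have n1 := (Complex.re_le_norm (r t)).trans a1
  have n2 := (Complex.re_le_norm (r (-t))).trans a2
  have n3 := (Complex.re_le_norm (r (Complex.I * t))).trans a3
  have n4 := (Complex.re_le_norm (r (-(Complex.I * t)))).trans a4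
  have : 0 < (δ / 2) ^ 2 := by positivity
  nlinarith

end Herm

end

/-! ### Taylor expansion, and jets of smooth and holomorphic functions along discs. -/

noncomputable section
namespace Herm
open Asymptotics Filter Topology
open scoped ComplexConjugate

/-- Second order Taylor expansion of a `C²` function. -/
lemma taylor_two {V W : Type*} [NormedAddCommGroup V] [NormedSpace ℝ V] [NormedAddCommGroup W]
    [NormedSpace ℝ W] {f : V → W} {x₀ : V} (hf : ContDiffAt ℝ 2 f x₀) :
    (fun x => f x - f x₀ - fderiv ℝ f x₀ (x - x₀)
      - (1 / 2 : ℝ) • fderiv ℝ (fderiv ℝ f) x₀ (x - x₀) (x - x₀)) =o[𝓝 x₀]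
      fun x => ‖x - x₀‖ ^ 2 := by
  have hsymm : IsSymmSndFDerivAt ℝ f x₀ := hf.isSymmSndFDerivAt (by simp)
  set B := fderiv ℝ (fderiv ℝ f) x₀ with hB
  set A := fderiv ℝ f x₀ with hA
  have hd : ∀ᶠ x in 𝓝 x₀, DifferentiableAt ℝ f x := by
    have h1 := hf.eventually (by simp)
    filter_upwards [h1] with x hx using hx.differentiableAt two_ne_zero
  obtain ⟨δ, hδ, hball⟩ := Metric.eventually_nhds_iff_ball.1 hd
  have hB' : HasFDerivAt (fderiv ℝ f) B x₀ :=
    ((hf.fderiv_right (m := 1) (by norm_num)).differentiableAt one_ne_zero).hasFDerivAt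
  -- By symmetry of B, half of B(x - x₀, x - x₀) has derivative B(x - x₀). The remainder thus has
  -- derivative o(‖x - x₀‖) and, on a convex ball, is o(‖x - x₀‖²).
  have hder : ∀ x ∈ Metric.ball x₀ δ, HasFDerivWithinAt
      (fun x => f x - f x₀ - A (x - x₀) - (1 / 2 : ℝ) • B (x - x₀) (x - x₀))
      (fderiv ℝ f x - A - B (x - x₀)) (Metric.ball x₀ δ) x := by
    intro x hx
    have h1 := (hball x hx).hasFDerivAt
    have h2 : HasFDerivAt (fun x => x - x₀) (ContinuousLinearMap.id ℝ V) x :=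
      (hasFDerivAt_id x).sub_const x₀
    have h3 : HasFDerivAt (fun x => A (x - x₀)) (A.comp (ContinuousLinearMap.id ℝ V)) x :=
      A.hasFDerivAt.comp x h2
    have h4 := (B.hasFDerivAt.comp x h2).clm_apply h2
    have h5 := ((h1.sub_const (f x₀)).sub h3).sub (h4.const_smul (1 / 2 : ℝ))
    refine (h5.congr_fderiv ?_).hasFDerivWithinAt
    ext v
    have hs : B v (x - x₀) = B (x - x₀) v := hsymm v (x - x₀)
    simp only [_root_.sub_apply, ContinuousLinearMap.comp_apply,
      _root_.smul_apply, _root_.add_apply, ContinuousLinearMap.flip_apply,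
      ContinuousLinearMap.id_apply, Function.comp_apply, hs]
    rw [← two_smul ℝ, smul_smul]
    norm_num
  have hlo : (fun x => fderiv ℝ f x - A - B (x - x₀)) =o[𝓝[Metric.ball x₀ δ] x₀]
      fun x => ‖x - x₀‖ ^ 1 := by
    simpa using (hB'.isLittleO.norm_right).mono nhdsWithin_le_nhds
  have := (convex_ball x₀ δ).isLittleO_pow_succ (Metric.mem_ball_self hδ) hder hlo
  rw [nhdsWithin_eq_nhds.2 (Metric.ball_mem_nhds x₀ hδ)] at this
  simpa using this

section Disc

variable {V : Type*} [NormedAddCommGroup V] [NormedSpace ℂ V] [NormedSpace ℝ V]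
  [IsScalarTower ℝ ℂ V]

/-- The complex linear part `(φ(v) - i φ(i v)) / 2` of a real linear map. -/
def linPart (φ : V →L[ℝ] ℂ) (v : V) : ℂ := (1 / 2 : ℂ) * (φ v - Complex.I * φ (Complex.I • v))

/-- The conjugate linear part `(φ(v) + i φ(i v)) / 2` of a real linear map. -/
def conjPart (φ : V →L[ℝ] ℂ) (v : V) : ℂ := (1 / 2 : ℂ) * (φ v + Complex.I * φ (Complex.I • v))

lemma complex_smul_eq (z : ℂ) (v : V) : z • v = z.re • v + z.im • (Complex.I • v) := by
  conv_lhs => rw [← Complex.re_add_im z]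
  rw [add_smul, mul_smul, ← algebraMap_smul ℂ z.re v, ← algebraMap_smul ℂ z.im (Complex.I • v)]
  rfl

lemma map_smul_eq_parts (φ : V →L[ℝ] ℂ) (z : ℂ) (v : V) :
    φ (z • v) = linPart φ v * z + conjPart φ v * conj z := by
  rw [complex_smul_eq z v, map_add, map_smul, map_smul, linPart, conjPart, Complex.real_smul,
    Complex.real_smul]
  have h1 : z = z.re + z.im * Complex.I := (Complex.re_add_im z).symm
  have h2 : conj z = z.re - z.im * Complex.I := by apply Complex.ext <;> simp
  conv_rhs => rw [h2, h1]
  simp only [Complex.add_re, Complex.ofReal_re, Complex.mul_re, Complex.I_re, mul_zero,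
    Complex.ofReal_im, Complex.I_im, mul_one, sub_self, add_zero, Complex.add_im, Complex.mul_im,
    zero_add]
  linear_combination ((z.im : ℂ) * φ (Complex.I • v)) * Complex.I_mul_I

/-- `∂∂̄` of a real bilinear form along `v`. -/
def mixedPart (B : V →L[ℝ] V →L[ℝ] ℂ) (v : V) : ℂ :=
  (1 / 4 : ℂ) * (B v v + B (Complex.I • v) (Complex.I • v))

/-- Splitting into types: the (1,1) part is explicit, and the (2,0) and (0,2) parts go into d and e,
which jets ignore. -/
lemma bilin_smul_smul_eq_parts (B : V →L[ℝ] V →L[ℝ] ℂ) (v : V) :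
    ∃ d e : ℂ, ∀ z : ℂ, (1 / 2 : ℝ) • B (z • v) (z • v) =
      mixedPart B v * (z * conj z) + d * z ^ 2 + e * (conj z) ^ 2 := by
  set w := Complex.I • v with hw
  refine ⟨(1 / 8 : ℂ) * (B v v - B w w - Complex.I * (B v w + B w v)),
    (1 / 8 : ℂ) * (B v v - B w w + Complex.I * (B v w + B w v)), fun z => ?_⟩
  rw [complex_smul_eq z v, ← hw, mixedPart, ← hw]
  simp only [map_add, map_smul, _root_.add_apply, _root_.smul_apply,
    Complex.real_smul]
  have h1 : z = z.re + z.im * Complex.I := (Complex.re_add_im z).symm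
  have h2 : conj z = z.re - z.im * Complex.I := by apply Complex.ext <;> simp
  generalize hx : (z.re : ℂ) = x at *
  generalize hy : (z.im : ℂ) = y at *
  rw [h2, h1]
  push_cast
  linear_combination ((B v v - B w w) / 4 * -y ^ 2 + y ^ 2 / 4 * (B v v + B w w)
    + (x * y / 2) * (B v w + B w v)) * Complex.I_mul_I

/-- The jet of a `C²` function along a holomorphic disc. -/
lemma HasJet.comp_disc {f : V → ℂ} {w : ℂ → V} {w₀ w₁ w₂ : V} (hf : ContDiffAt ℝ 2 f w₀)
    (hw : (fun z : ℂ => w z - (w₀ + z • w₁ + z ^ 2 • w₂)) =o[𝓝 0] fun z : ℂ => z ^ 2) :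
    HasJet (fun z => f (w z)) ⟨f w₀, linPart (fderiv ℝ f w₀) w₁, conjPart (fderiv ℝ f w₀) w₁,
      mixedPart (fderiv ℝ (fderiv ℝ f) w₀) w₁⟩ := by
  set A := fderiv ℝ f w₀ with hA
  set B := fderiv ℝ (fderiv ℝ f) w₀ with hB
  obtain ⟨d, e, hde⟩ := bilin_smul_smul_eq_parts B w₁
  set r : ℂ → V := fun z : ℂ => w z - (w₀ + z • w₁ + z ^ 2 • w₂) with hr
  have hid : (fun z : ℂ => z) =O[𝓝 0] (fun _ : ℂ => (1 : ℂ)) :=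
    isBigO_one_of_continuous continuous_id
  have sq_id : (fun z : ℂ => z ^ 2) =O[𝓝 0] (fun z : ℂ => z) := by
    simpa [sq] using (isBigO_refl (fun z : ℂ => z) (𝓝 0)).mul hid
  have hz1 : ∀ u : V, (fun z : ℂ => z • u) =O[𝓝 0] (fun z : ℂ => z) := fun u =>
    IsBigO.of_bound ‖u‖ (Eventually.of_forall fun z => by rw [norm_smul, mul_comm])
  have hz2 : ∀ u : V, (fun z : ℂ => z ^ 2 • u) =O[𝓝 0] (fun z : ℂ => z ^ 2) := fun u =>
    IsBigO.of_bound ‖u‖ (Eventually.of_forall fun z => by rw [norm_smul, mul_comm])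
  have hs : (fun z : ℂ => z ^ 2 • w₂ + r z) =O[𝓝 0] fun z : ℂ => z ^ 2 := (hz2 w₂).add hw.isBigO
  have hΔ : (fun z : ℂ => w z - w₀) =O[𝓝 0] fun z : ℂ => z := by
    refine ((hz1 w₁).add (hs.trans sq_id)).congr_left fun z => ?_
    simp only [hr]; abel
  have hten : Tendsto w (𝓝 0) (𝓝 w₀) := by
    have h1 : Tendsto (fun z : ℂ => w z - w₀) (𝓝 0) (𝓝 0) :=
      hΔ.trans_tendsto (tendsto_id)
    simpa using h1.add_const w₀
  have t1 : (fun z => f (w z) - f w₀ - A (w z - w₀) - (1 / 2 : ℝ) • B (w z - w₀) (w z - w₀))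
      =o[𝓝 0] fun z : ℂ => z ^ 2 := by
    refine ((taylor_two hf).comp_tendsto hten).trans_isBigO ?_
    simpa [Function.comp_def] using (hΔ.norm_left.pow 2)
  have hAr : (fun z => A (r z)) =o[𝓝 0] fun z : ℂ => z ^ 2 :=
    (A.isBigO_comp r (𝓝 0)).trans_isLittleO hw
  have hBB : ∀ {u u' : ℂ → V} {g g' : ℂ → ℂ}, u =O[𝓝 0] g → u' =O[𝓝 0] g' →
      (fun z => B (u z) (u' z)) =O[𝓝 0] fun z => g z * g' z := by
    intro u u' g g' h1 h2
    refine IsBigO.trans (IsBigO.of_bound ‖B‖ (Eventually.of_forall fun z => ?_))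
      (h1.norm_norm.mul h2.norm_norm |>.trans (IsBigO.of_bound 1 (Eventually.of_forall fun z => ?_)))
    · simpa [mul_assoc] using B.le_opNorm₂ (u z) (u' z)
    · simp
  have hcube : (fun z : ℂ => z * z ^ 2) =o[𝓝 0] fun z : ℂ => z ^ 2 := by
    simpa using (isLittleO_one_of_continuous (f := fun z => z) continuous_id rfl).mul_isBigO
      (isBigO_refl (fun z : ℂ => z ^ 2) (𝓝 0))
  have b1 : (fun z => B (z • w₁) (z ^ 2 • w₂ + r z)) =o[𝓝 0] fun z : ℂ => z ^ 2 :=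
    (hBB (hz1 w₁) hs).trans_isLittleO hcube
  have b2 : (fun z => B (z ^ 2 • w₂ + r z) (w z - w₀)) =o[𝓝 0] fun z : ℂ => z ^ 2 :=
    (hBB hs hΔ).trans_isLittleO (by simpa only [mul_comm] using hcube)
  -- The second order coefficient w₂ of the disc enters only the z² and z̄² terms, so the jet
  -- depends on w₀ and w₁ alone.
  refine ⟨linPart A w₂ + d, conjPart A w₂ + e,
    ((t1.add hAr).add ((b1.add b2).const_smul_left (1 / 2 : ℝ))).congr_left fun z => ?_⟩
  have e1 : w z - w₀ = z • w₁ + (z ^ 2 • w₂ + r z) := by simp only [hr]; abel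
  have e2 : A (w z - w₀) = A (z • w₁) + A (z ^ 2 • w₂) + A (r z) := by
    rw [e1, map_add, map_add, add_assoc]
  have e3 : B (w z - w₀) (w z - w₀) = B (z • w₁) (z • w₁) + (B (z • w₁) (z ^ 2 • w₂ + r z)
      + B (z ^ 2 • w₂ + r z) (w z - w₀)) := by
    nth_rewrite 1 [e1]
    rw [map_add, _root_.add_apply]
    nth_rewrite 1 [e1]
    rw [map_add, add_assoc]
  rw [e2, e3, smul_add, hde z, map_smul_eq_parts A z w₁, map_smul_eq_parts A (z ^ 2) w₂, map_pow, Pi.smul_apply]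
  ring

end Disc

/-- The jet of a holomorphic function. -/
lemma HasJet.of_analyticAt {f : ℂ → ℂ} (hf : AnalyticAt ℂ f 0) :
    HasJet f ⟨f 0, deriv f 0, 0, 0⟩ := by
  have h := HasJet.comp_disc (f := f) (w := fun z : ℂ => z) (w₀ := 0) (w₁ := 1) (w₂ := 0)
    ((hf.contDiffAt (n := 2)).restrict_scalars ℝ) (by simp)
  have h1 : ∀ᶠ z in 𝓝 0, fderiv ℝ f z = (fderiv ℂ f z).restrictScalars ℝ := by
    filter_upwards [hf.eventually_analyticAt] with z hz
    exact hz.differentiableAt.fderiv_restrictScalars ℝ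
  have h2 := Filter.Eventually.self_of_nhds h1
  -- The second derivative is complex bilinear, so its value at (i, i) is minus its value at (1, 1).
  have h3 : fderiv ℝ (fderiv ℝ f) 0 1 1 + fderiv ℝ (fderiv ℝ f) 0 Complex.I Complex.I = 0 := by
    rw [Filter.EventuallyEq.fderiv_eq h1]
    have h4 : HasFDerivAt (fun z => (fderiv ℂ f z).restrictScalars ℝ)
        ((ContinuousLinearMap.restrictScalarsL ℂ ℂ ℂ ℝ ℝ).comp
          ((fderiv ℂ (fderiv ℂ f) 0).restrictScalars ℝ)) 0 := by
      refine (ContinuousLinearMap.restrictScalarsL ℂ ℂ ℂ ℝ ℝ).hasFDerivAt.comp (0 : ℂ) ?_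
      exact (hf.fderiv.differentiableAt.hasFDerivAt).restrictScalars ℝ
    rw [h4.fderiv]
    have e : ∀ B : ℂ →L[ℂ] ℂ →L[ℂ] ℂ, B 1 1 + B Complex.I Complex.I = 0 := by
      intro B
      have : B Complex.I Complex.I = Complex.I • (Complex.I • B 1 1) := by
        rw [← map_smul, ← _root_.smul_apply, ← map_smul]
        simp
      rw [this, smul_smul, Complex.I_mul_I]
      simp
    exact e _
  have hI : (fderiv ℂ f 0) Complex.I = Complex.I * deriv f 0 := by
    rw [← fderiv_apply_one_eq_deriv, ← smul_eq_mul, ← map_smul]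
    simp
  convert h using 2
  · simp [linPart, h2, hI]
    linear_combination (1 / 2 * deriv f 0) * Complex.I_mul_I
  · simp [conjPart, h2, hI]
    linear_combination (deriv f 0) * Complex.I_mul_I
  · simp [mixedPart, h3]

end Herm

end

/-! ### Wirtinger derivatives as complex linear and conjugate linear parts. -/

noncomputable section
namespace Herm
open Asymptotics Filter Topology
open scoped ComplexConjugate

section Parts

variable {V : Type*} [NormedAddCommGroup V] [NormedSpace ℂ V] [NormedSpace ℝ V]

lemma linPart_add (φ : V →L[ℝ] ℂ) (u v : V) : linPart φ (u + v) = linPart φ u + linPart φ v := by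
  simp only [linPart, smul_add, map_add]; ring

lemma conjPart_add (φ : V →L[ℝ] ℂ) (u v : V) :
    conjPart φ (u + v) = conjPart φ u + conjPart φ v := by
  simp only [conjPart, smul_add, map_add]; ring

end Parts

section Disc

variable {V : Type*} [NormedAddCommGroup V] [NormedSpace ℂ V] [NormedSpace ℝ V]
  [IsScalarTower ℝ ℂ V]

lemma linPart_smul (φ : V →L[ℝ] ℂ) (c : ℂ) (v : V) : linPart φ (c • v) = c * linPart φ v := by
  rw [linPart, smul_smul, map_smul_eq_parts, map_smul_eq_parts, map_mul, Complex.conj_I]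
  linear_combination (-(1 / 2 : ℂ) * (c * linPart φ v - conj c * conjPart φ v)) * Complex.I_mul_I

lemma conjPart_smul (φ : V →L[ℝ] ℂ) (c : ℂ) (v : V) :
    conjPart φ (c • v) = star c * conjPart φ v := by
  rw [conjPart, smul_smul, map_smul_eq_parts, map_smul_eq_parts, map_mul, Complex.conj_I,
    Complex.star_def]
  linear_combination ((1 / 2 : ℂ) * (c * linPart φ v - conj c * conjPart φ v)) * Complex.I_mul_I

lemma linPart_sum (φ : V →L[ℝ] ℂ) {ι : Type*} (s : Finset ι) (c : ι → ℂ) (u : ι → V) :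
    linPart φ (∑ i ∈ s, c i • u i) = ∑ i ∈ s, c i * linPart φ (u i) := by
  classical
  induction s using Finset.induction_on with
  | empty => simp [linPart]
  | insert i s hi ih => simp only [Finset.sum_insert hi, linPart_add, linPart_smul, ih]

lemma conjPart_sum (φ : V →L[ℝ] ℂ) {ι : Type*} (s : Finset ι) (c : ι → ℂ) (u : ι → V) :
    conjPart φ (∑ i ∈ s, c i • u i) = ∑ i ∈ s, star (c i) * conjPart φ (u i) := by
  classical
  induction s using Finset.induction_on with
  | empty => simp [conjPart]
  | insert i s hi ih => simp only [Finset.sum_insert hi, conjPart_add, conjPart_smul, ih]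

end Disc

section Coord

variable {m : ℕ}

lemma sum_smul_stdVec (v : Cn m) : ∑ i, v i • (stdVec i : Cn m) = v := by
  ext k
  simp [Pi.single_apply]

lemma dz_eq (k : Fin m) (F : Cn m → ℂ) (z : Cn m) : dz k F z = linPart (fderiv ℝ F z) (stdVec k) :=
  rfl

lemma sum_dz (F : Cn m → ℂ) (z v : Cn m) : ∑ i, v i * dz i F z = linPart (fderiv ℝ F z) v := by
  conv_rhs => rw [← sum_smul_stdVec v, linPart_sum]
  rfl

lemma sum_dzbar (F : Cn m → ℂ) (z v : Cn m) :
    ∑ i, star (v i) * dzbar i F z = conjPart (fderiv ℝ F z) v := by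
  conv_rhs => rw [← sum_smul_stdVec v, conjPart_sum]
  rfl

lemma dz_dzbar {F : Cn m → ℂ} {z : Cn m} (hF : ContDiffAt ℝ 2 F z) (i j : Fin m) :
    dz i (fun w => dzbar j F w) z = (1 / 2 : ℂ) *
      (conjPart (fderiv ℝ (fderiv ℝ F) z (stdVec i)) (stdVec j)
        - Complex.I * conjPart (fderiv ℝ (fderiv ℝ F) z (Complex.I • stdVec i)) (stdVec j)) := by
  have h1 : HasFDerivAt (fderiv ℝ F) (fderiv ℝ (fderiv ℝ F) z) z :=
    ((hF.fderiv_right (m := 1) (by norm_num)).differentiableAt one_ne_zero).hasFDerivAt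
  have h2 : ∀ u : Cn m, HasFDerivAt (fun w => fderiv ℝ F w u)
      ((fderiv ℝ (fderiv ℝ F) z).flip u) z := by
    intro u
    have := h1.clm_apply (hasFDerivAt_const u z)
    refine this.congr_fderiv ?_
    ext x
    simp
  have h3 : HasFDerivAt (fun w => dzbar j F w) ((1 / 2 : ℂ) •
      ((fderiv ℝ (fderiv ℝ F) z).flip (stdVec j)
        + Complex.I • (fderiv ℝ (fderiv ℝ F) z).flip (Complex.I • stdVec j))) z := by
    have h := ((h2 (stdVec j)).add ((h2 (Complex.I • stdVec j)).const_smul Complex.I)).const_smul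
      (1 / 2 : ℂ)
    exact h
  rw [dz_eq, h3.fderiv]
  simp only [linPart, conjPart, _root_.smul_apply, _root_.add_apply, ContinuousLinearMap.flip_apply,
    smul_eq_mul]

/-- Contraction with v^i v̄^j turns coordinate derivatives into ∂∂̄ along the disc in direction v;
the cross terms cancel by symmetry of the second derivative. It links the curvature components to
`mixedMat`. -/
lemma sum_dz_dzbar {F : Cn m → ℂ} {z : Cn m} (hF : ContDiffAt ℝ 2 F z) (v : Cn m) :
    ∑ i, ∑ j, v i * star (v j) * dz i (fun w => dzbar j F w) z =
      mixedPart (fderiv ℝ (fderiv ℝ F) z) v := by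
  set B := fderiv ℝ (fderiv ℝ F) z with hB
  have hsymm : IsSymmSndFDerivAt ℝ F z := hF.isSymmSndFDerivAt (by simp)
  have h1 : ∀ i, ∑ j, v i * star (v j) * dz i (fun w => dzbar j F w) z =
      v i * ((1 / 2 : ℂ) * (conjPart (B (stdVec i)) v
        - Complex.I * conjPart (B (Complex.I • stdVec i)) v)) := by
    intro i
    have e : ∀ φ : Cn m →L[ℝ] ℂ, conjPart φ v = ∑ j, star (v j) * conjPart φ (stdVec j) := by
      intro φ
      conv_lhs => rw [← sum_smul_stdVec v, conjPart_sum]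
    rw [e, e, Finset.mul_sum, ← Finset.sum_sub_distrib, Finset.mul_sum, Finset.mul_sum]
    refine Finset.sum_congr rfl fun j _ => ?_
    rw [dz_dzbar hF]
    ring
  let ψ : Cn m →L[ℝ] ℂ := (1 / 2 : ℂ) • (B.flip v + Complex.I • B.flip (Complex.I • v))
  have h2 : ∀ u, conjPart (B u) v = ψ u := fun u => rfl
  have h3 : linPart ψ v = ∑ i, v i * linPart ψ (stdVec i) := by
    conv_lhs => rw [← sum_smul_stdVec v, linPart_sum]
  have h4 : linPart ψ v = mixedPart B v := by
    have hs : B v (Complex.I • v) = B (Complex.I • v) v := hsymm _ _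
    simp only [linPart, mixedPart, ← h2, conjPart, hs]
    linear_combination (-(1 / 4 : ℂ) * B (Complex.I • v) (Complex.I • v)) * Complex.I_mul_I
  rw [← h4, h3]
  refine Finset.sum_congr rfl fun i _ => ?_
  rw [h1 i]
  rfl

end Coord

/-! ### Sesquilinear forms, and Gram entries of holomorphic fields along a disc. -/

section Sesq

open Matrix

variable {ι : Type*} [Fintype ι]

/-- The sesquilinear form `∑ M_{kl} a_k b̄_l` of a matrix. -/
def sesq (M : Matrix ι ι ℂ) (a b : ι → ℂ) : ℂ := a ⬝ᵥ M *ᵥ star b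

lemma sesq_eq_sum (M : Matrix ι ι ℂ) (a b : ι → ℂ) :
    sesq M a b = ∑ k, ∑ l, M k l * a k * star (b l) := by
  simp only [sesq, dotProduct, mulVec, Finset.mul_sum, Pi.star_apply]
  exact Finset.sum_congr rfl fun k _ => Finset.sum_congr rfl fun l _ => by ring

lemma sesq_sub_left (M : Matrix ι ι ℂ) (a a' b : ι → ℂ) :
    sesq M (a - a') b = sesq M a b - sesq M a' b := by simp [sesq, sub_dotProduct]

lemma sesq_sub_right (M : Matrix ι ι ℂ) (a b b' : ι → ℂ) :
    sesq M a (b - b') = sesq M a b - sesq M a b' := by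
  simp [sesq, mulVec_sub, dotProduct_sub, star_sub]

lemma sesq_vecMul_left (M N : Matrix ι ι ℂ) (a b : ι → ℂ) :
    sesq M (a ᵥ* N) b = sesq (N * M) a b := by
  simp [sesq, ← dotProduct_mulVec, mulVec_mulVec]

lemma sesq_vecMul_right (M N : Matrix ι ι ℂ) (a b : ι → ℂ) :
    sesq M a (b ᵥ* N) = sesq (M * Nᴴ) a b := by
  simp [sesq, star_vecMul, mulVec_mulVec]

lemma sesq_sub (M N : Matrix ι ι ℂ) (a b : ι → ℂ) :
    sesq (M - N) a b = sesq M a b - sesq N a b := by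
  simp [sesq, sub_mulVec, dotProduct_sub]

lemma sesq_sum_left {κ : Type*} (s : Finset κ) (M : Matrix ι ι ℂ) (c : κ → ℂ) (a : κ → ι → ℂ)
    (b : ι → ℂ) : sesq M (∑ i ∈ s, c i • a i) b = ∑ i ∈ s, c i * sesq M (a i) b := by
  simp [sesq, sum_dotProduct]

lemma star_sesq {M : Matrix ι ι ℂ} (hM : M.IsHermitian) (a b : ι → ℂ) :
    star (sesq M a b) = sesq M b a := by
  rw [sesq_eq_sum, sesq_eq_sum, star_sum, Finset.sum_comm]
  refine Finset.sum_congr rfl fun k _ => ?_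
  rw [star_sum]
  refine Finset.sum_congr rfl fun l _ => ?_
  rw [← hM.apply l k, star_mul', star_mul', star_star]
  ring

lemma sesq_sum_right {κ : Type*} (s : Finset κ) {M : Matrix ι ι ℂ} (c : κ → ℂ) (a : κ → ι → ℂ)
    (b : ι → ℂ) : sesq M b (∑ i ∈ s, c i • a i) = ∑ i ∈ s, star (c i) * sesq M b (a i) := by
  simp [sesq, star_sum, mulVec_sum, dotProduct_sum, mulVec_smul]

lemma hasJet_sesq {γ : ℂ → Matrix ι ι ℂ} {g X Y Q : Matrix ι ι ℂ} {A B : ℂ → ι → ℂ}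
    {a b a' b' : ι → ℂ} (hγ : ∀ k l, HasJet (fun z => γ z k l) ⟨g k l, X k l, Y k l, Q k l⟩)
    (hA : ∀ k, HasJet (fun z => A z k) ⟨a k, b k, 0, 0⟩)
    (hB : ∀ k, HasJet (fun z => B z k) ⟨a' k, b' k, 0, 0⟩) :
    HasJet (fun z => sesq (γ z) (A z) (B z))
      ⟨sesq g a a', sesq g b a' + sesq X a a', sesq g a b' + sesq Y a a',
        sesq Q a a' + sesq Y b a' + sesq X a b' + sesq g b b'⟩ := by
  have h := HasJet.sum Finset.univ fun k _ => HasJet.sum Finset.univ fun l _ =>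
    ((hγ k l).mul (hA k)).mul (hB l).conj
  convert h using 1
  · ext z
    exact sesq_eq_sum _ _ _
  simp only [sesq_eq_sum, Jet.mul_def, Jet.bar, Jet.sum_mk, ← Finset.sum_add_distrib]
  congr 1 <;> refine Finset.sum_congr rfl fun k _ => Finset.sum_congr rfl fun l _ => ?_ <;>
    simp <;> ring

/-- The jet of the Gram entry of two holomorphic vector fields along a holomorphic disc, in terms
of their covariant derivatives `D`, `D'` and the curvature `X g⁻¹ Y - Q`. -/
lemma hasJet_gram [DecidableEq ι] {γ : ℂ → Matrix ι ι ℂ} {g X Y Q : Matrix ι ι ℂ} {A B : ℂ → ι → ℂ}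
    {a D a' D' : ι → ℂ} (hg : g.IsHermitian) (hu : IsUnit g.det) (hXY : Xᴴ = Y)
    (hγ : ∀ k l, HasJet (fun z => γ z k l) ⟨g k l, X k l, Y k l, Q k l⟩)
    (hA : ∀ k, HasJet (fun z => A z k) ⟨a k, (D - a ᵥ* (X * g⁻¹)) k, 0, 0⟩)
    (hB : ∀ k, HasJet (fun z => B z k) ⟨a' k, (D' - a' ᵥ* (X * g⁻¹)) k, 0, 0⟩) :
    HasJet (fun z => sesq (γ z) (A z) (B z))
      ⟨sesq g a a', sesq g D a', sesq g a D',
        -sesq (X * g⁻¹ * Y - Q) a a' + sesq g D D'⟩ := by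
  have h := hasJet_sesq hγ hA hB
  have hN : (X * g⁻¹)ᴴ = g⁻¹ * Y := by
    rw [conjTranspose_mul, conjTranspose_nonsing_inv, hg.eq, hXY]
  have e1 : X * g⁻¹ * g = X := by rw [Matrix.mul_assoc, nonsing_inv_mul _ hu, Matrix.mul_one]
  have e2 : g * (g⁻¹ * Y) = Y := by rw [← Matrix.mul_assoc, mul_nonsing_inv _ hu, Matrix.one_mul]
  have e3 : X * (g⁻¹ * Y) = X * g⁻¹ * Y := (Matrix.mul_assoc _ _ _).symm
  -- The connection term is a X g⁻¹, so D is the covariant derivative of A. In terms of D the linear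
  -- coefficients lose X and Y, and -Q is completed to the curvature X g⁻¹ Y - Q.
  convert h using 2
  · rw [sesq_sub_left, sesq_vecMul_left, e1]; ring
  · rw [sesq_sub_right, sesq_vecMul_right, hN, e2]; ring
  · simp only [sesq_sub_left, sesq_sub_right, sesq_vecMul_left, sesq_vecMul_right, hN, e1, e2,
      sesq_sub, e3]
    ring

/-- D minus its projection to the span of the β_j has nonnegative square, so a semidefinite form
suffices. It is needed to absorb the term X H₀⁻¹ Y of the determinant expansion. -/
lemma bessel {κ : Type*} [Fintype κ] [DecidableEq κ] {g : Matrix ι ι ℂ} (hg : g.IsHermitian)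
    (hpos : ∀ a, 0 ≤ (sesq g a a).re) {β : κ → ι → ℂ} {d : κ → ℝ} (hd : ∀ i, d i ≠ 0)
    (hβ : ∀ i j, sesq g (β i) (β j) = if i = j then (d i : ℂ) else 0) (D : ι → ℂ) :
    ∑ j, ‖sesq g D (β j)‖ ^ 2 / d j ≤ (sesq g D D).re := by
  set c : κ → ℂ := fun j => sesq g D (β j) / d j with hc
  have hcd : ∀ j, c j * d j = sesq g D (β j) := fun j =>
    div_mul_cancel₀ _ (Complex.ofReal_ne_zero.2 (hd j))
  have h1 : ∀ j, sesq g (∑ i, c i • β i) (β j) = sesq g D (β j) := by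
    intro j
    rw [sesq_sum_left]
    simp [hβ, hcd]
  have h2 := hpos (D - ∑ i, c i • β i)
  have h3 : sesq g (∑ i, c i • β i) D = ∑ j, ((‖sesq g D (β j)‖ ^ 2 / d j : ℝ) : ℂ) := by
    rw [sesq_sum_left]
    refine Finset.sum_congr rfl fun j _ => ?_
    rw [← star_sesq hg D (β j)]
    simp only [hc, Complex.star_def]
    rw [div_mul_eq_mul_div, Complex.mul_conj, Complex.normSq_eq_norm_sq]
    push_cast
    rfl
  have h4 : sesq g (D - ∑ i, c i • β i) (∑ i, c i • β i) = 0 := by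
    rw [sesq_sum_right]
    refine Finset.sum_eq_zero fun j _ => ?_
    rw [sesq_sub_left, h1, sub_self, mul_zero]
  rw [sesq_sub_right, h4, sub_zero, sesq_sub_left, h3, ← Complex.ofReal_sum, Complex.sub_re,
    Complex.ofReal_re] at h2
  linarith

end Sesq

end Herm

end

/-! ### Determinants and traces of jet matrices, and second order conditions at a maximum. -/

noncomputable section
namespace Herm
open Asymptotics Filter Topology
open scoped ComplexConjugate

section JetMatrix

open Matrix

variable {ι : Type*} [Fintype ι] [DecidableEq ι]

/-- Constant jets. -/
def Jet.const : ℂ →+* Jet where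
  toFun a := ⟨a, 0, 0, 0⟩
  map_one' := rfl
  map_mul' a b := by simp [Jet.mul_def]
  map_zero' := rfl
  map_add' a b := by simp [Jet.add_def]

/-- The jet of `ζ`. -/
def Jet.e₁ : Jet := ⟨0, 1, 0, 0⟩
/-- The jet of `ζ̄`. -/
def Jet.e₂ : Jet := ⟨0, 0, 1, 0⟩
/-- The jet of `ζ ζ̄`. -/
def Jet.e₁₂ : Jet := ⟨0, 0, 0, 1⟩

namespace Jet
lemma const_apply (a : ℂ) : const a = ⟨a, 0, 0, 0⟩ := rfl
lemma e₁_mul_e₁ : e₁ * e₁ = 0 := by simp [e₁, mul_def, zero_def]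
lemma e₂_mul_e₂ : e₂ * e₂ = 0 := by simp [e₂, mul_def, zero_def]
lemma e₁_mul_e₂ : e₁ * e₂ = e₁₂ := by simp [e₁, e₂, e₁₂, mul_def]
lemma e₁₂_mul_e₁₂ : e₁₂ * e₁₂ = 0 := by simp [e₁₂, mul_def, zero_def]
lemma e₁_mul_e₁₂ : e₁ * e₁₂ = 0 := by simp [e₁, e₁₂, mul_def, zero_def]
lemma e₁₂_mul_e₂ : e₁₂ * e₂ = 0 := by simp [e₂, e₁₂, mul_def, zero_def]
end Jet

lemma det_one_add_smul_of_sq_zero {R : Type*} [CommRing R] (r : R) (hr : r * r = 0)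
    (M : Matrix ι ι R) : (1 + r • M).det = 1 + M.trace * r := by
  rw [det_one_add_smul, sq, hr]; simp

/-- Since r² = 0, the inverse of 1 + rM is 1 - rM, and the adjugate is the determinant times this
inverse. -/
lemma adjugate_one_add_smul_of_sq_zero {R : Type*} [CommRing R] (r : R) (hr : r * r = 0)
    (M : Matrix ι ι R) : (1 + r • M).adjugate = 1 + r • (M.trace • (1 : Matrix ι ι R) - M) := by
  have h1 : (1 + r • M) * (1 - r • M) = 1 := by
    simp [mul_sub, add_mul, smul_smul, hr]
  have h2 := congrArg (· * (1 - r • M)) (adjugate_mul (1 + r • M))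
  simp only [Matrix.mul_assoc, h1, Matrix.mul_one] at h2
  rw [h2, det_one_add_smul_of_sq_zero r hr]
  have h3 : M.trace * r * r = 0 := by rw [_root_.mul_assoc, hr, mul_zero]
  simp only [add_smul, one_smul, Matrix.smul_mul, Matrix.one_mul, Matrix.add_mul, smul_sub,
    smul_smul, h3, zero_smul, sub_zero]
  rw [mul_comm M.trace r]
  abel

lemma jetMatrix_eq {Q : Matrix ι ι Jet} {a b b' c : Matrix ι ι ℂ}
    (h : ∀ i j, Q i j = ⟨a i j, b i j, b' i j, c i j⟩) :
    Q = Jet.const.mapMatrix a + Jet.e₁ • Jet.const.mapMatrix b + Jet.e₂ • Jet.const.mapMatrix b'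
      + Jet.e₁₂ • Jet.const.mapMatrix c := by
  ext1 i j
  simp [h, Jet.const_apply, Jet.e₁, Jet.e₂, Jet.e₁₂, Jet.mul_def, Jet.add_def]

lemma jetMatrix_normal {Q : Matrix ι ι Jet} {c : Matrix ι ι ℂ}
    (h : ∀ i j, Q i j = ⟨(1 : Matrix ι ι ℂ) i j, 0, 0, c i j⟩) :
    Q = 1 + Jet.e₁₂ • Jet.const.mapMatrix c := by
  have := jetMatrix_eq (a := 1) (b := 0) (b' := 0) (c := c) (Q := Q) (by simpa using h)
  simpa using this

lemma trace_mapMatrix (c : Matrix ι ι ℂ) :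
    (Jet.const.mapMatrix c).trace = Jet.const c.trace :=
  (AddMonoidHom.map_trace Jet.const c).symm

/-- As G has no linear terms, its adjugate is 1 + ζζ̄ (tr Z - Z), and only the constant term of P
meets the correction. -/
lemma trace_adjugate_mul_jet {G P : Matrix ι ι Jet} {Z H X Y K : Matrix ι ι ℂ}
    (hG : ∀ i j, G i j = ⟨(1 : Matrix ι ι ℂ) i j, 0, 0, Z i j⟩)
    (hP : ∀ i j, P i j = ⟨H i j, X i j, Y i j, K i j⟩) :
    (G.adjugate * P).trace.a = H.trace ∧
      (G.adjugate * P).trace.c = K.trace + Z.trace * H.trace - (Z * H).trace := by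
  have hh : G.adjugate * P = P + Jet.e₁₂ • Jet.const.mapMatrix (Z.trace • H - Z * H) := by
    rw [jetMatrix_normal hG, adjugate_one_add_smul_of_sq_zero _ Jet.e₁₂_mul_e₁₂, add_mul,
      Matrix.one_mul]
    have hW : (Jet.const.mapMatrix Z).trace • (1 : Matrix ι ι Jet) - Jet.const.mapMatrix Z =
        Jet.const.mapMatrix (Z.trace • (1 : Matrix ι ι ℂ) - Z) := by
      ext1 i j
      rw [trace_mapMatrix]
      by_cases hij : i = j <;> simp [hij]
    have hW' : Z.trace • H - Z * H = (Z.trace • (1 : Matrix ι ι ℂ) - Z) * H := by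
      rw [Matrix.sub_mul, Matrix.smul_mul, Matrix.one_mul]
    rw [hW, hW', Matrix.smul_mul]
    congr 1
    ext1 i j
    simp only [Matrix.smul_apply, Matrix.mul_apply, RingHom.mapMatrix_apply, Matrix.map_apply, hP,
      Jet.const_apply, smul_eq_mul, Jet.mul_def, Jet.e₁₂, Jet.sum_mk]
    simp
  have ht : P.trace = ⟨H.trace, X.trace, Y.trace, K.trace⟩ := by
    simp only [Matrix.trace, diag_apply, hP, Jet.sum_mk]
  rw [hh, trace_add, trace_smul, trace_mapMatrix, ht]
  simp [Jet.const_apply, Jet.e₁₂, Jet.mul_def, Jet.add_def]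
  ring

lemma det_jet_normal {G : Matrix ι ι Jet} {Z : Matrix ι ι ℂ}
    (hG : ∀ i j, G i j = ⟨(1 : Matrix ι ι ℂ) i j, 0, 0, Z i j⟩) :
    G.det = ⟨1, 0, 0, Z.trace⟩ := by
  rw [jetMatrix_normal hG, det_one_add_smul_of_sq_zero _ Jet.e₁₂_mul_e₁₂, trace_mapMatrix]
  simp [Jet.const_apply, Jet.e₁₂, Jet.mul_def, Jet.one_def, Jet.add_def]

/-- Completing the square in the determinant of a Hermitian jet. -/
lemma det_jet {P : Matrix ι ι Jet} {d X Y K : Matrix ι ι ℂ} (hd : IsUnit d.det)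
    (hdh : d.IsHermitian) (hXY : Xᴴ = Y) (hP : ∀ i j, P i j = ⟨d i j, X i j, Y i j, K i j⟩) :
    ∃ t : ℂ, P.det.a = d.det ∧
      P.det.c = d.det * ((d⁻¹ * (K - X * d⁻¹ * Y)).trace + t * conj t) := by
  set κ : Matrix ι ι ℂ →+* Matrix ι ι Jet := Jet.const.mapMatrix with hκ
  have hsm : ∀ (r s : Jet) (M N : Matrix ι ι Jet), (r • M) * (s • N) = (r * s) • (M * N) :=
    fun r s M N => by rw [Matrix.smul_mul, Matrix.mul_smul, smul_smul]
  have hXd : X * d⁻¹ * d = X := by rw [Matrix.mul_assoc, nonsing_inv_mul _ hd, Matrix.mul_one]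
  have hdY : d * (d⁻¹ * Y) = Y := by rw [← Matrix.mul_assoc, mul_nonsing_inv _ hd, Matrix.one_mul]
  -- Unipotent factors on both sides remove the linear terms and leave the Schur complement K - X
  -- d⁻¹ Y. Their determinants 1 - tζ and 1 - t̄ζ̄ account for the extra t t̄.
  have key : (1 + Jet.e₁ • κ (-(X * d⁻¹))) * P * (1 + Jet.e₂ • κ (-(d⁻¹ * Y))) =
      κ d * (1 + Jet.e₁₂ • κ (d⁻¹ * (K - X * d⁻¹ * Y))) := by
    have hl : (1 + Jet.e₁ • κ (-(X * d⁻¹))) * P =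
        κ d + Jet.e₂ • κ Y + Jet.e₁₂ • κ (K - X * d⁻¹ * Y) := by
      rw [jetMatrix_eq hP, ← hκ]
      simp only [add_mul, mul_add, Matrix.one_mul, Matrix.smul_mul, Matrix.mul_smul, smul_smul, ← map_mul,
        Jet.e₁_mul_e₁, Jet.e₁_mul_e₂, Jet.e₁_mul_e₁₂, mul_comm Jet.e₂ Jet.e₁, mul_comm Jet.e₁₂ Jet.e₁,
        Matrix.neg_mul, hXd, zero_smul, map_neg,
        smul_neg, map_sub, smul_sub]
      abel
    rw [hl]
    have e3 : d * (d⁻¹ * (K - X * d⁻¹ * Y)) = K - X * d⁻¹ * Y := by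
      rw [← Matrix.mul_assoc, mul_nonsing_inv _ hd, Matrix.one_mul]
    simp only [add_mul, mul_add, Matrix.mul_one, Matrix.smul_mul, Matrix.mul_smul, smul_smul, ← map_mul,
      Jet.e₂_mul_e₂, Jet.e₁₂_mul_e₂, Matrix.mul_neg, hdY, zero_smul, map_neg, smul_neg, e3,
      mul_comm Jet.e₂ Jet.e₁₂]
    abel
  set t : ℂ := (X * d⁻¹).trace with ht
  have ht2 : (d⁻¹ * Y).trace = conj t := by
    rw [ht, ← Complex.star_def, ← trace_conjTranspose, conjTranspose_mul,
      conjTranspose_nonsing_inv, hdh.eq, hXY]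
  refine ⟨t, ?_⟩
  have hdet := congrArg Matrix.det key
  rw [det_mul, det_mul, det_mul, det_one_add_smul_of_sq_zero _ Jet.e₁_mul_e₁,
    det_one_add_smul_of_sq_zero _ Jet.e₂_mul_e₂, det_one_add_smul_of_sq_zero _ Jet.e₁₂_mul_e₁₂,
    hκ, trace_mapMatrix, trace_mapMatrix, trace_mapMatrix, ← RingHom.map_det, trace_neg, trace_neg,
    ht2, ← ht] at hdet
  set D := P.det
  simp only [Jet.const_apply, Jet.one_def, Jet.mul_def, Jet.e₁, Jet.e₂, Jet.e₁₂, Jet.add_def,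
    Jet.mk.injEq] at hdet
  obtain ⟨h1, h2, h3, h4⟩ := hdet
  ring_nf at h1 h2 h3 h4
  have h5 : D.a = d.det := h1
  refine ⟨h5, ?_⟩
  rw [h5] at h2 h3 h4
  linear_combination h4 + t * h3 + conj t * h2

/-- Second order necessary condition for `tr (G⁻¹ H)` to be maximal. -/
lemma re_trace_le_of_max {G H : ℂ → Matrix ι ι ℂ} {Z K X Y H₀ : Matrix ι ι ℂ}
    (hG : ∀ i j, HasJet (fun z => G z i j) ⟨(1 : Matrix ι ι ℂ) i j, 0, 0, Z i j⟩)
    (hH : ∀ i j, HasJet (fun z => H z i j) ⟨H₀ i j, X i j, Y i j, K i j⟩)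
    (him : H₀.trace.im = 0)
    (hmax : ∀ᶠ z in 𝓝 0, ((G z).adjugate * H z).trace.re ≤ H₀.trace.re * (G z).det.re) :
    K.trace.re ≤ (Z * H₀).trace.re := by
  have e : H₀.trace = (H₀.trace.re : ℂ) := Complex.ext (by simp) (by simp [him])
  have j1 := HasJet.det hG
  have j2 := HasJet.trace_adjugate_mul hG hH
  obtain ⟨ea, ec⟩ := trace_adjugate_mul_jet
    (G := Matrix.of fun i j => ⟨(1 : Matrix ι ι ℂ) i j, 0, 0, Z i j⟩)
    (P := Matrix.of fun i j => ⟨H₀ i j, X i j, Y i j, K i j⟩) (fun _ _ => rfl) (fun _ _ => rfl)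
  -- This difference vanishes at 0 and is nonnegative nearby, so its z z̄ coefficient has
  -- nonnegative real part.
  have j3 := ((HasJet.const H₀.trace).mul j1).add j2.neg
  have hd := det_jet_normal (G := Matrix.of fun i j => ⟨(1 : Matrix ι ι ℂ) i j, 0, 0, Z i j⟩)
    (Z := Z) (fun _ _ => rfl)
  have h := j3.re_nonneg (by
      have : (Matrix.det fun i j => (⟨(1 : Matrix ι ι ℂ) i j, 0, 0, Z i j⟩ : Jet)).a = 1 :=
        congrArg Jet.a hd
      simp only [Jet.add_def, Jet.mul_def, Jet.neg_def, this]
      erw [ea]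
      simp) (by
      filter_upwards [hmax] with z hz
      simp only [Pi.add_apply, Pi.mul_apply, Pi.neg_apply, Complex.add_re, Complex.neg_re]
      rw [e, Complex.re_ofReal_mul]
      linarith)
  have hdc : (Matrix.det fun i j => (⟨(1 : Matrix ι ι ℂ) i j, 0, 0, Z i j⟩ : Jet)).c = Z.trace :=
    congrArg Jet.c hd
  simp only [Jet.add_def, Jet.mul_def, Jet.neg_def, hdc] at h
  erw [ec] at h
  simp only [Complex.add_re, Complex.neg_re, Complex.sub_re, zero_mul, add_zero,
    mul_comm H₀.trace] at h
  linarith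

/-- Second order necessary condition for `det (G⁻¹ H)` to be maximal. -/
lemma re_trace_le_of_det_max {G H : ℂ → Matrix ι ι ℂ} {Z K X Y H₀ : Matrix ι ι ℂ}
    (hG : ∀ i j, HasJet (fun z => G z i j) ⟨(1 : Matrix ι ι ℂ) i j, 0, 0, Z i j⟩)
    (hH : ∀ i j, HasJet (fun z => H z i j) ⟨H₀ i j, X i j, Y i j, K i j⟩)
    (hh : H₀.IsHermitian) (hXY : Xᴴ = Y) {δ : ℝ} (hδ : H₀.det = δ) (hδ0 : 0 < δ)
    (hmax : ∀ᶠ z in 𝓝 0, (H z).det.re ≤ δ * (G z).det.re) :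
    (H₀⁻¹ * (K - X * H₀⁻¹ * Y)).trace.re ≤ Z.trace.re := by
  have j1 := HasJet.det hG
  have j2 := HasJet.det hH
  obtain ⟨t, ea, ec⟩ := det_jet (P := Matrix.of fun i j => ⟨H₀ i j, X i j, Y i j, K i j⟩)
    (d := H₀) (X := X) (Y := Y) (K := K)
    (by rw [hδ]; exact (Complex.ofReal_ne_zero.2 hδ0.ne').isUnit) hh hXY (fun _ _ => rfl)
  have j3 := ((HasJet.const (δ : ℂ)).mul j1).add j2.neg
  have hd := det_jet_normal (G := Matrix.of fun i j => ⟨(1 : Matrix ι ι ℂ) i j, 0, 0, Z i j⟩)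
    (Z := Z) (fun _ _ => rfl)
  have h := j3.re_nonneg (by
      have : (Matrix.det fun i j => (⟨(1 : Matrix ι ι ℂ) i j, 0, 0, Z i j⟩ : Jet)).a = 1 :=
        congrArg Jet.a hd
      simp only [Jet.add_def, Jet.mul_def, Jet.neg_def, this]
      erw [ea]
      simp [hδ]) (by
      filter_upwards [hmax] with z hz
      simp only [Pi.add_apply, Pi.mul_apply, Pi.neg_apply, Complex.add_re, Complex.neg_re]
      rw [Complex.re_ofReal_mul]
      linarith)
  have hdc : (Matrix.det fun i j => (⟨(1 : Matrix ι ι ℂ) i j, 0, 0, Z i j⟩ : Jet)).c = Z.trace :=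
    congrArg Jet.c hd
  simp only [Jet.add_def, Jet.mul_def, Jet.neg_def, hdc] at h
  erw [ec] at h
  simp only [zero_mul, add_zero, hδ, Complex.mul_conj, Complex.add_re, Complex.neg_re,
    Complex.re_ofReal_mul, Complex.ofReal_re] at h
  -- The extra |t|² is on the favourable side and is dropped.
  have := Complex.normSq_nonneg t
  nlinarith

end JetMatrix

end Herm

end

/-! ### The Bochner inequalities in coordinates. -/

noncomputable section
namespace Herm
open Asymptotics Filter Topology
open scoped ComplexConjugate

section Local

open Matrix

lemma HasJet.tendsto {f : ℂ → ℂ} {q : Jet} (hf : HasJet f q) : Tendsto f (𝓝 0) (𝓝 q.a) := by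
  obtain ⟨d, e, h⟩ := hf
  have h1 : Tendsto (fun z : ℂ => z ^ 2) (𝓝 0) (𝓝 0) := by
    have : Continuous fun z : ℂ => z ^ 2 := by fun_prop
    simpa using this.tendsto 0
  have h2 := h.isBigO.trans_tendsto h1
  have h3 : Tendsto (fun z : ℂ => q.a + q.b * z + q.b' * conj z
    + q.c * (z * conj z) + d * z ^ 2 + e * (conj z) ^ 2) (𝓝 0) (𝓝 q.a) := by
    have : Continuous fun z : ℂ => q.a + q.b * z + q.b' * conj z
      + q.c * (z * conj z) + d * z ^ 2 + e * (conj z) ^ 2 := by fun_prop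
    simpa using this.tendsto 0
  simpa using h2.add h3

/-- The matrix `∂_v M`. -/
def linMat {m : ℕ} {ι : Type*} (γ : Cn m → Matrix ι ι ℂ) (z v : Cn m) : Matrix ι ι ℂ :=
  Matrix.of fun k l => linPart (fderiv ℝ (fun w => γ w k l) z) v

/-- The matrix `∂̄_v M`. -/
def conjMat {m : ℕ} {ι : Type*} (γ : Cn m → Matrix ι ι ℂ) (z v : Cn m) : Matrix ι ι ℂ :=
  Matrix.of fun k l => conjPart (fderiv ℝ (fun w => γ w k l) z) v

/-- The matrix `∂_v ∂̄_v M`. -/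
def mixedMat {m : ℕ} {ι : Type*} (γ : Cn m → Matrix ι ι ℂ) (z v : Cn m) : Matrix ι ι ℂ :=
  Matrix.of fun k l => mixedPart (fderiv ℝ (fderiv ℝ (fun w => γ w k l)) z) v

/-- The matrix of the Hermitian form `R(v, v̄, ·, ·)` of a metric with coefficients `γ`. -/
def curvMat {m : ℕ} {ι : Type*} [Fintype ι] [DecidableEq ι] (γ : Cn m → Matrix ι ι ℂ)
    (z v : Cn m) : Matrix ι ι ℂ :=
  linMat γ z v * (γ z)⁻¹ * conjMat γ z v - mixedMat γ z v

lemma linMat_conjTranspose {m : ℕ} {ι : Type*} {γ : Cn m → Matrix ι ι ℂ}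
    (hγ : ∀ z, (γ z).IsHermitian) (z v : Cn m)
    (hd : ∀ k l, DifferentiableAt ℝ (fun w => γ w k l) z) :
    (linMat γ z v)ᴴ = conjMat γ z v := by
  ext1 k l
  have h1 : (fun w => γ w k l) = fun w => Complex.conjCLE (γ w l k) := by
    funext w
    exact ((hγ w).apply k l).symm
  have h2 : fderiv ℝ (fun w => γ w k l) z =
      (Complex.conjCLE : ℂ →L[ℝ] ℂ).comp (fderiv ℝ (fun w => γ w l k) z) := by
    rw [h1]
    exact ((Complex.conjCLE : ℂ →L[ℝ] ℂ).hasFDerivAt.comp z (hd l k).hasFDerivAt).fderiv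
  simp [linMat, conjMat, linPart, conjPart, h2]

lemma expansion_of_analyticAt {V : Type*} [NormedAddCommGroup V] [NormedSpace ℂ V]
    {w : ℂ → V} (hw : AnalyticAt ℂ w 0) :
    ∃ w₂ : V, (fun z : ℂ => w z - (w 0 + z • deriv w 0 + z ^ 2 • w₂)) =o[𝓝 0]
      fun z : ℂ => z ^ 2 := by
  obtain ⟨p, hp⟩ := hw
  refine ⟨p.coeff 2, ?_⟩
  have h1 := hp.isBigO_sub_partialSum_pow 3
  have h2 : (fun z : ℂ => ‖z‖ ^ 3) =o[𝓝 0] fun z : ℂ => z ^ 2 := by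
    rw [← isLittleO_norm_right]
    simp only [norm_pow]
    exact (isLittleO_pow_pow (𝕜 := ℝ) (show 2 < 3 by norm_num)).comp_tendsto tendsto_norm_zero
  refine (h1.trans_isLittleO h2).congr_left fun z => ?_
  rw [zero_add, FormalMultilinearSeries.partialSum, Finset.sum_range_succ, Finset.sum_range_succ,
    Finset.sum_range_succ, Finset.sum_range_zero]
  simp only [FormalMultilinearSeries.apply_eq_pow_smul_coeff]
  have e0 : p.coeff 0 = w 0 := hp.coeff_zero _
  have e1 : p.coeff 1 = deriv w 0 := hp.deriv.symm
  rw [e0, e1]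
  simp

variable {m n : ℕ} {ι : Type*}

/-- The a_i extend along the disc z₀ + zv to affine fields A_i with zero covariant derivative at the
centre, so their Gram matrix has no linear terms and mixed term minus the curvature. The covariant
derivative D_i of the image field is in general nonzero and contributes ⟨D_i, D_j⟩. -/
lemma local_gram_jets {γ : Cn m → Matrix (Fin m) (Fin m) ℂ} {η : Cn n → Matrix (Fin n) (Fin n) ℂ}
    {F : Cn m → Cn n} {z₀ : Cn m}
    (hγ : ∀ k l, ContDiffAt ℝ 2 (fun w => γ w k l) z₀) (hγh : ∀ z, (γ z).IsHermitian)
    (hγu : IsUnit (γ z₀).det)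
    (hη : ∀ k l, ContDiffAt ℝ 2 (fun w => η w k l) (F z₀)) (hηh : ∀ z, (η z).IsHermitian)
    (hηu : IsUnit (η (F z₀)).det) (hF : AnalyticAt ℂ F z₀) (v : Cn m) (a : ι → Cn m) :
    ∃ (A : ι → ℂ → Cn m) (D : ι → Fin n → ℂ),
      (∀ i j, HasJet (fun z => sesq (γ (z₀ + z • v)) (A i z).ofLp (A j z).ofLp)
        ⟨sesq (γ z₀) (a i).ofLp (a j).ofLp, 0, 0,
          -sesq (curvMat γ z₀ v) (a i).ofLp (a j).ofLp⟩) ∧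
      (∀ i j, HasJet (fun z => sesq (η (F (z₀ + z • v))) (fderiv ℂ F (z₀ + z • v) (A i z)).ofLp
          (fderiv ℂ F (z₀ + z • v) (A j z)).ofLp)
        ⟨sesq (η (F z₀)) (fderiv ℂ F z₀ (a i)).ofLp (fderiv ℂ F z₀ (a j)).ofLp,
          sesq (η (F z₀)) (D i) (fderiv ℂ F z₀ (a j)).ofLp,
          sesq (η (F z₀)) (fderiv ℂ F z₀ (a i)).ofLp (D j),
          -sesq (curvMat η (F z₀) (fderiv ℂ F z₀ v)) (fderiv ℂ F z₀ (a i)).ofLp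
            (fderiv ℂ F z₀ (a j)).ofLp + sesq (η (F z₀)) (D i) (D j)⟩) := by
  set N := linMat γ z₀ v * (γ z₀)⁻¹ with hN
  set A : ι → ℂ → Cn m := fun i z => a i + z • WithLp.toLp 2 (-((a i).ofLp ᵥ* N)) with hA
  have hline : AnalyticAt ℂ (fun z : ℂ => z₀ + z • v) 0 := by fun_prop
  have hline0 : (fun z : ℂ => z₀ + z • v) 0 = z₀ := by simp
  have hF' : AnalyticAt ℂ F ((fun z : ℂ => z₀ + z • v) 0) := by rwa [hline0]
  have hw : AnalyticAt ℂ (fun z : ℂ => F (z₀ + z • v)) 0 := hF.comp_of_eq hline hline0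
  have hAan : ∀ i, AnalyticAt ℂ (A i) 0 := fun i => by
    simp only [hA]; fun_prop
  have hB : ∀ i, AnalyticAt ℂ (fun z : ℂ => fderiv ℂ F (z₀ + z • v) (A i z)) 0 := fun i =>
    AnalyticAt.comp₂ (f := fun z : ℂ => fderiv ℂ F (z₀ + z • v)) (g := A i)
      ((ContinuousLinearMap.id ℂ (Cn m →L[ℂ] Cn n)).analyticAt_bilinear _)
      (hF.fderiv.comp_of_eq hline hline0) (hAan i)
  have hBk : ∀ i k, AnalyticAt ℂ (fun z : ℂ => (fderiv ℂ F (z₀ + z • v) (A i z)).ofLp k) 0 :=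
    fun i k => ((EuclideanSpace.proj k : Cn n →L[ℂ] ℂ).analyticAt _).comp (hB i)
  have hA0 : ∀ i, A i 0 = a i := fun i => by simp [hA]
  have hv1 : HasDerivAt (fun z : ℂ => z₀ + z • v) v 0 := by
    simpa using ((hasDerivAt_id (0 : ℂ)).smul_const v).const_add z₀
  have hder : deriv (fun z : ℂ => F (z₀ + z • v)) 0 = fderiv ℂ F z₀ v := by
    have h1 := hF'.differentiableAt.hasFDerivAt.comp_hasDerivAt (0 : ℂ) hv1
    rw [hline0] at h1
    exact h1.deriv
  obtain ⟨w₂, hw₂⟩ := expansion_of_analyticAt hw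
  simp only [hder, zero_smul, add_zero] at hw₂
  have jγ : ∀ k l, HasJet (fun z => γ (z₀ + z • v) k l)
      ⟨γ z₀ k l, linMat γ z₀ v k l, conjMat γ z₀ v k l, mixedMat γ z₀ v k l⟩ := fun k l =>
    HasJet.comp_disc (w := fun z : ℂ => z₀ + z • v) (w₂ := 0) (hγ k l) (by simp)
  have jη : ∀ k l, HasJet (fun z => η (F (z₀ + z • v)) k l)
      ⟨η (F z₀) k l, linMat η (F z₀) (fderiv ℂ F z₀ v) k l,
        conjMat η (F z₀) (fderiv ℂ F z₀ v) k l, mixedMat η (F z₀) (fderiv ℂ F z₀ v) k l⟩ :=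
    fun k l => HasJet.comp_disc (w := fun z : ℂ => F (z₀ + z • v)) (hη k l) hw₂
  set N' := linMat η (F z₀) (fderiv ℂ F z₀ v) * (η (F z₀))⁻¹ with hN'
  -- Coordinate derivative plus connection term, which is the form `hasJet_gram` expects.
  set D : ι → Fin n → ℂ := fun i =>
    (fun k => deriv (fun z : ℂ => (fderiv ℂ F (z₀ + z • v) (A i z)).ofLp k) 0)
      + (fderiv ℂ F z₀ (a i)).ofLp ᵥ* N' with hD
  have jA : ∀ i k, HasJet (fun z => (A i z).ofLp k)
      ⟨(a i).ofLp k, ((0 : Fin m → ℂ) - (a i).ofLp ᵥ* N) k, 0, 0⟩ := by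
    intro i k
    have h := (HasJet.const ((a i).ofLp k)).add
      ((HasJet.const (-((a i).ofLp ᵥ* N) k)).mul HasJet.id)
    simp only [Jet.mul_def, Jet.add_def] at h
    convert h using 1
    · ext z
      simp [hA, mul_comm]
    · simp
  have jB : ∀ i k, HasJet (fun z : ℂ => (fderiv ℂ F (z₀ + z • v) (A i z)).ofLp k)
      ⟨(fderiv ℂ F z₀ (a i)).ofLp k, (D i - (fderiv ℂ F z₀ (a i)).ofLp ᵥ* N') k, 0, 0⟩ := by
    intro i k
    have h := HasJet.of_analyticAt (hBk i k)
    convert h using 2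
    · simp [hA0]
    · simp [hD]
  refine ⟨A, D, fun i j => ?_, fun i j => ?_⟩
  · have h := hasJet_gram (hγh z₀) hγu
      (linMat_conjTranspose hγh z₀ v fun k l => (hγ k l).differentiableAt two_ne_zero) jγ
      (jA i) (jA j)
    convert h using 2
    · simp [sesq]
    · simp [sesq]
    · simp [sesq, curvMat]
  · exact hasJet_gram (hηh (F z₀)) hηu
      (linMat_conjTranspose hηh (F z₀) _ fun k l => (hη k l).differentiableAt two_ne_zero) jη
      (jB i) (jB j)

/-- The Gram matrix of a family of vectors. -/
def gramMat {κ : Type*} [Fintype κ] (g : Matrix κ κ ℂ) (a : ι → EuclideanSpace ℂ κ) :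
    Matrix ι ι ℂ := Matrix.of fun i j => sesq g (a i).ofLp (a j).ofLp

lemma gramMat_isHermitian {κ : Type*} [Fintype κ] {g : Matrix κ κ ℂ} (hg : g.IsHermitian)
    (a : ι → EuclideanSpace ℂ κ) : (gramMat g a).IsHermitian := by
  ext1 i j
  exact star_sesq hg _ _

variable [Fintype ι] [DecidableEq ι]

/-- The Bochner inequality at a maximum of the trace of `f^*h` over unitary frames. -/
lemma local_trace_le {γ : Cn m → Matrix (Fin m) (Fin m) ℂ} {η : Cn n → Matrix (Fin n) (Fin n) ℂ}
    {F : Cn m → Cn n} {z₀ : Cn m}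
    (hγ : ∀ k l, ContDiffAt ℝ 2 (fun w => γ w k l) z₀) (hγh : ∀ z, (γ z).IsHermitian)
    (hγu : IsUnit (γ z₀).det)
    (hη : ∀ k l, ContDiffAt ℝ 2 (fun w => η w k l) (F z₀)) (hηh : ∀ z, (η z).IsHermitian)
    (hηu : IsUnit (η (F z₀)).det) (hηpos : ∀ u, 0 ≤ (sesq (η (F z₀)) u u).re)
    (hF : AnalyticAt ℂ F z₀) (a : ι → Cn m) (ha : gramMat (γ z₀) a = 1)
    {d : ι → ℝ} (hd : gramMat (η (F z₀)) (fun i => fderiv ℂ F z₀ (a i))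
      = Matrix.diagonal fun i => (d i : ℂ))
    (hmax : ∀ᶠ z in 𝓝 z₀, ∀ b : ι → Cn m, (gramMat (γ z) b).det ≠ 0 →
      ((gramMat (γ z) b).adjugate * gramMat (η (F z)) (fun i => fderiv ℂ F z (b i))).trace.re ≤
        (∑ i, d i) * (gramMat (γ z) b).det.re) (v : Cn m) :
    ∑ i, d i * (sesq (curvMat γ z₀ v) (a i).ofLp (a i).ofLp).re ≤
      ∑ i, (sesq (curvMat η (F z₀) (fderiv ℂ F z₀ v)) (fderiv ℂ F z₀ (a i)).ofLp
        (fderiv ℂ F z₀ (a i)).ofLp).re := by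
  obtain ⟨A, D, jG, jH⟩ := local_gram_jets hγ hγh hγu hη hηh hηu hF v a
  have ha' : ∀ i j, sesq (γ z₀) (a i).ofLp (a j).ofLp = (1 : Matrix ι ι ℂ) i j :=
    fun i j => congrFun (congrFun ha i) j
  have hline : Tendsto (fun z : ℂ => z₀ + z • v) (𝓝 0) (𝓝 z₀) := by
    have : Continuous (fun z : ℂ => z₀ + z • v) := by fun_prop
    simpa using this.tendsto 0
  simp only [ha'] at jG
  have jdet := HasJet.det (G := fun z => gramMat (γ (z₀ + z • v)) fun i => A i z) jG
  -- Maximality is only assumed for nondegenerate frames; near the centre the Gram determinant is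
  -- close to 1.
  have hdet1 : ∀ᶠ z : ℂ in 𝓝 0, (gramMat (γ (z₀ + z • v)) fun i => A i z).det ≠ 0 := by
    have h1 := jdet.tendsto
    have h2 := congrArg Jet.a (det_jet_normal (G := Matrix.of fun i j =>
      ⟨(1 : Matrix ι ι ℂ) i j, 0, 0, -sesq (curvMat γ z₀ v) (a i).ofLp (a j).ofLp⟩)
      (Z := Matrix.of fun i j => -sesq (curvMat γ z₀ v) (a i).ofLp (a j).ofLp)
      (fun _ _ => rfl))
    erw [h2] at h1
    exact h1.eventually_ne one_ne_zero
  have htr : (gramMat (η (F z₀)) fun i => fderiv ℂ F z₀ (a i)).trace = ((∑ i, d i : ℝ) : ℂ) := by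
    rw [hd, Matrix.trace_diagonal]; push_cast; rfl
  have key := re_trace_le_of_max
    (G := fun z => gramMat (γ (z₀ + z • v)) fun i => A i z)
    (H := fun z => gramMat (η (F (z₀ + z • v))) fun i => fderiv ℂ F (z₀ + z • v) (A i z))
    (H₀ := gramMat (η (F z₀)) fun i => fderiv ℂ F z₀ (a i))
    (Z := Matrix.of fun i j => -sesq (curvMat γ z₀ v) (a i).ofLp (a j).ofLp)
    (X := Matrix.of fun i j => sesq (η (F z₀)) (D i) (fderiv ℂ F z₀ (a j)).ofLp)
    (Y := Matrix.of fun i j => sesq (η (F z₀)) (fderiv ℂ F z₀ (a i)).ofLp (D j))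
    (K := Matrix.of fun i j => -sesq (curvMat η (F z₀) (fderiv ℂ F z₀ v))
      (fderiv ℂ F z₀ (a i)).ofLp (fderiv ℂ F z₀ (a j)).ofLp + sesq (η (F z₀)) (D i) (D j))
    jG jH (by rw [htr, Complex.ofReal_im]) (by
      filter_upwards [hline.eventually hmax, hdet1] with z h1 h2
      rw [htr, Complex.ofReal_re]
      exact h1 _ h2)
  rw [hd] at key
  simp only [Matrix.trace, Matrix.diag_apply, Matrix.mul_diagonal, Matrix.of_apply, Complex.re_sum,
    Complex.add_re, Complex.neg_re, Complex.re_mul_ofReal, Finset.sum_add_distrib, neg_mul,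
    Finset.sum_neg_distrib] at key
  have hD : 0 ≤ ∑ i, (sesq (η (F z₀)) (D i) (D i)).re := Finset.sum_nonneg fun i _ => hηpos _
  simp only [mul_comm (d _)]
  linarith

/-- The Bochner inequality at a maximum of the determinant of `f^*h` over unitary frames. -/
lemma local_det_le {γ : Cn m → Matrix (Fin m) (Fin m) ℂ} {η : Cn n → Matrix (Fin n) (Fin n) ℂ}
    {F : Cn m → Cn n} {z₀ : Cn m}
    (hγ : ∀ k l, ContDiffAt ℝ 2 (fun w => γ w k l) z₀) (hγh : ∀ z, (γ z).IsHermitian)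
    (hγu : IsUnit (γ z₀).det)
    (hη : ∀ k l, ContDiffAt ℝ 2 (fun w => η w k l) (F z₀)) (hηh : ∀ z, (η z).IsHermitian)
    (hηu : IsUnit (η (F z₀)).det) (hηpos : ∀ u, 0 ≤ (sesq (η (F z₀)) u u).re)
    (hF : AnalyticAt ℂ F z₀) (a : ι → Cn m) (ha : gramMat (γ z₀) a = 1)
    {d : ι → ℝ} (hd0 : ∀ i, 0 < d i)
    (hd : gramMat (η (F z₀)) (fun i => fderiv ℂ F z₀ (a i)) = Matrix.diagonal fun i => (d i : ℂ))
    (hmax : ∀ᶠ z in 𝓝 z₀, ∀ b : ι → Cn m, (gramMat (γ z) b).det ≠ 0 →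
      (gramMat (η (F z)) (fun i => fderiv ℂ F z (b i))).det.re ≤
        (∏ i, d i) * (gramMat (γ z) b).det.re) (v : Cn m) :
    ∑ i, (sesq (curvMat γ z₀ v) (a i).ofLp (a i).ofLp).re ≤
      ∑ i, (d i)⁻¹ * (sesq (curvMat η (F z₀) (fderiv ℂ F z₀ v)) (fderiv ℂ F z₀ (a i)).ofLp
        (fderiv ℂ F z₀ (a i)).ofLp).re := by
  obtain ⟨A, D, jG, jH⟩ := local_gram_jets hγ hγh hγu hη hηh hηu hF v a
  have ha' : ∀ i j, sesq (γ z₀) (a i).ofLp (a j).ofLp = (1 : Matrix ι ι ℂ) i j :=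
    fun i j => congrFun (congrFun ha i) j
  have hd' : ∀ i j, sesq (η (F z₀)) (fderiv ℂ F z₀ (a i)).ofLp (fderiv ℂ F z₀ (a j)).ofLp =
      if i = j then (d i : ℂ) else 0 := by
    intro i j
    have := congrFun (congrFun hd i) j
    simpa [gramMat, Matrix.diagonal_apply] using this
  have hline : Tendsto (fun z : ℂ => z₀ + z • v) (𝓝 0) (𝓝 z₀) := by
    have : Continuous (fun z : ℂ => z₀ + z • v) := by fun_prop
    simpa using this.tendsto 0
  simp only [ha'] at jG
  have jdet := HasJet.det (G := fun z => gramMat (γ (z₀ + z • v)) fun i => A i z) jG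
  have hdet1 : ∀ᶠ z : ℂ in 𝓝 0, (gramMat (γ (z₀ + z • v)) fun i => A i z).det ≠ 0 := by
    have h1 := jdet.tendsto
    have h2 := congrArg Jet.a (det_jet_normal (G := Matrix.of fun i j =>
      ⟨(1 : Matrix ι ι ℂ) i j, 0, 0, -sesq (curvMat γ z₀ v) (a i).ofLp (a j).ofLp⟩)
      (Z := Matrix.of fun i j => -sesq (curvMat γ z₀ v) (a i).ofLp (a j).ofLp)
      (fun _ _ => rfl))
    erw [h2] at h1
    exact h1.eventually_ne one_ne_zero
  have hdn : ∀ i, (d i : ℂ) ≠ 0 := fun i => Complex.ofReal_ne_zero.2 (hd0 i).ne'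
  have hinv : (Matrix.diagonal fun i => (d i : ℂ))⁻¹ = Matrix.diagonal fun i => ((d i)⁻¹ : ℂ) := by
    refine Matrix.inv_eq_right_inv ?_
    rw [Matrix.diagonal_mul_diagonal, ← Matrix.diagonal_one]
    congr 1
    funext i
    exact mul_inv_cancel₀ (hdn i)
  have key := re_trace_le_of_det_max
    (G := fun z => gramMat (γ (z₀ + z • v)) fun i => A i z)
    (H := fun z => gramMat (η (F (z₀ + z • v))) fun i => fderiv ℂ F (z₀ + z • v) (A i z))
    (H₀ := gramMat (η (F z₀)) fun i => fderiv ℂ F z₀ (a i))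
    (Z := Matrix.of fun i j => -sesq (curvMat γ z₀ v) (a i).ofLp (a j).ofLp)
    (X := Matrix.of fun i j => sesq (η (F z₀)) (D i) (fderiv ℂ F z₀ (a j)).ofLp)
    (Y := Matrix.of fun i j => sesq (η (F z₀)) (fderiv ℂ F z₀ (a i)).ofLp (D j))
    (K := Matrix.of fun i j => -sesq (curvMat η (F z₀) (fderiv ℂ F z₀ v))
      (fderiv ℂ F z₀ (a i)).ofLp (fderiv ℂ F z₀ (a j)).ofLp + sesq (η (F z₀)) (D i) (D j))
    (δ := ∏ i, d i)
    jG jH (gramMat_isHermitian (hηh _) _) (by ext1 i j; exact star_sesq (hηh _) _ _)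
    (by rw [hd, Matrix.det_diagonal]; push_cast; rfl) (Finset.prod_pos fun i _ => hd0 i) (by
      filter_upwards [hline.eventually hmax, hdet1] with z h1 h2
      exact h1 _ h2)
  rw [hd, hinv] at key
  -- The i-th diagonal entry of X H₀⁻¹ Y is the squared length of the projection of D_i to the span
  -- of the image frame. It is at most ⟨D_i, D_i⟩, so the derivative terms together have the
  -- favourable sign.
  have hb : ∀ i, ∑ j, ‖sesq (η (F z₀)) (D i) (fderiv ℂ F z₀ (a j)).ofLp‖ ^ 2 / d j ≤
      (sesq (η (F z₀)) (D i) (D i)).re := fun i =>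
    bessel (hηh _) hηpos (fun i => (hd0 i).ne') hd' (D i)
  have hXY : ∀ i, ((Matrix.of fun i j => sesq (η (F z₀)) (D i) (fderiv ℂ F z₀ (a j)).ofLp) *
      (Matrix.diagonal fun i => ((d i)⁻¹ : ℂ)) *
      (Matrix.of fun i j => sesq (η (F z₀)) (fderiv ℂ F z₀ (a i)).ofLp (D j))) i i =
      ((∑ j, ‖sesq (η (F z₀)) (D i) (fderiv ℂ F z₀ (a j)).ofLp‖ ^ 2 / d j : ℝ) : ℂ) := by
    intro i
    rw [Matrix.mul_apply]
    push_cast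
    refine Finset.sum_congr rfl fun j _ => ?_
    rw [Matrix.mul_diagonal, Matrix.of_apply, Matrix.of_apply, ← star_sesq (hηh _) (D i),
      mul_right_comm, Complex.star_def, Complex.mul_conj, Complex.normSq_eq_norm_sq]
    push_cast
    rfl
  have e1 : ∀ i, ((d i : ℂ))⁻¹ = (((d i)⁻¹ : ℝ) : ℂ) := fun i => by push_cast; rfl
  simp only [Matrix.trace, Matrix.diag_apply, Matrix.diagonal_mul, Matrix.sub_apply, hXY] at key
  simp only [Matrix.of_apply, Complex.re_sum, e1, Complex.re_ofReal_mul,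
    Complex.add_re, Complex.neg_re, Complex.sub_re, Complex.ofReal_re,
    Finset.sum_neg_distrib] at key
  refine neg_le_neg_iff.1 (le_trans ?_ key)
  rw [← Finset.sum_neg_distrib]
  refine Finset.sum_le_sum fun i _ => ?_
  rw [← mul_neg]
  refine mul_le_mul_of_nonneg_left ?_ (inv_pos.2 (hd0 i)).le
  linarith [hb i]

end Local

end Herm

end

/-! ### Metric and curvature in the coordinates of a chart. -/

noncomputable section
namespace Herm
open Filter Topology

section Coordinates

variable {m : ℕ} {M : Type*} [TopologicalSpace M] [ChartedSpace (Cn m) M]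

/-- The Gram matrix of a family of tangent vectors. -/
def gram (g : HermitianMetric m M) (p : M) {ι : Type*} (E : ι → Tan m M p) : Matrix ι ι ℂ :=
  Matrix.of fun i j => g.toForm p (E i) (E j)

/-- The coordinates of tangent vectors in a chart. -/
def chartCoord (e : OpenPartialHomeomorph M (Cn m)) (p : M) : Tan m M p →ₗ[ℂ] Cn m :=
  (mfderiv 𝓘(ℂ, Cn m) 𝓘(ℂ, Cn m) e p).toLinearMap

/-- The tangent vector with given coordinates in a chart. -/
def chartVec (e : OpenPartialHomeomorph M (Cn m)) (z : Cn m) : Cn m →ₗ[ℂ] Tan m M (e.symm z) :=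
  (mfderiv 𝓘(ℂ, Cn m) 𝓘(ℂ, Cn m) e.symm z).toLinearMap

lemma sum_comm_four {α β γ δ R : Type*} [Fintype α] [Fintype β] [Fintype γ] [Fintype δ]
    [AddCommMonoid R] (G : α → β → γ → δ → R) :
    ∑ i, ∑ j, ∑ k, ∑ l, G i j k l = ∑ k, ∑ l, ∑ i, ∑ j, G i j k l := by
  have h := Finset.sum_comm (s := (Finset.univ : Finset (α × β)))
    (t := (Finset.univ : Finset (γ × δ))) (f := fun x y => G x.1 x.2 y.1 y.2)
  simpa only [Fintype.sum_prod_type] using h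

lemma coeff_isHermitian (g : HermitianMetric m M) (e : OpenPartialHomeomorph M (Cn m)) (z : Cn m) :
    (coeff g e z).IsHermitian := by
  ext1 k l
  exact (g.conj_symm _ _ _).symm

lemma toForm_chartVec (g : HermitianMetric m M) (e : OpenPartialHomeomorph M (Cn m)) (z a b : Cn m) :
    g.toForm (e.symm z) (chartVec e z a) (chartVec e z b) = sesq (coeff g e z) a.ofLp b.ofLp := by
  have h : ∀ a : Cn m, chartVec e z a = ∑ k, a k • coordVec e z k := by
    intro a
    conv_lhs => rw [← sum_smul_stdVec a]
    rw [map_sum]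
    simp only [map_smul]
    rfl
  rw [h a, h b, sesq_eq_sum]
  simp only [map_sum, LinearMap.sum_apply, map_smul, LinearMap.smul_apply, LinearMap.map_smulₛₗ,
    smul_eq_mul, Finset.mul_sum]
  rw [Finset.sum_comm]
  refine Finset.sum_congr rfl fun k _ => Finset.sum_congr rfl fun l _ => ?_
  simp only [coeff, Matrix.of_apply]
  rw [starRingEnd_apply]
  ring

lemma contDiffAt_coeff (g : HermitianMetric m M) (x : M) {z : Cn m}
    (hz : z ∈ (chartAt (Cn m) x).target) (k l : Fin m) :
    ContDiffAt ℝ 2 (fun w => coeff g (chartAt (Cn m) x) w k l) z := by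
  have h := (g.smooth _ (chart_mem_atlas (Cn m) x) k l).contDiffAt
    ((chartAt (Cn m) x).open_target.mem_nhds hz)
  exact h.of_le (WithTop.coe_le_coe.2 (le_top : (2 : ℕ∞) ≤ ⊤))

/-- For fixed k and l, summing over i and j turns the Wirtinger derivatives in `chernComp` into
derivatives in direction v, which are the entries of `curvMat`. -/
lemma chern_eq (g : HermitianMetric m M) (p : M) (v a b : Tan m M p) :
    chern g p v v a b =
      sesq (curvMat (coeff g (chartAt (Cn m) p)) (chartAt (Cn m) p p)
        (chartCoord (chartAt (Cn m) p) p v))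
        (chartCoord (chartAt (Cn m) p) p a).ofLp (chartCoord (chartAt (Cn m) p) p b).ofLp := by
  set e := chartAt (Cn m) p with he
  set z := e p with hz
  have hzt : z ∈ e.target := e.map_source (mem_chart_source (Cn m) p)
  set γ := coeff g e with hγ
  have hc : ∀ (u : Tan m M p) (k : Fin m), coordComp e p u k = (chartCoord e p u).ofLp k :=
    fun _ _ => rfl
  simp only [chern, ← he, ← hz, hc]
  set v' := chartCoord e p v
  set a' := (chartCoord e p a).ofLp
  set b' := (chartCoord e p b).ofLp
  have h2 : ∀ k l, ContDiffAt ℝ 2 (fun w => γ w k l) z := contDiffAt_coeff g p hzt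
  have key : ∀ k l, ∑ i, ∑ j, chernComp g e z i j k l * (v'.ofLp i * star (v'.ofLp j)) =
      curvMat γ z v' k l := by
    intro k l
    have hX : ∀ q, linMat γ z v' k q = ∑ i, v'.ofLp i * dz i (fun w => γ w k q) z :=
      fun q => (sum_dz _ z v').symm
    have hY : ∀ q, conjMat γ z v' q l = ∑ j, star (v'.ofLp j) * dzbar j (fun w => γ w q l) z :=
      fun q => (sum_dzbar _ z v').symm
    have hQ : mixedMat γ z v' k l = ∑ i, ∑ j, v'.ofLp i * star (v'.ofLp j) *
        dz i (fun w => dzbar j (fun w' => γ w' k l) w) z := (sum_dz_dzbar (h2 k l) v').symm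
    rw [curvMat, Matrix.sub_apply, Matrix.mul_apply, hQ]
    simp only [chernComp, invCoeff, ← hγ, add_mul, Finset.sum_add_distrib, neg_mul,
      Finset.sum_neg_distrib]
    rw [neg_add_eq_sub]
    congr 1
    · simp only [Finset.sum_mul]
      rw [sum_comm_four]
      refine Finset.sum_congr rfl fun p _ => ?_
      rw [Matrix.mul_apply, Finset.sum_mul]
      refine Finset.sum_congr rfl fun q _ => ?_
      rw [hX, hY, Finset.sum_mul, Finset.sum_mul_sum]
      exact Finset.sum_congr rfl fun i _ => Finset.sum_congr rfl fun j _ => by ring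
    · exact Finset.sum_congr rfl fun i _ => Finset.sum_congr rfl fun j _ => by ring
  rw [sesq_eq_sum]
  rw [sum_comm_four]
  refine Finset.sum_congr rfl fun k _ => Finset.sum_congr rfl fun l _ => ?_
  rw [← key k l]
  simp only [Finset.sum_mul]
  exact Finset.sum_congr rfl fun i _ => Finset.sum_congr rfl fun j _ => by ring

section Smooth

variable [IsManifold 𝓘(ℂ, Cn m) ω M]

lemma chartCoord_chartVec (x : M) {z : Cn m} (hz : z ∈ (chartAt (Cn m) x).target) (a : Cn m) :
    chartCoord (chartAt (Cn m) x) ((chartAt (Cn m) x).symm z) (chartVec (chartAt (Cn m) x) z a)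
      = a := by
  have h1 : IsManifold 𝓘(ℂ, Cn m) 1 M := IsManifold.of_le (n := ω) le_top
  have h := (mdifferentiable_chart (I := 𝓘(ℂ, Cn m)) x).comp_symm_deriv hz
  exact congrArg (fun L => L a) h

lemma chartVec_chartCoord (x : M) {z : Cn m} (hz : z ∈ (chartAt (Cn m) x).target)
    (v : Tan m M ((chartAt (Cn m) x).symm z)) :
    chartVec (chartAt (Cn m) x) z (chartCoord (chartAt (Cn m) x) ((chartAt (Cn m) x).symm z) v)
      = v := by
  have hinj : Function.Injective (chartVec (chartAt (Cn m) x) z) :=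
    Function.LeftInverse.injective (chartCoord_chartVec x hz)
  have hsurj : Function.Surjective (chartVec (chartAt (Cn m) x) z) :=
    LinearMap.injective_iff_surjective (K := ℂ) (V := Cn m)
      (f := (chartVec (chartAt (Cn m) x) z : Cn m →ₗ[ℂ] Cn m)) |>.1 hinj
  obtain ⟨a, rfl⟩ := hsurj v
  rw [chartCoord_chartVec x hz]

lemma chartCoord_bijective (x : M) {y : M} (hy : y ∈ (chartAt (Cn m) x).source) :
    Function.Bijective (chartCoord (chartAt (Cn m) x) y) := by
  obtain ⟨z, hz, rfl⟩ : ∃ z ∈ (chartAt (Cn m) x).target, (chartAt (Cn m) x).symm z = y :=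
    ⟨_, (chartAt (Cn m) x).map_source hy, (chartAt (Cn m) x).left_inv hy⟩
  exact ⟨Function.LeftInverse.injective (chartVec_chartCoord x hz),
    Function.RightInverse.surjective (chartCoord_chartVec x hz)⟩

lemma toForm_eq (g : HermitianMetric m M) (x : M) {y : M} (hy : y ∈ (chartAt (Cn m) x).source)
    (u v : Tan m M y) : g.toForm y u v =
      sesq (coeff g (chartAt (Cn m) x) (chartAt (Cn m) x y))
        (chartCoord (chartAt (Cn m) x) y u).ofLp (chartCoord (chartAt (Cn m) x) y v).ofLp := by
  obtain ⟨z, hz, rfl⟩ : ∃ z ∈ (chartAt (Cn m) x).target, (chartAt (Cn m) x).symm z = y :=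
    ⟨_, (chartAt (Cn m) x).map_source hy, (chartAt (Cn m) x).left_inv hy⟩
  rw [(chartAt (Cn m) x).right_inv hz, ← toForm_chartVec, chartVec_chartCoord x hz,
    chartVec_chartCoord x hz]

lemma gram_eq_gramMat (g : HermitianMetric m M) (x : M) {y : M}
    (hy : y ∈ (chartAt (Cn m) x).source) {ι : Type*} (E : ι → Tan m M y) :
    gram g y E = gramMat (coeff g (chartAt (Cn m) x) (chartAt (Cn m) x y))
      (fun i => chartCoord (chartAt (Cn m) x) y (E i)) := by
  ext1 i j
  exact toForm_eq g x hy _ _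

lemma sesq_coeff_pos (g : HermitianMetric m M) (x : M) {z : Cn m}
    (hz : z ∈ (chartAt (Cn m) x).target) {a : Cn m} (ha : a ≠ 0) :
    0 < (sesq (coeff g (chartAt (Cn m) x) z) a.ofLp a.ofLp).re := by
  rw [← toForm_chartVec]
  refine g.pos _ _ fun h => ha ?_
  rw [← chartCoord_chartVec x hz a, h, map_zero]

lemma sesq_coeff_nonneg (g : HermitianMetric m M) (x : M) {z : Cn m}
    (hz : z ∈ (chartAt (Cn m) x).target) (a : Fin m → ℂ) :
    0 ≤ (sesq (coeff g (chartAt (Cn m) x) z) a a).re := by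
  by_cases ha : WithLp.toLp 2 a = (0 : Cn m)
  · have : a = 0 := congrArg WithLp.ofLp ha
    simp [this, sesq]
  · exact (sesq_coeff_pos g x hz ha).le

lemma isUnit_det_coeff (g : HermitianMetric m M) (x : M) {z : Cn m}
    (hz : z ∈ (chartAt (Cn m) x).target) : IsUnit (coeff g (chartAt (Cn m) x) z).det := by
  rw [isUnit_iff_ne_zero]
  intro h
  obtain ⟨v, hv, hv0⟩ := Matrix.exists_vecMul_eq_zero_iff.2 h
  have h1 := sesq_coeff_pos g x hz (a := WithLp.toLp 2 v)
    (fun h => hv (congrArg WithLp.ofLp h))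
  simp only [sesq, Matrix.dotProduct_mulVec, hv0, zero_dotProduct, Complex.zero_re, lt_irrefl] at h1

end Smooth

end Coordinates

/-! ### The tangent map in charts, and the Bochner inequalities on manifolds. -/

section Map

variable {m n : ℕ} {M N : Type*} [TopologicalSpace M] [ChartedSpace (Cn m) M]
  [IsManifold 𝓘(ℂ, Cn m) ω M] [TopologicalSpace N] [ChartedSpace (Cn n) N]
  [IsManifold 𝓘(ℂ, Cn n) ω N] {f : M → N}

/-- The tangent map of `f`. -/
def tangentMapAt (m n : ℕ) {M N : Type*} [TopologicalSpace M] [ChartedSpace (Cn m) M]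
    [TopologicalSpace N] [ChartedSpace (Cn n) N] (f : M → N) (x : M) :
    Tan m M x →ₗ[ℂ] Tan n N (f x) :=
  (mfderiv 𝓘(ℂ, Cn m) 𝓘(ℂ, Cn n) f x).toLinearMap

/-- The representation of `f` in the charts at `x` and at `f x`. -/
def localRep (m n : ℕ) {M N : Type*} [TopologicalSpace M] [ChartedSpace (Cn m) M]
    [TopologicalSpace N] [ChartedSpace (Cn n) N] (f : M → N) (x : M) (z : Cn m) : Cn n :=
  chartAt (Cn n) (f x) (f ((chartAt (Cn m) x).symm z))

lemma analyticAt_localRep (hf : ContMDiff 𝓘(ℂ, Cn m) 𝓘(ℂ, Cn n) ω f) (x : M) {y : M}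
    (hy : y ∈ (chartAt (Cn m) x).source) (hfy : f y ∈ (chartAt (Cn n) (f x)).source) :
    AnalyticAt ℂ (localRep m n f x) (chartAt (Cn m) x y) := by
  have hyt := (chartAt (Cn m) x).map_source hy
  have h1 : ContMDiffAt 𝓘(ℂ, Cn m) 𝓘(ℂ, Cn m) ω (chartAt (Cn m) x).symm (chartAt (Cn m) x y) :=
    (contMDiffOn_chart_symm (x := x)).contMDiffAt ((chartAt (Cn m) x).open_target.mem_nhds hyt)
  have h2 : ContMDiffAt 𝓘(ℂ, Cn n) 𝓘(ℂ, Cn n) ω (chartAt (Cn n) (f x)) (f y) :=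
    (contMDiffOn_chart (x := f x)).contMDiffAt ((chartAt (Cn n) (f x)).open_source.mem_nhds hfy)
  have h3 : ContMDiffAt 𝓘(ℂ, Cn m) 𝓘(ℂ, Cn n) ω (localRep m n f x) (chartAt (Cn m) x y) := by
    refine ContMDiffAt.comp (g := chartAt (Cn n) (f x)) (chartAt (Cn m) x y) ?_
      (ContMDiffAt.comp (g := f) (chartAt (Cn m) x y) (hf _) h1)
    rwa [(chartAt (Cn m) x).left_inv hy]
  exact analyticWithinAt_univ.1
    (contDiffWithinAt_omega_iff_analyticWithinAt.1 (contDiffWithinAt_univ.2 h3.contDiffAt))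

lemma chartCoord_tangentMapAt (hf : ContMDiff 𝓘(ℂ, Cn m) 𝓘(ℂ, Cn n) ω f) (x : M) {y : M}
    (hy : y ∈ (chartAt (Cn m) x).source) (hfy : f y ∈ (chartAt (Cn n) (f x)).source)
    (u : Tan m M y) : chartCoord (chartAt (Cn n) (f x)) (f y) (tangentMapAt m n f y u) =
      fderiv ℂ (localRep m n f x) (chartAt (Cn m) x y) (chartCoord (chartAt (Cn m) x) y u) := by
  have i1 : IsManifold 𝓘(ℂ, Cn m) 1 M := IsManifold.of_le (n := ω) le_top
  have i2 : IsManifold 𝓘(ℂ, Cn n) 1 N := IsManifold.of_le (n := ω) le_top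
  have hfd : MDifferentiableAt 𝓘(ℂ, Cn m) 𝓘(ℂ, Cn n) f y := hf.mdifferentiable (by simp) y
  have hψ : MDifferentiableAt 𝓘(ℂ, Cn n) 𝓘(ℂ, Cn n) (chartAt (Cn n) (f x)) (f y) :=
    (mdifferentiable_chart (I := 𝓘(ℂ, Cn n)) (f x)).mdifferentiableAt hfy
  have he : MDifferentiableAt 𝓘(ℂ, Cn m) 𝓘(ℂ, Cn m) (chartAt (Cn m) x) y :=
    (mdifferentiable_chart (I := 𝓘(ℂ, Cn m)) x).mdifferentiableAt hy
  have hF : MDifferentiableAt 𝓘(ℂ, Cn m) 𝓘(ℂ, Cn n) (localRep m n f x) (chartAt (Cn m) x y) :=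
    (analyticAt_localRep hf x hy hfy).differentiableAt.mdifferentiableAt
  have e1 := mfderiv_comp y hψ hfd
  have e2 := mfderiv_comp y hF he
  have e3 : (chartAt (Cn n) (f x)) ∘ f =ᶠ[𝓝 y] localRep m n f x ∘ chartAt (Cn m) x := by
    filter_upwards [(chartAt (Cn m) x).open_source.mem_nhds hy] with w hw
    simp only [Function.comp_apply, localRep]
    rw [(chartAt (Cn m) x).left_inv hw]
  rw [e3.mfderiv_eq, e2] at e1
  have e4 := congrArg (fun L => L u) e1
  rw [mfderiv_eq_fderiv] at e4
  exact e4.symm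

variable {ι : Type*} [Fintype ι] [DecidableEq ι]

/-- Coordinate families near the centre come from tangent vectors, and the Gram matrices are the
same in both descriptions. The relation R is abstract so as to cover both the trace and the
determinant inequality. -/
lemma local_max_of_max {g : HermitianMetric m M} {h : HermitianMetric n N}
    (hf : ContMDiff 𝓘(ℂ, Cn m) 𝓘(ℂ, Cn n) ω f) (x : M) {R : Matrix ι ι ℂ → Matrix ι ι ℂ → Prop}
    (hR : ∀ (y : M) (E : ι → Tan m M y), (gram g y E).det ≠ 0 →
      R (gram g y E) (gram h (f y) fun i => tangentMapAt m n f y (E i))) :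
    ∀ᶠ z in 𝓝 (chartAt (Cn m) x x), ∀ b : ι → Cn m,
      (gramMat (coeff g (chartAt (Cn m) x) z) b).det ≠ 0 →
      R (gramMat (coeff g (chartAt (Cn m) x) z) b)
        (gramMat (coeff h (chartAt (Cn n) (f x)) (localRep m n f x z))
          fun i => fderiv ℂ (localRep m n f x) z (b i)) := by
  have hx := mem_chart_source (Cn m) x
  have hxt := (chartAt (Cn m) x).map_source hx
  have hc : ContinuousAt (fun z => f ((chartAt (Cn m) x).symm z)) (chartAt (Cn m) x x) :=
    ContinuousAt.comp (f := (chartAt (Cn m) x).symm) hf.continuous.continuousAt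
      ((chartAt (Cn m) x).continuousAt_symm hxt)
  have hmem : (chartAt (Cn n) (f x)).source ∈ 𝓝 (f ((chartAt (Cn m) x).symm
      (chartAt (Cn m) x x))) := by
    rw [(chartAt (Cn m) x).left_inv hx]
    exact (chartAt (Cn n) (f x)).open_source.mem_nhds (mem_chart_source _ _)
  filter_upwards [(chartAt (Cn m) x).open_target.mem_nhds hxt, hc hmem] with z hz hz' b hb
  set y := (chartAt (Cn m) x).symm z with hy
  have hys : y ∈ (chartAt (Cn m) x).source := (chartAt (Cn m) x).map_target hz
  have hyz : chartAt (Cn m) x y = z := (chartAt (Cn m) x).right_inv hz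
  have h1 := gram_eq_gramMat g x hys fun i => chartVec (chartAt (Cn m) x) z (b i)
  have h2 := gram_eq_gramMat h (f x) hz'
    fun i => tangentMapAt m n f y (chartVec (chartAt (Cn m) x) z (b i))
  have hcc : ∀ i, chartCoord (chartAt (Cn m) x) y (chartVec (chartAt (Cn m) x) z (b i)) = b i :=
    fun i => chartCoord_chartVec x hz (b i)
  simp only [hcc, hyz] at h1
  have h5 : ∀ i, chartCoord (chartAt (Cn n) (f x)) (f y)
      (tangentMapAt m n f y (chartVec (chartAt (Cn m) x) z (b i))) =
      fderiv ℂ (localRep m n f x) z (b i) := fun i => by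
    rw [chartCoord_tangentMapAt hf x hys hz', hcc, hyz]
  have h2' := h2.trans (congrArg (gramMat _) (funext h5))
  have h3 := hR y fun i => chartVec (chartAt (Cn m) x) z (b i)
  rw [h1, h2'] at h3
  exact h3 hb

/-- This is `local_trace_le` in the charts at x and f x, the very charts that define `chern` at
these two points. No invariance of the curvature under change of chart is involved. -/
theorem trace_bochner {g : HermitianMetric m M} {h : HermitianMetric n N}
    (hf : ContMDiff 𝓘(ℂ, Cn m) 𝓘(ℂ, Cn n) ω f) (x : M) (E : ι → Tan m M x) (hE : gram g x E = 1)
    {d : ι → ℝ} (hd : (gram h (f x) fun i => tangentMapAt m n f x (E i)) =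
      Matrix.diagonal fun i => (d i : ℂ))
    (hmax : ∀ (y : M) (E' : ι → Tan m M y), (gram g y E').det ≠ 0 →
      ((gram g y E').adjugate * (gram h (f y) fun i => tangentMapAt m n f y (E' i))).trace.re ≤
        (∑ i, d i) * (gram g y E').det.re) (v : Tan m M x) :
    ∑ i, d i * (chern g x v v (E i) (E i)).re ≤
      ∑ i, (chern h (f x) (tangentMapAt m n f x v) (tangentMapAt m n f x v)
        (tangentMapAt m n f x (E i)) (tangentMapAt m n f x (E i))).re := by
  have hx := mem_chart_source (Cn m) x
  have hfx := mem_chart_source (Cn n) (f x)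
  have hxt := (chartAt (Cn m) x).map_source hx
  have hfxt := (chartAt (Cn n) (f x)).map_source hfx
  have hF0 : localRep m n f x (chartAt (Cn m) x x) = chartAt (Cn n) (f x) (f x) := by
    rw [localRep, (chartAt (Cn m) x).left_inv hx]
  rw [gram_eq_gramMat g x hx] at hE
  rw [gram_eq_gramMat h (f x) hfx] at hd
  simp only [chartCoord_tangentMapAt hf x hx hfx] at hd
  have := local_trace_le (γ := coeff g (chartAt (Cn m) x)) (η := coeff h (chartAt (Cn n) (f x)))
    (F := localRep m n f x) (z₀ := chartAt (Cn m) x x) (contDiffAt_coeff g x hxt)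
    (coeff_isHermitian g _) (isUnit_det_coeff g x hxt)
    (by rw [hF0]; exact contDiffAt_coeff h (f x) hfxt) (coeff_isHermitian h _)
    (by rw [hF0]; exact isUnit_det_coeff h (f x) hfxt)
    (by rw [hF0]; exact sesq_coeff_nonneg h (f x) hfxt) (analyticAt_localRep hf x hx hfx)
    (fun i => chartCoord (chartAt (Cn m) x) x (E i)) hE (d := d) (by rw [hF0]; exact hd)
    (local_max_of_max hf x (R := fun G H => (G.adjugate * H).trace.re ≤ (∑ i, d i) * G.det.re)
      hmax) (chartCoord (chartAt (Cn m) x) x v)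
  rw [hF0] at this
  simpa only [chern_eq, chartCoord_tangentMapAt hf x hx hfx] using this

theorem det_bochner {g : HermitianMetric m M} {h : HermitianMetric n N}
    (hf : ContMDiff 𝓘(ℂ, Cn m) 𝓘(ℂ, Cn n) ω f) (x : M) (E : ι → Tan m M x) (hE : gram g x E = 1)
    {d : ι → ℝ} (hd0 : ∀ i, 0 < d i) (hd : (gram h (f x) fun i => tangentMapAt m n f x (E i)) =
      Matrix.diagonal fun i => (d i : ℂ))
    (hmax : ∀ (y : M) (E' : ι → Tan m M y), (gram g y E').det ≠ 0 →
      (gram h (f y) fun i => tangentMapAt m n f y (E' i)).det.re ≤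
        (∏ i, d i) * (gram g y E').det.re) (v : Tan m M x) :
    ∑ i, (chern g x v v (E i) (E i)).re ≤
      ∑ i, (d i)⁻¹ * (chern h (f x) (tangentMapAt m n f x v) (tangentMapAt m n f x v)
        (tangentMapAt m n f x (E i)) (tangentMapAt m n f x (E i))).re := by
  have hx := mem_chart_source (Cn m) x
  have hfx := mem_chart_source (Cn n) (f x)
  have hxt := (chartAt (Cn m) x).map_source hx
  have hfxt := (chartAt (Cn n) (f x)).map_source hfx
  have hF0 : localRep m n f x (chartAt (Cn m) x x) = chartAt (Cn n) (f x) (f x) := by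
    rw [localRep, (chartAt (Cn m) x).left_inv hx]
  rw [gram_eq_gramMat g x hx] at hE
  rw [gram_eq_gramMat h (f x) hfx] at hd
  simp only [chartCoord_tangentMapAt hf x hx hfx] at hd
  have := local_det_le (γ := coeff g (chartAt (Cn m) x)) (η := coeff h (chartAt (Cn n) (f x)))
    (F := localRep m n f x) (z₀ := chartAt (Cn m) x x) (contDiffAt_coeff g x hxt)
    (coeff_isHermitian g _) (isUnit_det_coeff g x hxt)
    (by rw [hF0]; exact contDiffAt_coeff h (f x) hfxt) (coeff_isHermitian h _)
    (by rw [hF0]; exact isUnit_det_coeff h (f x) hfxt)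
    (by rw [hF0]; exact sesq_coeff_nonneg h (f x) hfxt) (analyticAt_localRep hf x hx hfx)
    (fun i => chartCoord (chartAt (Cn m) x) x (E i)) hE (d := d) hd0 (by rw [hF0]; exact hd)
    (local_max_of_max hf x (R := fun G H => H.det.re ≤ (∏ i, d i) * G.det.re)
      hmax) (chartCoord (chartAt (Cn m) x) x v)
  rw [hF0] at this
  simpa only [chern_eq, chartCoord_tangentMapAt hf x hx hfx] using this

end Map

end Herm

end

/-! ### Unitary frames, and existence of a maximal one. -/

noncomputable section
namespace Herm
open Filter Topology Matrix

section Frames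

variable {ι : Type*} {m : ℕ} {M : Type*} [TopologicalSpace M] [ChartedSpace (Cn m) M]

lemma gram_isHermitian (g : HermitianMetric m M) (p : M) (E : ι → Tan m M p) :
    (gram g p E).IsHermitian := by
  ext1 i j
  exact (g.conj_symm _ _ _).symm

lemma toForm_self_nonneg (g : HermitianMetric m M) (p : M) (v : Tan m M p) :
    0 ≤ (g.toForm p v v).re := by
  by_cases h : v = 0
  · simp [h]
  · exact (g.pos p v h).le

variable [Fintype ι]

/-- The family `S E` obtained from a family `E` by a change of frame. -/
def frameChange {V : Type*} [AddCommGroup V] [Module ℂ V] (S : Matrix ι ι ℂ) (E : ι → V) : ι → V :=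
  fun i => ∑ j, S i j • E j

lemma gram_frameChange (g : HermitianMetric m M) (p : M) (S : Matrix ι ι ℂ) (E : ι → Tan m M p) :
    gram g p (frameChange S E) = S * gram g p E * Sᴴ := by
  ext1 i j
  simp only [gram, frameChange, Matrix.of_apply, Matrix.mul_apply, conjTranspose_apply, map_sum,
    LinearMap.sum_apply, map_smul, LinearMap.smul_apply, LinearMap.map_smulₛₗ, smul_eq_mul,
    Finset.sum_mul, Finset.mul_sum]
  refine Finset.sum_congr rfl fun k _ => Finset.sum_congr rfl fun l _ => ?_
  rw [starRingEnd_apply]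
  ring

lemma map_frameChange {V W : Type*} [AddCommGroup V] [Module ℂ V] [AddCommGroup W] [Module ℂ W]
    (L : V →ₗ[ℂ] W) (S : Matrix ι ι ℂ) (E : ι → V) :
    (fun i => L (frameChange S E i)) = frameChange S fun i => L (E i) := by
  funext i
  simp [frameChange, map_sum]

variable [DecidableEq ι]

lemma exists_unitary_diagonalization {A : Matrix ι ι ℂ} (hA : A.IsHermitian) :
    ∃ (S : Matrix ι ι ℂ) (d : ι → ℝ), S * Sᴴ = 1 ∧
      S * A * Sᴴ = Matrix.diagonal fun i => (d i : ℂ) := by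
  refine ⟨star (hA.eigenvectorUnitary : Matrix ι ι ℂ), hA.eigenvalues, ?_, ?_⟩
  · rw [star_eq_conjTranspose, conjTranspose_conjTranspose, ← star_eq_conjTranspose,
      Unitary.coe_star_mul_self]
  · have h := hA.conjStarAlgAut_star_eigenvectorUnitary
    rw [Unitary.conjStarAlgAut_star_apply] at h
    rw [star_eq_conjTranspose, conjTranspose_conjTranspose, ← star_eq_conjTranspose, h]
    rfl

/-- Every family with invertible Gram matrix has a unitary change of frame. -/
lemma exists_frameChange_unitary (g : HermitianMetric m M) (p : M) (E : ι → Tan m M p)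
    (hE : (gram g p E).det ≠ 0) : ∃ S : Matrix ι ι ℂ, S * gram g p E * Sᴴ = 1 := by
  obtain ⟨S, d, hS, hd⟩ := exists_unitary_diagonalization (gram_isHermitian g p E)
  have hS' : S.det * Sᴴ.det = 1 := by rw [← det_mul, hS, det_one]
  have hdet : ∏ i, (d i : ℂ) ≠ 0 := by
    rw [← det_diagonal, ← hd, det_mul, det_mul, mul_right_comm, hS', one_mul]
    exact hE
  have hpos : ∀ i, 0 < d i := by
    intro i
    have h0 : d i ≠ 0 := fun h => hdet (Finset.prod_eq_zero (Finset.mem_univ i) (by simp [h]))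
    have h1 : (g.toForm p (frameChange S E i) (frameChange S E i)).re = d i := by
      have := congrFun (congrFun ((gram_frameChange g p S E).trans hd) i) i
      rw [diagonal_apply_eq] at this
      exact (congrArg Complex.re this).trans (Complex.ofReal_re _)
    exact lt_of_le_of_ne (h1 ▸ toForm_self_nonneg g p _) h0.symm
  -- The diagonalising frame is orthogonal with squared lengths d_i > 0; it remains to normalise it.
  refine ⟨(Matrix.diagonal fun i => (((Real.sqrt (d i))⁻¹ : ℝ) : ℂ)) * S, ?_⟩
  have e : ∀ D : Matrix ι ι ℂ, D * S * gram g p E * (D * S)ᴴ = D * (S * gram g p E * Sᴴ) * Dᴴ := by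
    intro D
    rw [conjTranspose_mul]
    simp only [Matrix.mul_assoc]
  rw [e, hd, diagonal_conjTranspose, diagonal_mul_diagonal, diagonal_mul_diagonal, ← diagonal_one]
  congr 1
  funext i
  simp only [Pi.star_apply, Complex.star_def, Complex.conj_ofReal, ← Complex.ofReal_mul]
  have h2 := Real.mul_self_sqrt (hpos i).le
  have h3 : Real.sqrt (d i) ≠ 0 := (Real.sqrt_pos.2 (hpos i)).ne'
  have h4 : (Real.sqrt (d i))⁻¹ * d i * (Real.sqrt (d i))⁻¹ = 1 := by
    nth_rewrite 2 [← h2]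
    field_simp
  rw [h4, Complex.ofReal_one]

end Frames

section Continuity

variable {ι : Type*} {κ : Type*} [Fintype κ]

lemma continuousAt_gramMat {X : Type*} [TopologicalSpace X] {x : X} {γ : X → Matrix κ κ ℂ}
    {A : X → ι → EuclideanSpace ℂ κ} (hγ : ∀ k l, ContinuousAt (fun y => γ y k l) x)
    (hA : ∀ i, ContinuousAt (fun y => A y i) x) :
    ContinuousAt (fun y => gramMat (γ y) (A y)) x := by
  have hAk : ∀ i k, ContinuousAt (fun y => (A y i).ofLp k) x := fun i k =>
    (EuclideanSpace.proj k : EuclideanSpace ℂ κ →L[ℂ] ℂ).continuous.continuousAt.comp (hA i)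
  refine continuousAt_pi.2 fun i => continuousAt_pi.2 fun j => ?_
  simp only [gramMat, Matrix.of_apply, sesq_eq_sum]
  exact tendsto_finsetSum _ fun k _ => tendsto_finsetSum _ fun l _ =>
    ((hγ k l).mul (hAk i k)).mul ((hAk j l).star)

end Continuity

section Max

variable {m n : ℕ} {M N : Type*} [TopologicalSpace M] [ChartedSpace (Cn m) M]
  [IsManifold 𝓘(ℂ, Cn m) ω M] [TopologicalSpace N] [ChartedSpace (Cn n) N]
  [IsManifold 𝓘(ℂ, Cn n) ω N] {f : M → N} {ι : Type*} [Fintype ι] [DecidableEq ι]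

/-- Positivity on the compact set K × sphere gives c, and homogeneity extends the bound to all
vectors. It bounds the coordinates of unitary frames over K. -/
lemma exists_lower_bound_coeff (g : HermitianMetric m M) (x : M) {K : Set (Cn m)}
    (hK : IsCompact K) (hKt : K ⊆ (chartAt (Cn m) x).target) :
    ∃ c : ℝ, 0 < c ∧ ∀ z ∈ K, ∀ a : Cn m,
      c * ‖a‖ ^ 2 ≤ (sesq (coeff g (chartAt (Cn m) x) z) a.ofLp a.ofLp).re := by
  set γ := coeff g (chartAt (Cn m) x)
  have hc : ContinuousOn (fun p : Cn m × Cn m => (sesq (γ p.1) p.2.ofLp p.2.ofLp).re)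
      (K ×ˢ Metric.sphere 0 1) := by
    intro p hp
    refine ContinuousAt.continuousWithinAt ?_
    have h := continuousAt_gramMat (ι := Unit) (x := p) (γ := fun p : Cn m × Cn m => γ p.1)
      (A := fun p _ => p.2)
      (fun k l => ((contDiffAt_coeff g x (hKt hp.1) k l).continuousAt).comp
        (continuous_fst.continuousAt))
      (fun _ => continuous_snd.continuousAt)
    exact Complex.continuous_re.continuousAt.comp
      (continuousAt_pi.1 (continuousAt_pi.1 h ()) ())
  obtain ⟨c, hc0, hcb⟩ := (hK.prod (isCompact_sphere (0 : Cn m) 1)).exists_forall_le' hc (a := 0)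
    (fun p hp => sesq_coeff_pos g x (hKt hp.1) fun h => by simpa [h] using hp.2)
  refine ⟨c, hc0, fun z hz a => ?_⟩
  by_cases ha : a = 0
  · simp [ha, sesq]
  have hn : ‖a‖ ≠ 0 := norm_ne_zero_iff.2 ha
  have h1 := hcb (z, ((‖a‖⁻¹ : ℝ) : ℂ) • a) ⟨hz, by
    rw [mem_sphere_zero_iff_norm, norm_smul, Complex.norm_real, norm_inv, norm_norm,
      inv_mul_cancel₀ hn]⟩
  have h2 : sesq (γ z) (((‖a‖⁻¹ : ℝ) : ℂ) • a).ofLp (((‖a‖⁻¹ : ℝ) : ℂ) • a).ofLp =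
      ((‖a‖⁻¹ ^ 2 : ℝ) : ℂ) * sesq (γ z) a.ofLp a.ofLp := by
    simp only [sesq, WithLp.ofLp_smul, star_smul, mulVec_smul, dotProduct_smul, smul_dotProduct,
      smul_eq_mul, Complex.star_def, Complex.conj_ofReal]
    push_cast
    ring
  simp only [h2, Complex.re_ofReal_mul] at h1
  have h3 := mul_le_mul_of_nonneg_right h1 (sq_nonneg ‖a‖)
  have h4 : ‖a‖⁻¹ ^ 2 * (sesq (γ z) a.ofLp a.ofLp).re * ‖a‖ ^ 2 = (sesq (γ z) a.ofLp a.ofLp).re := by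
    field_simp
  linarith

/-- Over a closed coordinate ball, unitary frames form a compact set of pairs (point, coordinate
frame), on which Φ has a maximum. The frame E₀ is a default for the case that this set is empty, so
x₁ need not lie in K. -/
lemma exists_local_max (g : HermitianMetric m M) (h : HermitianMetric n N)
    (hf : ContMDiff 𝓘(ℂ, Cn m) 𝓘(ℂ, Cn n) ω f) {Φ : Matrix ι ι ℂ → ℝ} (hΦ : Continuous Φ)
    {x₀ : M} {E₀ : ι → Tan m M x₀} (hE₀ : gram g x₀ E₀ = 1) (x : M) :
    ∃ K ∈ 𝓝 x, ∃ (x₁ : M) (E₁ : ι → Tan m M x₁), gram g x₁ E₁ = 1 ∧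
      ∀ y ∈ K, ∀ E : ι → Tan m M y, gram g y E = 1 →
        Φ (gram h (f y) fun i => tangentMapAt m n f y (E i)) ≤
          Φ (gram h (f x₁) fun i => tangentMapAt m n f x₁ (E₁ i)) := by
  set e := chartAt (Cn m) x with he
  set F := localRep m n f x with hF
  set γ := coeff g e with hγ
  set η := coeff h (chartAt (Cn n) (f x)) with hη
  have hx : x ∈ e.source := mem_chart_source (Cn m) x
  have hxt := e.map_source hx
  set Ω : Set (Cn m) := e.target ∩ {z | f (e.symm z) ∈ (chartAt (Cn n) (f x)).source} with hΩ
  have hΩn : Ω ∈ 𝓝 (e x) := by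
    refine inter_mem (e.open_target.mem_nhds hxt) ?_
    have hc : ContinuousAt (fun z => f (e.symm z)) (e x) :=
      ContinuousAt.comp (f := e.symm) hf.continuous.continuousAt (e.continuousAt_symm hxt)
    refine hc ?_
    simp only [e.left_inv hx]
    exact (chartAt (Cn n) (f x)).open_source.mem_nhds (mem_chart_source _ _)
  obtain ⟨r, hr, hball⟩ := Metric.nhds_basis_closedBall.mem_iff.1 hΩn
  set B := Metric.closedBall (e x) r with hB
  have hBc : IsCompact B := isCompact_closedBall _ _
  obtain ⟨c, hc0, hc⟩ := exists_lower_bound_coeff g x hBc fun z hz => (hball hz).1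
  have cG : ∀ p ∈ B ×ˢ (Set.univ : Set (ι → Cn m)),
      ContinuousAt (fun p : Cn m × (ι → Cn m) => gramMat (γ p.1) p.2) p := fun p hp =>
    continuousAt_gramMat (fun k l => ((contDiffAt_coeff g x (hball hp.1).1 k l).continuousAt).comp
      continuous_fst.continuousAt) fun i => ((continuous_apply i).comp continuous_snd).continuousAt
  have hFan : ∀ z ∈ B, AnalyticAt ℂ F z := by
    intro z hz
    have h1 := analyticAt_localRep hf x (e.map_target (hball hz).1) (hball hz).2
    rwa [e.right_inv (hball hz).1] at h1
  have cH : ∀ p ∈ B ×ˢ (Set.univ : Set (ι → Cn m)), ContinuousAt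
      (fun p : Cn m × (ι → Cn m) => gramMat (η (F p.1)) fun i => fderiv ℂ F p.1 (p.2 i)) p := by
    intro p hp
    have h1 := (hFan p.1 hp.1).continuousAt.comp (x := p) continuous_fst.continuousAt
    have h2 := (hFan p.1 hp.1).fderiv.continuousAt.comp (x := p) continuous_fst.continuousAt
    refine continuousAt_gramMat (fun k l => ?_) fun i => ?_
    · refine ContinuousAt.comp (g := fun w => η w k l) ?_ h1
      exact (contDiffAt_coeff h (f x) ((chartAt (Cn n) (f x)).map_source (hball hp.1).2)
        k l).continuousAt
    · exact h2.clm_apply ((continuous_apply i).comp continuous_snd).continuousAt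
  set S : Set (Cn m × (ι → Cn m)) := (B ×ˢ Set.univ) ∩
    (fun p : Cn m × (ι → Cn m) => gramMat (γ p.1) p.2) ⁻¹' {1} with hS
  have hScl : IsClosed S := ContinuousOn.preimage_isClosed_of_isClosed
    (fun p hp => (cG p hp).continuousWithinAt)
    (Metric.isClosed_closedBall.prod isClosed_univ) isClosed_singleton
  have hSc : IsCompact S := by
    -- Unitarity gives ‖a‖² ≤ c⁻¹ for each frame vector; the radius c⁻¹ + 1 bounds ‖a‖ without a
    -- square root.
    refine IsCompact.of_isClosed_subset
      (hBc.prod (isCompact_closedBall (0 : ι → Cn m) (c⁻¹ + 1))) hScl fun p hp => ?_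
    refine ⟨hp.1.1, ?_⟩
    rw [mem_closedBall_zero_iff]
    refine (pi_norm_le_iff_of_nonneg (by positivity)).2 fun i => ?_
    have h1 := hc p.1 hp.1.1 (p.2 i)
    have h2 : sesq (γ p.1) (p.2 i).ofLp (p.2 i).ofLp = 1 := by
      have := congrFun (congrFun hp.2 i) i
      rwa [one_apply_eq] at this
    rw [h2, Complex.one_re] at h1
    have h3 : ‖p.2 i‖ ^ 2 ≤ c⁻¹ := by
      rwa [← one_div, le_div_iff₀ hc0, mul_comm]
    nlinarith [sq_nonneg (‖p.2 i‖ - 1)]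
  have hK : e.source ∩ e ⁻¹' B ∈ 𝓝 x := inter_mem (e.open_source.mem_nhds hx)
    ((e.continuousAt hx).preimage_mem_nhds (Metric.closedBall_mem_nhds _ hr))
  refine ⟨e.source ∩ e ⁻¹' B, hK, ?_⟩
  have tr : ∀ y ∈ e.source ∩ e ⁻¹' B, ∀ E : ι → Tan m M y,
      gram g y E = gramMat (γ (e y)) (fun i => chartCoord e y (E i)) ∧
      (gram h (f y) fun i => tangentMapAt m n f y (E i)) =
        gramMat (η (F (e y))) fun i => fderiv ℂ F (e y) (chartCoord e y (E i)) := by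
    intro y hy E
    have hfy : f y ∈ (chartAt (Cn n) (f x)).source := by
      have := (hball hy.2).2
      simpa only [Set.mem_ofPred_eq, e.left_inv hy.1] using this
    refine ⟨gram_eq_gramMat g x hy.1 E, (gram_eq_gramMat h (f x) hfy _).trans ?_⟩
    have e1 : chartAt (Cn n) (f x) (f y) = F (e y) := by
      rw [hF, localRep, ← he, e.left_inv hy.1]
    rw [e1]
    exact congrArg _ (funext fun i => chartCoord_tangentMapAt hf x hy.1 hfy (E i))
  rcases S.eq_empty_or_nonempty with hSe | hSne
  · refine ⟨x₀, E₀, hE₀, fun y hy E hE => ?_⟩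
    have : (e y, fun i => chartCoord e y (E i)) ∈ S :=
      ⟨⟨hy.2, Set.mem_univ _⟩, (tr y hy E).1.symm.trans hE⟩
    rw [hSe] at this
    exact this.elim
  · obtain ⟨⟨z, a⟩, hza, hmax⟩ := hSc.exists_isMaxOn hSne
      (f := fun p : Cn m × (ι → Cn m) =>
        Φ (gramMat (η (F p.1)) fun i => fderiv ℂ F p.1 (p.2 i)))
      fun p hp => (hΦ.continuousAt.comp (cH p hp.1)).continuousWithinAt
    have hzt : z ∈ e.target := (hball hza.1.1).1
    have hyK : e.symm z ∈ e.source ∩ e ⁻¹' B :=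
      ⟨e.map_target hzt, by simpa only [Set.mem_preimage, e.right_inv hzt] using hza.1.1⟩
    have hcc : ∀ i, chartCoord e (e.symm z) (chartVec e z (a i)) = a i :=
      fun i => chartCoord_chartVec x hzt (a i)
    obtain ⟨t1, t2⟩ := tr _ hyK fun i => chartVec e z (a i)
    simp only [hcc, e.right_inv hzt] at t1 t2
    refine ⟨e.symm z, fun i => chartVec e z (a i), t1.trans hza.2, fun y hy E hE => ?_⟩
    have hmem : (e y, fun i => chartCoord e y (E i)) ∈ S :=
      ⟨⟨hy.2, Set.mem_univ _⟩, (tr y hy E).1.symm.trans hE⟩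
    have hm := isMaxOn_iff.1 hmax _ hmem
    dsimp only at hm
    exact ((congrArg Φ (tr y hy E).2).le.trans hm).trans (congrArg Φ t2).ge

/-- Compactness in the form of induction over subsets: of two dominating frames keep the better one.
The frame bundle itself needs no topology. -/
lemma exists_max_unitary [CompactSpace M] (g : HermitianMetric m M) (h : HermitianMetric n N)
    (hf : ContMDiff 𝓘(ℂ, Cn m) 𝓘(ℂ, Cn n) ω f) {Φ : Matrix ι ι ℂ → ℝ} (hΦ : Continuous Φ)
    {x₀ : M} {E₀ : ι → Tan m M x₀} (hE₀ : gram g x₀ E₀ = 1) :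
    ∃ (x₁ : M) (E₁ : ι → Tan m M x₁), gram g x₁ E₁ = 1 ∧
      ∀ (y : M) (E : ι → Tan m M y), gram g y E = 1 →
        Φ (gram h (f y) fun i => tangentMapAt m n f y (E i)) ≤
          Φ (gram h (f x₁) fun i => tangentMapAt m n f x₁ (E₁ i)) := by
  have key := (isCompact_univ (X := M)).induction_on
    (p := fun K => ∃ (x₁ : M) (E₁ : ι → Tan m M x₁), gram g x₁ E₁ = 1 ∧
      ∀ y ∈ K, ∀ E : ι → Tan m M y, gram g y E = 1 →
        Φ (gram h (f y) fun i => tangentMapAt m n f y (E i)) ≤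
          Φ (gram h (f x₁) fun i => tangentMapAt m n f x₁ (E₁ i)))
    ⟨x₀, E₀, hE₀, fun y hy => hy.elim⟩
    (fun s t hst ⟨x₁, E₁, h1, h2⟩ => ⟨x₁, E₁, h1, fun y hy => h2 y (hst hy)⟩)
    (by
      rintro s t ⟨x₁, E₁, h1, h2⟩ ⟨x₂, E₂, h3, h4⟩
      rcases le_total (Φ (gram h (f x₁) fun i => tangentMapAt m n f x₁ (E₁ i)))
        (Φ (gram h (f x₂) fun i => tangentMapAt m n f x₂ (E₂ i))) with hle | hle
      · exact ⟨x₂, E₂, h3, fun y hy E hE => hy.elim (fun hy => (h2 y hy E hE).trans hle)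
          fun hy => h4 y hy E hE⟩
      · exact ⟨x₁, E₁, h1, fun y hy E hE => hy.elim (fun hy => h2 y hy E hE)
          fun hy => (h4 y hy E hE).trans hle⟩)
    (fun x _ => by
      obtain ⟨K, hK, hp⟩ := exists_local_max g h hf hΦ hE₀ x
      exact ⟨K, mem_nhdsWithin_of_mem_nhds hK, hp⟩)
  obtain ⟨x₁, E₁, h1, h2⟩ := key
  exact ⟨x₁, E₁, h1, fun y => h2 y (Set.mem_univ y)⟩

/-- A function of Gram matrices that scales by `|det|²` under changes of frame attains its maximum
over unitary frames, at a frame for which `f^*h` is diagonal. -/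
theorem exists_max_frame [CompactSpace M] (g : HermitianMetric m M) (h : HermitianMetric n N)
    (hf : ContMDiff 𝓘(ℂ, Cn m) 𝓘(ℂ, Cn n) ω f) {Φ : Matrix ι ι ℂ → Matrix ι ι ℂ → ℝ}
    (hΦc : Continuous (Φ 1))
    (hΦ : ∀ S G H, Φ (S * G * Sᴴ) (S * H * Sᴴ) = Complex.normSq S.det * Φ G H)
    {x₀ : M} {E₀ : ι → Tan m M x₀} (hE₀ : gram g x₀ E₀ = 1) :
    ∃ (x : M) (E : ι → Tan m M x) (d : ι → ℝ), gram g x E = 1 ∧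
      (gram h (f x) fun i => tangentMapAt m n f x (E i)) = (Matrix.diagonal fun i => (d i : ℂ)) ∧
      (∀ i, 0 ≤ d i) ∧ ∀ (y : M) (E' : ι → Tan m M y), (gram g y E').det ≠ 0 →
        Φ (gram g y E') (gram h (f y) fun i => tangentMapAt m n f y (E' i)) ≤
          Φ 1 (Matrix.diagonal fun i => (d i : ℂ)) * (gram g y E').det.re := by
  obtain ⟨x, E, hE, hmax⟩ := exists_max_unitary g h hf hΦc hE₀
  obtain ⟨S, d, hS, hd⟩ := exists_unitary_diagonalization
    (gram_isHermitian h (f x) fun i => tangentMapAt m n f x (E i))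
  have nS : Complex.normSq S.det = 1 := by
    have h1 : S.det * star S.det = 1 := by
      rw [← det_conjTranspose, ← det_mul, hS, det_one]
    rw [Complex.star_def, Complex.mul_conj] at h1
    exact_mod_cast h1
  have hGS : gram g x (frameChange S E) = 1 := by
    rw [gram_frameChange, hE, Matrix.mul_one, hS]
  have hHS : (gram h (f x) fun i => tangentMapAt m n f x (frameChange S E i)) =
      Matrix.diagonal fun i => (d i : ℂ) := by
    rw [map_frameChange (tangentMapAt m n f x), gram_frameChange, hd]
  refine ⟨x, frameChange S E, d, hGS, hHS, fun i => ?_, fun y E' hE' => ?_⟩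
  · have h1 := congrArg Complex.re (congrFun (congrFun hHS i) i)
    rw [diagonal_apply_eq, Complex.ofReal_re] at h1
    rw [← h1]
    exact toForm_self_nonneg h _ _
  -- Since |det S| = 1, the rotation to diagonal form does not change the maximal value.
  · have hC : Φ 1 (Matrix.diagonal fun i => (d i : ℂ)) =
        Φ 1 (gram h (f x) fun i => tangentMapAt m n f x (E i)) := by
      have := hΦ S 1 (gram h (f x) fun i => tangentMapAt m n f x (E i))
      rwa [hd, Matrix.mul_one, hS, nS, one_mul] at this
    -- T makes the given frame unitary. From |det T|² det G = 1, the scaling law turns the bound for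
    -- the unitary frame into one with the factor det G.
    obtain ⟨T, hT⟩ := exists_frameChange_unitary g y E' hE'
    have h1 := hmax y (frameChange T E') (by rw [gram_frameChange, hT])
    rw [map_frameChange (tangentMapAt m n f y), gram_frameChange, ← hC] at h1
    have h2 := hΦ T (gram g y E') (gram h (f y) fun i => tangentMapAt m n f y (E' i))
    rw [hT] at h2
    rw [h2] at h1
    have h3 : ((Complex.normSq T.det : ℝ) : ℂ) * (gram g y E').det = 1 := by
      have := congrArg Matrix.det hT
      rw [det_mul, det_mul, det_conjTranspose, det_one] at this
      rw [← Complex.mul_conj, ← Complex.star_def, ← this]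
      ring
    have h4 := congrArg Complex.re h3
    rw [Complex.re_ofReal_mul, Complex.one_re] at h4
    have h5 : 0 < Complex.normSq T.det := by
      refine lt_of_le_of_ne (Complex.normSq_nonneg _) fun h => ?_
      rw [← h, zero_mul] at h4
      exact zero_ne_one h4
    refine le_of_mul_le_mul_left ?_ h5
    calc _ ≤ Φ 1 (Matrix.diagonal fun i => (d i : ℂ)) := h1
      _ = Φ 1 (Matrix.diagonal fun i => (d i : ℂ)) *
          (Complex.normSq T.det * (gram g y E').det.re) := by rw [h4, mul_one]
      _ = _ := by ring

end Max

end Herm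

end

/-! ### Linear algebra of frames, and curvature contractions over a unitary frame. -/

noncomputable section
namespace Herm
open Filter Topology Matrix

section Frames

variable {m : ℕ} {M : Type*} [TopologicalSpace M] [ChartedSpace (Cn m) M]
  {ι : Type*} [Fintype ι]

instance (p : M) : FiniteDimensional ℂ (Tan m M p) :=
  inferInstanceAs (FiniteDimensional ℂ (Cn m))

lemma finrank_tan (p : M) : Module.finrank ℂ (Tan m M p) = m :=
  finrank_euclideanSpace_fin (𝕜 := ℂ) (n := m)

lemma toForm_sum_left (g : HermitianMetric m M) (p : M) (c : ι → ℂ) (E : ι → Tan m M p)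
    (v : Tan m M p) : g.toForm p (∑ i, c i • E i) v = ∑ i, c i * g.toForm p (E i) v := by
  simp only [map_sum, LinearMap.sum_apply, map_smul, LinearMap.smul_apply, smul_eq_mul]

lemma toForm_self_eq_zero (g : HermitianMetric m M) (p : M) {v : Tan m M p}
    (h : g.toForm p v v = 0) : v = 0 := by
  by_contra hv
  have := g.pos p v hv
  rw [h, Complex.zero_re] at this
  exact this.false

lemma toForm_sum_right_eq_zero (g : HermitianMetric m M) (p : M) (c : ι → ℂ) (E : ι → Tan m M p)
    (v : Tan m M p) (h : ∀ j, g.toForm p v (E j) = 0) : g.toForm p v (∑ i, c i • E i) = 0 := by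
  rw [map_sum]
  refine Finset.sum_eq_zero fun i _ => ?_
  rw [LinearMap.map_smulₛₗ, h, smul_zero]

variable [DecidableEq ι]

lemma det_gram_ne_zero (g : HermitianMetric m M) (p : M) {E : ι → Tan m M p}
    (hE : LinearIndependent ℂ E) : (gram g p E).det ≠ 0 := by
  intro h
  obtain ⟨v, hv, hv0⟩ := Matrix.exists_vecMul_eq_zero_iff.2 h
  have h1 : ∀ j, g.toForm p (∑ i, v i • E i) (E j) = 0 := by
    intro j
    rw [toForm_sum_left]
    exact congrFun hv0 j
  have h2 := toForm_self_eq_zero g p (toForm_sum_right_eq_zero g p v E _ h1)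
  exact hv (funext fun i => Fintype.linearIndependent_iff.1 hE v h2 i)

lemma det_gram_re_pos (g : HermitianMetric m M) (p : M) {E : ι → Tan m M p}
    (hE : (gram g p E).det ≠ 0) : 0 < (gram g p E).det.re := by
  obtain ⟨T, hT⟩ := exists_frameChange_unitary g p E hE
  have h3 : ((Complex.normSq T.det : ℝ) : ℂ) * (gram g p E).det = 1 := by
    have := congrArg Matrix.det hT
    rw [det_mul, det_mul, det_conjTranspose, det_one] at this
    rw [← Complex.mul_conj, ← Complex.star_def, ← this]
    ring
  have h4 := congrArg Complex.re h3
  rw [Complex.re_ofReal_mul, Complex.one_re] at h4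
  by_contra! h
  nlinarith [Complex.normSq_nonneg T.det]

lemma linearIndependent_of_gram_eq_one (g : HermitianMetric m M) (p : M) {E : ι → Tan m M p}
    (hE : gram g p E = 1) : LinearIndependent ℂ E := by
  refine Fintype.linearIndependent_iff.2 fun c hc j => ?_
  have h1 := toForm_sum_left g p c E (E j)
  rw [hc, map_zero, LinearMap.zero_apply] at h1
  have h2 : ∀ i, g.toForm p (E i) (E j) = (1 : Matrix ι ι ℂ) i j := fun i =>
    congrFun (congrFun hE i) j
  simpa [h2, one_apply] using h1.symm

lemma isUnitary_iff (g : HermitianMetric m M) (p : M) {ℓ : ℕ} (E : Fin ℓ → Tan m M p) :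
    IsUnitary g p E ↔ gram g p E = 1 := by
  constructor
  · intro h
    ext1 i j
    rw [one_apply]
    exact h i j
  · intro h i j
    rw [← one_apply (α := ℂ), ← h]
    rfl

lemma isUnitaryBasis_span (g : HermitianMetric m M) (p : M) {ℓ : ℕ} {E : Fin ℓ → Tan m M p}
    (hE : gram g p E = 1) : IsUnitaryBasis g p (Submodule.span ℂ (Set.range E)) E ∧
      Module.finrank ℂ (Submodule.span ℂ (Set.range E)) = ℓ :=
  ⟨⟨(isUnitary_iff g p E).2 hE, rfl⟩, by
    rw [finrank_span_eq_card (linearIndependent_of_gram_eq_one g p hE), Fintype.card_fin]⟩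

lemma coordComp_eq (e : OpenPartialHomeomorph M (Cn m)) (p : M) (u : Tan m M p) (k : Fin m) :
    coordComp e p u k = (chartCoord e p u).ofLp k := rfl

lemma chern_smul (g : HermitianMetric m M) (p : M) (c d : ℂ) (v w : Tan m M p) :
    chern g p (c • v) (c • v) (d • w) (d • w) =
      ((Complex.normSq c * Complex.normSq d : ℝ) : ℂ) * chern g p v v w w := by
  simp only [chern, coordComp_eq, map_smul, WithLp.ofLp_smul, Pi.smul_apply, smul_eq_mul, star_mul',
    Finset.mul_sum, Complex.star_def]
  push_cast
  rw [← Complex.mul_conj, ← Complex.mul_conj]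
  refine Finset.sum_congr rfl fun _ _ => Finset.sum_congr rfl fun _ _ =>
    Finset.sum_congr rfl fun _ _ => Finset.sum_congr rfl fun _ _ => by ring

lemma scal_eq_sum_ric1 (g : HermitianMetric m M) (p : M) {ℓ : ℕ} (E : Fin ℓ → Tan m M p) :
    scal g p E = ∑ i, ric1 g p E (E i) := by
  simp only [scal, ric1, Complex.re_sum]

lemma sum_ric2_eq (g : HermitianMetric m M) (p : M) {ℓ : ℕ} (E : Fin ℓ → Tan m M p)
    (d : Fin ℓ → ℝ) : ∑ j, ∑ i, d i * (chern g p (E j) (E j) (E i) (E i)).re =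
      ∑ i, d i * ric2 g p E (E i) := by
  rw [Finset.sum_comm]
  simp only [ric2, Complex.re_sum, Finset.mul_sum]

/-- Applied to a vector not killed by the tangent map, it gives a frame on which the pulled back
form has nonzero trace. -/
lemma exists_linearIndependent_extension {x : M} {v : Tan m M x} (hv : v ≠ 0) {ℓ : ℕ} (hℓ : 1 ≤ ℓ)
    (hℓm : ℓ ≤ m) : ∃ E : Fin ℓ → Tan m M x, LinearIndependent ℂ E ∧ ∃ i, E i = v := by
  induction ℓ, hℓ using Nat.le_induction with
  | base => exact ⟨fun _ => v, LinearIndependent.of_subsingleton 0 hv, 0, rfl⟩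
  | succ k hk ih =>
    obtain ⟨E, hE, i, hi⟩ := ih (by omega)
    obtain ⟨u, hu⟩ := exists_linearIndependent_snoc_of_lt_finrank hE
      (by rw [finrank_tan]; omega)
    exact ⟨_, hu, i.castSucc, by rw [Fin.snoc_castSucc, hi]⟩

/-- Each √d_i occurs twice and leaves d_i. Padding d by zeros outside the range of σ gives the sum
over a full frame that the real bisectional curvature requires. -/
lemma sum_chern_eq (g : HermitianMetric m M) (p : M) {ℓ : ℕ} {σ : Fin ℓ → Fin m}
    (hσ : Function.Injective σ) {w : Fin ℓ → Tan m M p} {d : Fin ℓ → ℝ} (hd : ∀ i, 0 ≤ d i)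
    {e : Fin m → Tan m M p} (hw : ∀ i, w i = ((Real.sqrt (d i) : ℝ) : ℂ) • e (σ i)) :
    ∑ i, ∑ j, (chern g p (w i) (w i) (w j) (w j)).re =
      ∑ i, ∑ j, (chern g p (e i) (e i) (e j) (e j)).re * Function.extend σ d 0 i *
        Function.extend σ d 0 j := by
  have h0 : ∀ i ∉ Set.range σ, Function.extend σ d 0 i = 0 := fun i hi =>
    Function.extend_apply' _ _ _ (by simpa using hi)
  refine Fintype.sum_of_injective σ hσ _ _ (fun i hi => ?_) fun i => ?_
  · exact Finset.sum_eq_zero fun j _ => by rw [h0 i hi]; ring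
  · refine Fintype.sum_of_injective σ hσ _ _ (fun j hj => ?_) fun j => ?_
    · rw [h0 j hj]; ring
    · rw [hw i, hw j, chern_smul, hσ.extend_apply, hσ.extend_apply, Complex.re_ofReal_mul,
        Complex.normSq_ofReal, Complex.normSq_ofReal, Real.mul_self_sqrt (hd i),
        Real.mul_self_sqrt (hd j)]
      ring

/-- A unitary frame adapted to an orthogonal family. -/
lemma exists_unitary_frame_extension {κ : Type*} [DecidableEq κ]
    (g : HermitianMetric m M) (p : M) {σ : κ → Fin m}
    (hσ : Function.Injective σ) {w : κ → Tan m M p} {d : κ → ℝ}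
    (hd : ∀ i, 0 ≤ d i) (hw : gram g p w = Matrix.diagonal fun i => (d i : ℂ)) :
    ∃ e : Fin m → Tan m M p, gram g p e = 1 ∧ ∀ i, w i = ((Real.sqrt (d i) : ℝ) : ℂ) • e (σ i) := by
  obtain ⟨e₀, he₀⟩ : ∃ e₀ : Fin m → Tan m M p, gram g p e₀ = 1 := by
    obtain ⟨S, hS⟩ := exists_frameChange_unitary g p
      (Module.finBasisOfFinrankEq ℂ (Tan m M p) (finrank_tan p))
      (det_gram_ne_zero g p (Module.Basis.linearIndependent _))
    exact ⟨frameChange S _, by rw [gram_frameChange, hS]⟩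
  have hspan : Submodule.span ℂ (Set.range e₀) = ⊤ :=
    (linearIndependent_of_gram_eq_one g p he₀).span_eq_top_of_card_eq_finrank' (by simp [finrank_tan])
  let L : Cn m →ₗ[ℂ] Tan m M p := ∑ i, (EuclideanSpace.proj i : Cn m →L[ℂ] ℂ).toLinearMap.smulRight (e₀ i)
  have hL : ∀ a : Cn m, L a = ∑ i, a i • e₀ i := fun a => by
    simp [L, LinearMap.sum_apply, LinearMap.smulRight_apply]
  have hLs : Function.Surjective L := by
    intro v
    have hv : v ∈ Submodule.span ℂ (Set.range e₀) := by rw [hspan]; trivial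
    obtain ⟨c, hc⟩ := (Submodule.mem_span_range_iff_exists_fun ℂ).1 hv
    exact ⟨WithLp.toLp 2 c, by rw [hL, ← hc]⟩
  -- Coordinates in the frame e₀ turn the form into the standard inner product, with the arguments
  -- swapped because `inner` is conjugate linear in the first one.
  have hin : ∀ a b : Cn m, g.toForm p (L a) (L b) = inner ℂ b a := by
    intro a b
    have h2 : ∀ i j, g.toForm p (e₀ i) (e₀ j) = (1 : Matrix (Fin m) (Fin m) ℂ) i j := fun i j =>
      congrFun (congrFun he₀ i) j
    rw [hL, hL, toForm_sum_left]
    simp only [map_sum, LinearMap.map_smulₛₗ, h2, one_apply, smul_eq_mul, mul_ite, mul_one, mul_zero,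
      Finset.sum_ite_eq, Finset.mem_univ, if_true, PiLp.inner_apply, RCLike.inner_apply]
  choose u hu using fun i => hLs (w i)
  have hww : ∀ i j, inner ℂ (u i) (u j) = if i = j then (d i : ℂ) else 0 := by
    intro i j
    rw [← hin, hu, hu]
    have := congrFun (congrFun hw j) i
    rw [diagonal_apply] at this
    refine this.trans ?_
    by_cases hij : i = j
    · simp [hij]
    · simp [hij, Ne.symm hij]
  set v : Fin m → Cn m := Function.extend σ (fun i => (((Real.sqrt (d i))⁻¹ : ℝ) : ℂ) • u i) 0 with hv
  have hvσ : ∀ i, v (σ i) = (((Real.sqrt (d i))⁻¹ : ℝ) : ℂ) • u i := fun i => hσ.extend_apply _ _ i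
  -- Only slots with d_i > 0 are prescribed. Where d_i = 0 the vector w_i is zero, and any
  -- completion serves.
  set s : Set (Fin m) := {j | ∃ i, σ i = j ∧ 0 < d i} with hs
  have hon : Orthonormal ℂ (s.domRestrict v) := by
    rw [orthonormal_iff_ite]
    rintro ⟨_, i, rfl, hi⟩ ⟨_, j, rfl, hj⟩
    simp only [Set.domRestrict_apply, hvσ, inner_smul_left, inner_smul_right, hww,
      Complex.conj_ofReal, Subtype.mk.injEq, hσ.eq_iff]
    by_cases hij : i = j
    · subst hij
      simp only [if_true]
      rw [← Complex.ofReal_mul, ← Complex.ofReal_mul]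
      have h2 := Real.mul_self_sqrt hi.le
      have h3 : Real.sqrt (d i) ≠ 0 := (Real.sqrt_pos.2 hi).ne'
      have h4 : (Real.sqrt (d i))⁻¹ * ((Real.sqrt (d i))⁻¹ * d i) = 1 := by
        nth_rewrite 3 [← h2]
        field_simp
      rw [h4, Complex.ofReal_one]
    · simp [hij]
  obtain ⟨b, hb⟩ := hon.exists_orthonormalBasis_extension_of_card_eq (by simp)
  refine ⟨fun j => L (b j), ?_, fun i => ?_⟩
  · ext1 i j
    have h1 := orthonormal_iff_ite.1 b.orthonormal j i
    refine (hin _ _).trans (h1.trans ?_)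
    rw [one_apply]
    simp only [eq_comm]
  · rcases (hd i).eq_or_lt with h0 | hpos
    · have h1 : g.toForm p (w i) (w i) = 0 := by
        have := congrFun (congrFun hw i) i
        rw [diagonal_apply_eq, ← h0, Complex.ofReal_zero] at this
        exact this
      rw [toForm_self_eq_zero g p h1, ← h0]
      simp
    · dsimp only
      rw [hb (σ i) ⟨i, rfl, hpos⟩, hvσ, map_smul, hu, smul_smul, ← Complex.ofReal_mul,
        mul_inv_cancel₀ (Real.sqrt_pos.2 hpos).ne', Complex.ofReal_one, one_smul]

variable [IsManifold 𝓘(ℂ, Cn m) ω M]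

/-- If the rows of A are the coordinates of a unitary frame, then A γ Aᴴ = 1 and γ⁻¹ = Aᴴ A.
Contraction with g^{i j̄} thereby becomes a sum over the frame. -/
lemma invCoeff_eq_sum (g : HermitianMetric m M) (p : M) {E : Fin m → Tan m M p}
    (hE : gram g p E = 1) (i j : Fin m) :
    invCoeff g (chartAt (Cn m) p) (chartAt (Cn m) p p) i j =
      ∑ a, coordComp (chartAt (Cn m) p) p (E a) i * star (coordComp (chartAt (Cn m) p) p (E a) j) := by
  set A : Matrix (Fin m) (Fin m) ℂ := Matrix.of fun a i => coordComp (chartAt (Cn m) p) p (E a) i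
    with hA
  set γ := coeff g (chartAt (Cn m) p) (chartAt (Cn m) p p) with hγ
  have h1 : A * γ * Aᴴ = 1 := by
    rw [← hE, gram_eq_gramMat g p (mem_chart_source (Cn m) p)]
    ext1 a b
    rw [gramMat, Matrix.of_apply, sesq_eq_sum, Matrix.mul_apply]
    simp only [Matrix.mul_apply, Finset.sum_mul, conjTranspose_apply]
    rw [Finset.sum_comm]
    refine Finset.sum_congr rfl fun k _ => Finset.sum_congr rfl fun l _ => ?_
    rw [hA, Matrix.of_apply, Matrix.of_apply, coordComp_eq, coordComp_eq]
    ring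
  have h2 : Aᴴ * (A * γ) = 1 := mul_eq_one_comm.1 h1
  have h3 : γ⁻¹ = Aᴴ * A := inv_eq_left_inv (by rw [Matrix.mul_assoc, h2])
  rw [invCoeff, ← hγ, h3, Matrix.mul_apply]
  refine Finset.sum_congr rfl fun a _ => ?_
  rw [conjTranspose_apply, mul_comm]
  rfl

lemma ricci_eq_ric1 (g : HermitianMetric m M) (p : M) {E : Fin m → Tan m M p}
    (hE : gram g p E = 1) (v : Tan m M p) : ricci g p v = ric1 g p E v := by
  rw [ricci, ric1]
  congr 1
  simp only [invCoeff_eq_sum g p hE, chern, Finset.sum_mul]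
  have swap : ∀ G : Fin m → Fin m → Fin m → Fin m → Fin m → ℂ,
      ∑ i, ∑ j, ∑ k, ∑ l, ∑ a, G i j k l a = ∑ a, ∑ i, ∑ j, ∑ k, ∑ l, G i j k l a := by
    intro G
    have h := Finset.sum_comm (s := (Finset.univ : Finset (Fin m × Fin m × Fin m × Fin m)))
      (t := (Finset.univ : Finset (Fin m))) (f := fun x y => G x.1 x.2.1 x.2.2.1 x.2.2.2 y)
    simpa only [Fintype.sum_prod_type] using h
  rw [swap]
  exact Finset.sum_congr rfl fun _ _ => Finset.sum_congr rfl fun _ _ =>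
    Finset.sum_congr rfl fun _ _ => Finset.sum_congr rfl fun _ _ =>
    Finset.sum_congr rfl fun _ _ => by ring

lemma scalar_eq_scal (g : HermitianMetric m M) (p : M) {E : Fin m → Tan m M p}
    (hE : gram g p E = 1) : scalar g p = scal g p E := by
  rw [scalar, scal]
  congr 1
  simp only [invCoeff_eq_sum g p hE, chern, Finset.sum_mul_sum]
  simp only [Finset.sum_mul]
  have swap : ∀ G : Fin m → Fin m → Fin m → Fin m → Fin m → Fin m → ℂ,
      ∑ i, ∑ j, ∑ k, ∑ l, ∑ a, ∑ b, G i j k l a b =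
        ∑ a, ∑ b, ∑ i, ∑ j, ∑ k, ∑ l, G i j k l a b := by
    intro G
    have h := Finset.sum_comm (s := (Finset.univ : Finset (Fin m × Fin m × Fin m × Fin m)))
      (t := (Finset.univ : Finset (Fin m × Fin m)))
      (f := fun x y => G x.1 x.2.1 x.2.2.1 x.2.2.2 y.1 y.2)
    simpa only [Fintype.sum_prod_type] using h
  rw [swap]
  exact Finset.sum_congr rfl fun _ _ => Finset.sum_congr rfl fun _ _ =>
    Finset.sum_congr rfl fun _ _ => Finset.sum_congr rfl fun _ _ =>
    Finset.sum_congr rfl fun _ _ => Finset.sum_congr rfl fun _ _ => by ring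

end Frames

end Herm

end

/-! ### The rank bound and constancy from the sign conditions. -/

noncomputable section
namespace Herm
open Filter Topology Matrix

lemma sum_neg_of_pos_card {ℓ : ℕ} (hℓ : 1 ≤ ℓ) {a : Fin ℓ → ℝ} (h : ∀ i, a i < 0) : ∑ i, a i < 0 :=
  Finset.sum_neg (fun i _ => h i) ⟨⟨0, hℓ⟩, Finset.mem_univ _⟩

lemma sum_pos_of_pos_card {ℓ : ℕ} (hℓ : 1 ≤ ℓ) {a : Fin ℓ → ℝ} (h : ∀ i, 0 < a i) : 0 < ∑ i, a i :=
  Finset.sum_pos (fun i _ => h i) ⟨⟨0, hℓ⟩, Finset.mem_univ _⟩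

section Rank

variable {m n : ℕ} {M N : Type*} [TopologicalSpace M] [ChartedSpace (Cn m) M]
  [IsManifold 𝓘(ℂ, Cn m) ω M] [CompactSpace M] [TopologicalSpace N] [ChartedSpace (Cn n) N]
  [IsManifold 𝓘(ℂ, Cn n) ω N] {f : M → N}

/-- If `f` has rank at least `ℓ` somewhere, then some unitary `ℓ`-frame `E` maps to multiples of a
unitary `ℓ`-frame `e` for which the partial Ricci curvature `Ric_ℓ^{(1)}` does not decrease. -/
theorem exists_ric1_le (g : HermitianMetric m M) (h : HermitianMetric n N)
    (hf : ContMDiff 𝓘(ℂ, Cn m) 𝓘(ℂ, Cn n) ω f) {ℓ : ℕ} {x₀ : M}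
    (hx₀ : ℓ ≤ Module.finrank ℂ (LinearMap.range (tangentMapAt m n f x₀))) :
    ∃ (x : M) (E : Fin ℓ → Tan m M x) (e : Fin ℓ → Tan n N (f x)) (c : Fin ℓ → ℂ),
      gram g x E = 1 ∧ gram h (f x) e = 1 ∧ (∀ i, c i ≠ 0) ∧
      (∀ i, tangentMapAt m n f x (E i) = c i • e i) ∧
      ∀ v, ric1 g x E v ≤ ric1 h (f x) e (tangentMapAt m n f x v) := by
  -- Lifts of ℓ basis vectors of the range form a frame with independent images, so the maximal
  -- determinant is positive and every d_i is nonzero.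
  set b := Module.finBasis ℂ (LinearMap.range (tangentMapAt m n f x₀)) with hb
  choose E₀ hE₀ using fun i : Fin ℓ => (b (Fin.castLE hx₀ i)).2
  have hli : LinearIndependent ℂ fun i => tangentMapAt m n f x₀ (E₀ i) := by
    simp only [hE₀]
    exact (b.linearIndependent.comp _ (Fin.castLE_injective hx₀)).map'
      (Submodule.subtype _) (Submodule.ker_subtype _)
  have hli₀ : LinearIndependent ℂ E₀ := LinearIndependent.of_comp (tangentMapAt m n f x₀) hli
  have hG := det_gram_ne_zero g x₀ hli₀
  obtain ⟨S, hS⟩ := exists_frameChange_unitary g x₀ E₀ hG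
  obtain ⟨x, E, d, hE, hd, hd0, hmax⟩ := exists_max_frame g h hf
    (Φ := fun _ H : Matrix (Fin ℓ) (Fin ℓ) ℂ => H.det.re)
    (Complex.continuous_re.comp continuous_id.matrix_det)
    (fun S G H => by
      rw [det_mul, det_mul, det_conjTranspose, mul_right_comm, Complex.star_def, Complex.mul_conj,
        Complex.re_ofReal_mul])
    (x₀ := x₀) (E₀ := frameChange S E₀) (by rw [gram_frameChange, hS])
  have hprod : (Matrix.diagonal fun i => (d i : ℂ)).det.re = ∏ i, d i := by
    rw [det_diagonal, ← Complex.ofReal_prod, Complex.ofReal_re]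
  simp only [hprod] at hmax
  have hpos : 0 < ∏ i, d i := by
    have h1 := hmax x₀ E₀ hG
    have h2 := det_gram_re_pos g x₀ hG
    have h3 := det_gram_re_pos h (f x₀) (det_gram_ne_zero h (f x₀) hli)
    by_contra! hn
    nlinarith
  have hdpos : ∀ i, 0 < d i := fun i => lt_of_le_of_ne (hd0 i) fun h0 =>
    hpos.ne' (Finset.prod_eq_zero (Finset.mem_univ i) h0.symm)
  have hs : ∀ i, Real.sqrt (d i) ≠ 0 := fun i => (Real.sqrt_pos.2 (hdpos i)).ne'
  set e : Fin ℓ → Tan n N (f x) :=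
    fun i => (((Real.sqrt (d i))⁻¹ : ℝ) : ℂ) • tangentMapAt m n f x (E i) with he
  refine ⟨x, E, e, fun i => ((Real.sqrt (d i) : ℝ) : ℂ), hE, ?_,
    fun i => Complex.ofReal_ne_zero.2 (hs i), fun i => ?_, fun v => ?_⟩
  · ext1 i j
    have h1 : h.toForm (f x) (tangentMapAt m n f x (E i)) (tangentMapAt m n f x (E j)) = _ :=
      congrFun (congrFun hd i) j
    simp only [gram, he, Matrix.of_apply, map_smul, LinearMap.smul_apply, LinearMap.map_smulₛₗ, h1,
      smul_eq_mul, Complex.conj_ofReal, diagonal_apply, one_apply]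
    by_cases hij : i = j
    · subst hij
      simp only [if_true, ← Complex.ofReal_mul]
      have h2 := Real.mul_self_sqrt (hdpos i).le
      have h4 : (Real.sqrt (d i))⁻¹ * ((Real.sqrt (d i))⁻¹ * d i) = 1 := by
        have := hs i
        nth_rewrite 3 [← h2]
        field_simp
      rw [h4, Complex.ofReal_one]
    · simp [hij]
  · rw [he, smul_smul, ← Complex.ofReal_mul, mul_inv_cancel₀ (hs i), Complex.ofReal_one, one_smul]
  · have h1 := det_bochner hf x E hE hdpos hd hmax v
    have h2 : ∀ i, chern h (f x) (tangentMapAt m n f x v) (tangentMapAt m n f x v) (e i) (e i) =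
        (((d i)⁻¹ : ℝ) : ℂ) * chern h (f x) (tangentMapAt m n f x v) (tangentMapAt m n f x v)
          (tangentMapAt m n f x (E i)) (tangentMapAt m n f x (E i)) := by
      intro i
      have h3 := chern_smul h (f x) 1 (((Real.sqrt (d i))⁻¹ : ℝ) : ℂ) (tangentMapAt m n f x v)
        (tangentMapAt m n f x (E i))
      rw [one_smul, map_one, one_mul, Complex.normSq_ofReal, ← mul_inv,
        Real.mul_self_sqrt (hdpos i).le] at h3
      exact h3
    simpa only [ric1, Complex.re_sum, h2, Complex.re_ofReal_mul] using h1

/-- The rank of `f` is less than `ℓ` under the sign conditions of the form `S_ℓ ≥ Ric_ℓ^{(1)}`. -/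
theorem finrank_range_lt {g : HermitianMetric m M} {h : HermitianMetric n N}
    (hf : ContMDiff 𝓘(ℂ, Cn m) 𝓘(ℂ, Cn n) ω f) {ℓ : ℕ} (hℓ : 1 ≤ ℓ)
    (H : (ScalSign g ℓ (0 ≤ ·) ∧ Ric1Sign h ℓ (· < 0)) ∨
      (ScalSign g ℓ (0 < ·) ∧ Ric1Sign h ℓ (· ≤ 0)) ∨
      (Ric1Sign g ℓ (0 ≤ ·) ∧ ScalSign h ℓ (· < 0)) ∨
      (Ric1Sign g ℓ (0 < ·) ∧ ScalSign h ℓ (· ≤ 0))) (x₀ : M) :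
    Module.finrank ℂ (LinearMap.range (tangentMapAt m n f x₀)) < ℓ := by
  by_contra! hx₀
  obtain ⟨x, E, e, c, hE, he, hc, hce, hric⟩ := exists_ric1_le g h hf hx₀
  obtain ⟨uE, fE⟩ := isUnitaryBasis_span g x hE
  obtain ⟨ue, fe⟩ := isUnitaryBasis_span h (f x) he
  have hE0 : ∀ i, E i ≠ 0 := (linearIndependent_of_gram_eq_one g x hE).ne_zero
  have he0 : ∀ i, e i ≠ 0 := (linearIndependent_of_gram_eq_one h (f x) he).ne_zero
  have hEm : ∀ i, E i ∈ Submodule.span ℂ (Set.range E) :=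
    fun i => Submodule.subset_span (Set.mem_range_self i)
  have hem : ∀ i, e i ∈ Submodule.span ℂ (Set.range e) :=
    fun i => Submodule.subset_span (Set.mem_range_self i)
  -- Test with v = E_i: the left sides add up to the scalar curvature of the frame on M.
  have k1 : scal g x E ≤ ∑ i, ric1 h (f x) e (c i • e i) := by
    rw [scal_eq_sum_ric1]
    exact Finset.sum_le_sum fun i _ => hce i ▸ hric (E i)
  -- Test with v = E_i / c_i, whose image is e_i: the right sides add up to the scalar curvature of
  -- e on N.
  have k2 : ∑ i, ric1 g x E ((c i)⁻¹ • E i) ≤ scal h (f x) e := by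
    rw [scal_eq_sum_ric1]
    refine Finset.sum_le_sum fun i _ => (hric _).trans_eq ?_
    rw [map_smul, hce, smul_smul, inv_mul_cancel₀ (hc i), one_smul]
  have m1 : ∀ i, c i • e i ∈ Submodule.span ℂ (Set.range e) :=
    fun i => Submodule.smul_mem _ _ (hem i)
  have z1 : ∀ i, c i • e i ≠ 0 := fun i => smul_ne_zero (hc i) (he0 i)
  have m2 : ∀ i, (c i)⁻¹ • E i ∈ Submodule.span ℂ (Set.range E) :=
    fun i => Submodule.smul_mem _ _ (hEm i)
  have z2 : ∀ i, (c i)⁻¹ • E i ≠ 0 := fun i => smul_ne_zero (inv_ne_zero (hc i)) (hE0 i)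
  rcases H with ⟨hg, hh⟩ | ⟨hg, hh⟩ | ⟨hg, hh⟩ | ⟨hg, hh⟩
  · have a1 := hg x _ fE E uE
    have a2 := sum_neg_of_pos_card hℓ fun i => hh (f x) _ fe e ue _ (m1 i) (z1 i)
    simp only at a1
    linarith
  · have a1 := hg x _ fE E uE
    have a2 := Finset.sum_nonpos (s := Finset.univ)
      fun (i : Fin ℓ) _ => hh (f x) _ fe e ue _ (m1 i) (z1 i)
    simp only at a1
    linarith
  · have a1 := hh (f x) _ fe e ue
    have a2 := Finset.sum_nonneg (s := Finset.univ)
      fun (i : Fin ℓ) _ => hg x _ fE E uE _ (m2 i) (z2 i)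
    simp only at a1
    linarith
  · have a1 := hh (f x) _ fe e ue
    have a2 := sum_pos_of_pos_card hℓ fun i => hg x _ fE E uE _ (m2 i) (z2 i)
    simp only at a1
    linarith

end Rank

section Constant

variable {m n : ℕ} {M N : Type*} [TopologicalSpace M] [ChartedSpace (Cn m) M]
  [IsManifold 𝓘(ℂ, Cn m) ω M] [TopologicalSpace N] [ChartedSpace (Cn n) N]
  [IsManifold 𝓘(ℂ, Cn n) ω N] {f : M → N}

/-- The tangent map of `f` vanishes under the sign conditions on `Ric_ℓ^{(2)}` and the real bisectional
curvature. -/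
theorem tangentMapAt_eq_zero [CompactSpace M] {g : HermitianMetric m M} {h : HermitianMetric n N}
    (hf : ContMDiff 𝓘(ℂ, Cn m) 𝓘(ℂ, Cn n) ω f) (hmn : m ≤ n) {ℓ : ℕ} (hℓ : 1 ≤ ℓ) (hℓm : ℓ ≤ m)
    (H : (Ric2Sign g ℓ (0 < ·) ∧ RealBisecSign h (· ≤ 0)) ∨
      (Ric2Sign g ℓ (0 ≤ ·) ∧ RealBisecSign h (· < 0))) (x₀ : M) : tangentMapAt m n f x₀ = 0 := by
  by_contra hne
  obtain ⟨v₀, hv₀⟩ : ∃ v, tangentMapAt m n f x₀ v ≠ 0 := by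
    by_contra! hall
    exact hne (LinearMap.ext hall)
  obtain ⟨E₀, hli₀, i₀, hi₀⟩ := exists_linearIndependent_extension
    (v := v₀) (fun h0 => hv₀ (by rw [h0, map_zero])) hℓ hℓm
  have hG := det_gram_ne_zero g x₀ hli₀
  obtain ⟨S, hS⟩ := exists_frameChange_unitary g x₀ E₀ hG
  have hSu : gram g x₀ (frameChange S E₀) = 1 := by rw [gram_frameChange, hS]
  obtain ⟨x, E, d, hE, hd, hd0, hmax⟩ := exists_max_frame g h hf
    (Φ := fun G H : Matrix (Fin ℓ) (Fin ℓ) ℂ => (G.adjugate * H).trace.re)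
    (Complex.continuous_re.comp (continuous_const.matrix_mul continuous_id).matrix_trace)
    (fun S G H => by
      -- The adjugate reverses products, so adj S · S = det S appears in the middle. Cyclicity of
      -- the trace then produces the conjugate factor from Sᴴ.
      have e1 : (S * G * Sᴴ).adjugate * (S * H * Sᴴ) =
          (Sᴴ).adjugate * (G.adjugate * (S.adjugate * S) * H * Sᴴ) := by
        rw [adjugate_mul_distrib, adjugate_mul_distrib]
        simp only [Matrix.mul_assoc]
      rw [e1, adjugate_mul, trace_mul_comm]
      have e2 : G.adjugate * S.det • (1 : Matrix (Fin ℓ) (Fin ℓ) ℂ) * H * Sᴴ * (Sᴴ).adjugate =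
          (S.det * star S.det) • (G.adjugate * H) := by
        rw [Matrix.mul_assoc, mul_adjugate, det_conjTranspose]
        simp only [Matrix.mul_smul, Matrix.smul_mul, Matrix.mul_one, smul_smul]
        rw [mul_comm]
      rw [e2, trace_smul, smul_eq_mul, Complex.star_def, Complex.mul_conj, Complex.re_ofReal_mul])
    hSu
  have hsum : ((1 : Matrix (Fin ℓ) (Fin ℓ) ℂ).adjugate *
      Matrix.diagonal fun i => (d i : ℂ)).trace.re = ∑ i, d i := by
    rw [adjugate_one, Matrix.one_mul, trace_diagonal, ← Complex.ofReal_sum, Complex.ofReal_re]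
  simp only [hsum] at hmax
  -- If all d_i vanished, the maximal trace would be zero. Then the frame at x₀ would be killed, and
  -- so would v₀, because S is invertible.
  have hpos : ∃ i, 0 < d i := by
    by_contra! hn
    have h1 := hmax x₀ (frameChange S E₀) (by rw [hSu, det_one]; exact one_ne_zero)
    rw [hSu, adjugate_one, Matrix.one_mul, det_one, Complex.one_re, mul_one, Matrix.trace,
      Complex.re_sum] at h1
    have h2 : ∀ i ∈ Finset.univ, 0 ≤ (Matrix.diag (gram h (f x₀) fun i =>
        tangentMapAt m n f x₀ (frameChange S E₀ i)) i).re := fun i _ => toForm_self_nonneg h _ _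
    have h3 := (Finset.sum_eq_zero_iff_of_nonneg h2).1
      (le_antisymm (h1.trans (Finset.sum_nonpos fun i _ => hn i)) (Finset.sum_nonneg h2))
    have h4 : ∀ i, tangentMapAt m n f x₀ (frameChange S E₀ i) = 0 := by
      intro i
      by_contra h5
      exact (h.pos _ _ h5).ne' (h3 i (Finset.mem_univ i))
    have hSinv : (S * gram g x₀ E₀ * Sᴴ).det = 1 := by rw [hS, det_one]
    have hSdet : IsUnit S.det := by
      rw [det_mul, det_mul, mul_assoc] at hSinv
      exact IsUnit.of_mul_eq_one _ hSinv
    have h6 : frameChange S⁻¹ (frameChange S fun i => tangentMapAt m n f x₀ (E₀ i)) =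
        fun i => tangentMapAt m n f x₀ (E₀ i) := by
      funext i
      simp only [frameChange, Finset.smul_sum, smul_smul]
      rw [Finset.sum_comm]
      simp only [← Finset.sum_smul, ← Matrix.mul_apply, nonsing_inv_mul _ hSdet]
      simp [one_apply]
    rw [← map_frameChange (tangentMapAt m n f x₀)] at h6
    have h8 : (fun i => tangentMapAt m n f x₀ (frameChange S E₀ i)) = fun _ => 0 := funext h4
    rw [h8] at h6
    have h7 := congrFun h6 i₀
    simp only [frameChange, smul_zero, Finset.sum_const_zero, hi₀] at h7
    exact hv₀ h7.symm
  obtain ⟨uE, fE⟩ := isUnitaryBasis_span g x hE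
  have hE0 : ∀ i, E i ≠ 0 := (linearIndependent_of_gram_eq_one g x hE).ne_zero
  have hEm : ∀ i, E i ∈ Submodule.span ℂ (Set.range E) :=
    fun i => Submodule.subset_span (Set.mem_range_self i)
  -- As ℓ ≤ m ≤ n, the images f_*E_i, some possibly zero, fit into the slots of a unitary frame of
  -- N.
  have hσ : Function.Injective (Fin.castLE (hℓm.trans hmn)) := Fin.castLE_injective _
  obtain ⟨e, he, hwe⟩ := exists_unitary_frame_extension h (f x) hσ hd0 hd
  -- The trace inequality summed over v = E_j; its right side is |a|² times the real bisectional
  -- curvature.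
  have key : ∑ i, d i * ric2 g x E (E i) ≤ ∑ i, ∑ j,
      (chern h (f x) (e i) (e i) (e j) (e j)).re *
        Function.extend (Fin.castLE (hℓm.trans hmn)) d 0 i *
        Function.extend (Fin.castLE (hℓm.trans hmn)) d 0 j := by
    rw [← sum_ric2_eq, ← sum_chern_eq h (f x) hσ hd0 hwe]
    exact Finset.sum_le_sum fun j _ => trace_bochner hf x E hE hd hmax (E j)
  set a := Function.extend (Fin.castLE (hℓm.trans hmn)) d 0 with ha
  have haσ : ∀ i, a (Fin.castLE (hℓm.trans hmn) i) = d i := fun i => hσ.extend_apply _ _ i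
  have ha0 : ∀ i, 0 ≤ a i := by
    intro i
    by_cases hi : ∃ j, Fin.castLE (hℓm.trans hmn) j = i
    · obtain ⟨j, rfl⟩ := hi
      rw [haσ]; exact hd0 j
    · rw [ha, Function.extend_apply' _ _ _ hi]; rfl
  obtain ⟨i₁, hi₁⟩ := hpos
  have hasq : 0 < ∑ i, a i ^ 2 := Finset.sum_pos' (fun i _ => sq_nonneg _)
    ⟨Fin.castLE (hℓm.trans hmn) i₁, Finset.mem_univ _, by rw [haσ]; positivity⟩
  have hB : realBisec h (f x) e a * (∑ i, a i ^ 2) = ∑ i, ∑ j,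
      (chern h (f x) (e i) (e i) (e j) (e j)).re * a i * a j := by
    rw [realBisec]
    field_simp
  rw [← hB] at key
  rcases H with ⟨hg, hh⟩ | ⟨hg, hh⟩
  · have a1 : 0 < ∑ i, d i * ric2 g x E (E i) := Finset.sum_pos'
      (fun i _ => mul_nonneg (hd0 i) (hg x _ fE E uE _ (hEm i) (hE0 i)).le)
      ⟨i₁, Finset.mem_univ _, mul_pos hi₁ (hg x _ fE E uE _ (hEm i₁) (hE0 i₁))⟩
    have a2 := hh (f x) e ((isUnitary_iff h (f x) e).2 he) a ha0 hasq
    simp only at a2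
    nlinarith
  · have a1 : 0 ≤ ∑ i, d i * ric2 g x E (E i) := Finset.sum_nonneg
      fun i _ => mul_nonneg (hd0 i) (hg x _ fE E uE _ (hEm i) (hE0 i))
    have a2 := hh (f x) e ((isUnitary_iff h (f x) e).2 he) a ha0 hasq
    simp only at a2
    nlinarith

/-- A map with vanishing differential on a connected manifold is constant. -/
lemma exists_eq_const [ConnectedSpace M] (hf : ContMDiff 𝓘(ℂ, Cn m) 𝓘(ℂ, Cn n) ω f)
    (h0 : ∀ x, tangentMapAt m n f x = 0) : ∃ c : N, ∀ x : M, f x = c := by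
  have hloc : IsLocallyConstant f := by
    rw [IsLocallyConstant.iff_eventually_eq]
    intro x
    have hx := mem_chart_source (Cn m) x
    have hxt := (chartAt (Cn m) x).map_source hx
    have h1 : ∀ᶠ y in 𝓝 x, y ∈ (chartAt (Cn m) x).source ∧
        f y ∈ (chartAt (Cn n) (f x)).source := by
      filter_upwards [(chartAt (Cn m) x).open_source.mem_nhds hx,
        hf.continuous.continuousAt ((chartAt (Cn n) (f x)).open_source.mem_nhds
          (mem_chart_source _ _))] with y ha hb
      exact ⟨ha, hb⟩
    have h2 : ∀ᶠ z in 𝓝 (chartAt (Cn m) x x), z ∈ (chartAt (Cn m) x).target ∧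
        f ((chartAt (Cn m) x).symm z) ∈ (chartAt (Cn n) (f x)).source := by
      have hc := (chartAt (Cn m) x).continuousAt_symm hxt
      rw [ContinuousAt, (chartAt (Cn m) x).left_inv hx] at hc
      filter_upwards [hc.eventually h1, (chartAt (Cn m) x).open_target.mem_nhds hxt] with z hz hz'
      exact ⟨hz', hz.2⟩
    obtain ⟨r, hr, hball⟩ := Metric.eventually_nhds_iff_ball.1 h2
    have hconst : ∀ z ∈ Metric.ball (chartAt (Cn m) x x) r,
        localRep m n f x z = localRep m n f x (chartAt (Cn m) x x) := by
      intro z hz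
      refine (Metric.isOpen_ball.is_const_of_fderiv_eq_zero (𝕜 := ℂ)
        (convex_ball _ _).isPreconnected (fun w hw => ?_) (fun w hw => ?_) hz
        (Metric.mem_ball_self hr))
      · have := analyticAt_localRep hf x ((chartAt (Cn m) x).map_target (hball w hw).1)
          (hball w hw).2
        rw [(chartAt (Cn m) x).right_inv (hball w hw).1] at this
        exact this.differentiableAt.differentiableWithinAt
      · ext1 u
        have := chartCoord_tangentMapAt hf x ((chartAt (Cn m) x).map_target (hball w hw).1)
          (hball w hw).2 (chartVec (chartAt (Cn m) x) w u)
        rw [chartCoord_chartVec x (hball w hw).1, (chartAt (Cn m) x).right_inv (hball w hw).1,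
          h0, LinearMap.zero_apply, map_zero] at this
        exact this.symm
    have h3 := (chartAt (Cn m) x).continuousAt hx (Metric.ball_mem_nhds _ hr)
    filter_upwards [h1, h3] with y hy hy'
    have h4 := hconst _ hy'
    rw [localRep, localRep, (chartAt (Cn m) x).left_inv hy.1, (chartAt (Cn m) x).left_inv hx] at h4
    exact (chartAt (Cn n) (f x)).injOn hy.2 (mem_chart_source _ _) h4
  obtain ⟨x⟩ := (inferInstance : Nonempty M)
  exact ⟨f x, fun y => hloc.apply_eq_of_preconnectedSpace y x⟩

end Constant

end Herm

end

/-! ### From the rank bound to degeneracy, by measure. -/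

noncomputable section
namespace Herm
open Filter Topology Matrix MeasureTheory

lemma det_restrictScalars_eq_zero {m : ℕ} {A : Cn m →L[ℂ] Cn m} (hA : ¬ Function.Surjective A) :
    (A.restrictScalars ℝ).det = 0 := by
  by_contra hd
  exact hA (LinearMap.equivOfDetNeZero (A.restrictScalars ℝ).toLinearMap hd).surjective

lemma mapRank_lt {m n : ℕ} {M N : Type*} [TopologicalSpace M] [ChartedSpace (Cn m) M]
    [TopologicalSpace N] [ChartedSpace (Cn n) N] {f : M → N} {ℓ : ℕ} (hℓ : 1 ≤ ℓ)
    (hr : ∀ x, Module.finrank ℂ (LinearMap.range (tangentMapAt m n f x)) < ℓ) :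
    mapRank m n f < (ℓ : ℕ∞) := by
  -- A supremum preserves only weak bounds, hence the detour through ℓ - 1.
  refine lt_of_le_of_lt (iSup_le (a := ((ℓ - 1 : ℕ) : ℕ∞)) fun x => ?_)
    (Nat.cast_lt.2 (show ℓ - 1 < ℓ by omega))
  exact Nat.cast_le.2 (Nat.le_sub_one_of_lt (hr x))

section Degenerate

variable {m n : ℕ} {M N : Type*} [TopologicalSpace M] [ChartedSpace (Cn m) M]
  [IsManifold 𝓘(ℂ, Cn m) ω M] [TopologicalSpace N] [ChartedSpace (Cn n) N]
  [IsManifold 𝓘(ℂ, Cn n) ω N] {f : M → N}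

/-- If `f` nowhere has rank `m`, then the image of `f` in a chart is projected to a null set by any
linear map to `ℂ^m`. -/
lemma volume_image_chart_eq_zero [CompactSpace M]
    (hf : ContMDiff 𝓘(ℂ, Cn m) 𝓘(ℂ, Cn n) ω f)
    (hr : ∀ x, Module.finrank ℂ (LinearMap.range (tangentMapAt m n f x)) < m)
    (p : N) (A : Cn n →L[ℂ] Cn m) :
    volume ((A ∘ chartAt (Cn n) p) '' (Set.range f ∩ (chartAt (Cn n) p).source)) = 0 := by
  have i1 : IsManifold 𝓘(ℂ, Cn m) 1 M := IsManifold.of_le (n := ω) le_top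
  have i2 : IsManifold 𝓘(ℂ, Cn n) 1 N := IsManifold.of_le (n := ω) le_top
  obtain ⟨t, ht⟩ := isCompact_univ.elim_nhds_subcover (fun x : M => (chartAt (Cn m) x).source)
    fun x _ => (chartAt (Cn m) x).open_source.mem_nhds (mem_chart_source _ x)
  set D : M → Set (Cn m) := fun x => {z ∈ (chartAt (Cn m) x).target |
    f ((chartAt (Cn m) x).symm z) ∈ (chartAt (Cn n) p).source} with hD
  refine measure_mono_null (t := ⋃ x ∈ t, ((A ∘ chartAt (Cn n) p) ∘
    (f ∘ (chartAt (Cn m) x).symm)) '' D x) ?_ ?_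
  · rintro _ ⟨_, ⟨⟨y, rfl⟩, hy⟩, rfl⟩
    obtain ⟨x, hx, hyx⟩ := Set.mem_iUnion₂.1 (ht.2 (Set.mem_univ y))
    refine Set.mem_biUnion hx ⟨chartAt (Cn m) x y, ⟨(chartAt (Cn m) x).map_source hyx, ?_⟩, ?_⟩
    · rwa [(chartAt (Cn m) x).left_inv hyx]
    · simp only [Function.comp_apply, (chartAt (Cn m) x).left_inv hyx]
  · refine (measure_biUnion_null_iff t.countable_toSet).2 fun x _ => ?_
    have hder : ∀ z ∈ D x, ∃ L : Cn m →L[ℂ] Cn m, ¬ Function.Surjective L ∧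
        HasFDerivAt ((A ∘ chartAt (Cn n) p) ∘ (f ∘ (chartAt (Cn m) x).symm)) L z := by
      intro z hz
      have hfd : MDifferentiableAt 𝓘(ℂ, Cn m) 𝓘(ℂ, Cn n) f ((chartAt (Cn m) x).symm z) :=
        hf.mdifferentiable (by simp) _
      have hψ : MDifferentiableAt 𝓘(ℂ, Cn n) 𝓘(ℂ, Cn n) (chartAt (Cn n) p)
          (f ((chartAt (Cn m) x).symm z)) :=
        (mdifferentiable_chart (I := 𝓘(ℂ, Cn n)) p).mdifferentiableAt hz.2
      have he : MDifferentiableAt 𝓘(ℂ, Cn m) 𝓘(ℂ, Cn m) (chartAt (Cn m) x).symm z :=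
        (mdifferentiable_chart (I := 𝓘(ℂ, Cn m)) x).mdifferentiableAt_symm hz.1
      have hA : HasMFDerivAt 𝓘(ℂ, Cn n) 𝓘(ℂ, Cn m) A
          (chartAt (Cn n) p (f ((chartAt (Cn m) x).symm z))) A := A.hasFDerivAt.hasMFDerivAt
      have hc := (hA.comp _ hψ.hasMFDerivAt).comp z (hfd.hasMFDerivAt.comp z he.hasMFDerivAt)
      refine ⟨_, ?_, hc.hasFDerivAt⟩
      -- A surjective derivative would map the range of the tangent map, of dimension less than m,
      -- onto ℂ^m.
      intro hs
      set B : Tan n N (f ((chartAt (Cn m) x).symm z)) →ₗ[ℂ] Cn m :=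
        A.toLinearMap ∘ₗ chartCoord (chartAt (Cn n) p) _ with hB
      have hs' : Function.Surjective (B ∘ₗ tangentMapAt m n f ((chartAt (Cn m) x).symm z)) := by
        intro w
        obtain ⟨u, hu⟩ := hs w
        exact ⟨chartVec (chartAt (Cn m) x) z u, hu⟩
      have h1 := LinearMap.range_eq_top.2 hs'
      rw [LinearMap.range_comp] at h1
      have h2 := Submodule.finrank_map_le B
        (LinearMap.range (tangentMapAt m n f ((chartAt (Cn m) x).symm z)))
      rw [h1, finrank_top, finrank_euclideanSpace_fin] at h2
      exact absurd (hr _) h2.not_gt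
    choose! L hL hL' using hder
    -- Sard's theorem in equal dimensions: the derivative is singular at every point of `D x`.
    exact addHaar_image_eq_zero_of_det_fderivWithin_eq_zero volume
      (fun z hz => ((hL' z hz).restrictScalars ℝ).hasFDerivWithinAt)
      fun z hz => det_restrictScalars_eq_zero (hL z hz)

/-- A set containing a `d`-dimensional piece, `m ≤ d`, projects to a set of positive measure in
`ℂ^m` under a suitable linear map in a suitable chart. -/
lemma ContainsPiece.exists_volume_ne_zero {S : Set N} {d : ℕ}
    (hS : ContainsPiece (n := n) S d) (hmd : m ≤ d) :
    ∃ (p : N) (A : Cn n →L[ℂ] Cn m),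
      volume ((A ∘ chartAt (Cn n) p) '' (S ∩ (chartAt (Cn n) p).source)) ≠ 0 := by
  have i2 : IsManifold 𝓘(ℂ, Cn n) 1 N := IsManifold.of_le (n := ω) le_top
  obtain ⟨U, φ, hU, ⟨z₀, hz₀⟩, hφ, -, hinj, hsub⟩ := hS
  have hφ0 := hφ.contMDiffAt (hU.mem_nhds hz₀)
  have hψ0 : ContMDiffAt 𝓘(ℂ, Cn n) 𝓘(ℂ, Cn n) ω (chartAt (Cn n) (φ z₀)) (φ z₀) :=
    (contMDiffOn_chart (x := φ z₀)).contMDiffAt ((chartAt (Cn n) (φ z₀)).open_source.mem_nhds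
      (mem_chart_source _ _))
  have hG : ContDiffAt ℂ ω (chartAt (Cn n) (φ z₀) ∘ φ) z₀ := (hψ0.comp z₀ hφ0).contDiffAt
  have hG' := hG.hasStrictFDerivAt (by simp)
  have hLinj : Function.Injective (fderiv ℂ (chartAt (Cn n) (φ z₀) ∘ φ) z₀) := by
    have h1 := mfderiv_comp z₀ (hψ0.mdifferentiableAt (by simp)) (hφ0.mdifferentiableAt (by simp))
    rw [mfderiv_eq_fderiv] at h1
    intro u v huv
    rw [h1] at huv
    exact hinj z₀ hz₀ ((chartCoord_bijective (φ z₀) (mem_chart_source _ _)).1 huv)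
  -- Restrict the parametrisation to an m-dimensional slice and let A be a left inverse of its
  -- derivative. The composite then has derivative the identity at 0.
  obtain ⟨ι, hι⟩ : ∃ ι : Cn m →ₗ[ℂ] Cn d, Function.Injective ι :=
    finrank_le_iff_exists_linearMap.1 (by simpa using hmd)
  obtain ⟨A, hA⟩ := LinearMap.exists_leftInverse_of_injective
    ((fderiv ℂ (chartAt (Cn n) (φ z₀) ∘ φ) z₀).toLinearMap ∘ₗ ι)
    (LinearMap.ker_eq_bot.2 (hLinj.comp hι))
  set ι' : Cn m →L[ℂ] Cn d := LinearMap.toContinuousLinearMap ι with hι'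
  set A' : Cn n →L[ℂ] Cn m := LinearMap.toContinuousLinearMap A with hA'
  refine ⟨φ z₀, A', ?_⟩
  have hs0 : HasStrictFDerivAt (fun w : Cn m => z₀ + ι' w) ι' 0 :=
    ι'.hasStrictFDerivAt.const_add z₀
  have hz : z₀ + ι' 0 = z₀ := by rw [map_zero, add_zero]
  have hH : HasStrictFDerivAt (fun w => A' ((chartAt (Cn n) (φ z₀) ∘ φ) (z₀ + ι' w)))
      ((ContinuousLinearEquiv.refl ℂ (Cn m) : Cn m ≃L[ℂ] Cn m) : Cn m →L[ℂ] Cn m) 0 := by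
    have := A'.hasStrictFDerivAt.comp (0 : Cn m) (HasStrictFDerivAt.comp (0 : Cn m)
      (g := chartAt (Cn n) (φ z₀) ∘ φ) (by rw [hz]; exact hG') hs0)
    have e : ((ContinuousLinearEquiv.refl ℂ (Cn m) : Cn m ≃L[ℂ] Cn m) : Cn m →L[ℂ] Cn m) =
        A' ∘SL fderiv ℂ (chartAt (Cn n) (φ z₀) ∘ φ) z₀ ∘SL ι' :=
      ContinuousLinearMap.ext fun u => (LinearMap.congr_fun hA u).symm
    rw [e]
    exact this
  have hc : Tendsto (fun w : Cn m => z₀ + ι' w) (𝓝 0) (𝓝 z₀) := by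
    have := hs0.continuousAt
    rwa [ContinuousAt, hz] at this
  have hV : {w : Cn m | z₀ + ι' w ∈ U ∧ φ (z₀ + ι' w) ∈ (chartAt (Cn n) (φ z₀)).source} ∈
      𝓝 (0 : Cn m) := by
    filter_upwards [hc (hU.mem_nhds hz₀), hc (hφ0.continuousAt
      ((chartAt (Cn n) (φ z₀)).open_source.mem_nhds (mem_chart_source _ _)))] with w h1 h2
    exact ⟨h1, h2⟩
  have himg := image_mem_map (m := fun w => A' ((chartAt (Cn n) (φ z₀) ∘ φ) (z₀ + ι' w))) hV
  -- By the inverse function theorem the projected piece contains a neighbourhood, hence has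
  -- positive measure.
  rw [hH.map_nhds_eq_of_equiv] at himg
  refine ((Measure.measure_pos_of_mem_nhds volume himg).trans_le (measure_mono ?_)).ne'
  rintro _ ⟨w, hw, rfl⟩
  exact ⟨φ (z₀ + ι' w), ⟨hsub ⟨_, hw.1, rfl⟩, hw.2⟩, rfl⟩

/-- A piece of dimension d ≥ m in the image would have a projection of both positive and zero
measure. -/
lemma isDegenerate_of_finrank_range_lt [CompactSpace M] (hm : 1 ≤ m)
    (hf : ContMDiff 𝓘(ℂ, Cn m) 𝓘(ℂ, Cn n) ω f)
    (hr : ∀ x, Module.finrank ℂ (LinearMap.range (tangentMapAt m n f x)) < m) :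
    IsDegenerate m n f := by
  refine lt_of_le_of_lt (iSup₂_le (a := (((m - 1 : ℕ) : ℕ∞) : WithBot ℕ∞)) fun d hd => ?_) ?_
  · have h1 : d < m := by
      by_contra! h
      obtain ⟨p, A, hA⟩ := hd.exists_volume_ne_zero h
      exact hA (volume_image_chart_eq_zero hf hr p A)
    exact WithBot.coe_le_coe.2 (Nat.cast_le.2 (by omega))
  · exact WithBot.coe_lt_coe.2 (Nat.cast_lt.2 (by omega))

end Degenerate

section Full

variable {m : ℕ} {M : Type*} [TopologicalSpace M] [ChartedSpace (Cn m) M]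
  [IsManifold 𝓘(ℂ, Cn m) ω M]

/-- A unitary family of m vectors is a full frame, so the contraction over it is the trace with the
inverse metric. -/
lemma ScalarSign.scalSign {g : HermitianMetric m M} {P : ℝ → Prop} (hg : ScalarSign g P) :
    ScalSign g m P := by
  intro p Sg _ E hE
  rw [← scalar_eq_scal g p ((isUnitary_iff g p E).1 hE.1)]
  exact hg p

lemma RicciSign.ric1Sign {g : HermitianMetric m M} {P : ℝ → Prop} (hg : RicciSign g P) :
    Ric1Sign g m P := by
  intro p Sg _ E hE v _ hv
  rw [← ricci_eq_ric1 g p ((isUnitary_iff g p E).1 hE.1)]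
  exact hg p v hv

end Full

end Herm

end

theorem theorem1p4 {m n : ℕ} (hm : 1 ≤ m) (hmn : m ≤ n)
    {M : Type*} [TopologicalSpace M] [ChartedSpace (Herm.Cn m) M]
    [IsManifold 𝓘(ℂ, Herm.Cn m) ω M] [T2Space M] [CompactSpace M] [ConnectedSpace M]
    {N : Type*} [TopologicalSpace N] [ChartedSpace (Herm.Cn n) N]
    [IsManifold 𝓘(ℂ, Herm.Cn n) ω N] [T2Space N] [SecondCountableTopology N]
    (g : Herm.HermitianMetric m M) (h : Herm.HermitianMetric n N)
    (f : M → N) (hf : ContMDiff 𝓘(ℂ, Herm.Cn m) 𝓘(ℂ, Herm.Cn n) ω f) :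
    -- (a)
    (((Herm.ScalarSign g (0 ≤ ·) ∧ Herm.Ric1Sign h m (· < 0)) ∨
      (Herm.ScalarSign g (0 < ·) ∧ Herm.Ric1Sign h m (· ≤ 0)) ∨
      (Herm.RicciSign g (0 ≤ ·) ∧ Herm.ScalSign h m (· < 0)) ∨
      (Herm.RicciSign g (0 < ·) ∧ Herm.ScalSign h m (· ≤ 0))) →
        Herm.IsDegenerate m n f) ∧
    -- (b)
    (∀ ℓ : ℕ, 1 ≤ ℓ → ℓ < m → Herm.IsKahler g →
      ((Herm.ScalSign g ℓ (0 ≤ ·) ∧ Herm.Ric1Sign h ℓ (· < 0)) ∨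
       (Herm.ScalSign g ℓ (0 < ·) ∧ Herm.Ric1Sign h ℓ (· ≤ 0)) ∨
       (Herm.Ric1Sign g ℓ (0 ≤ ·) ∧ Herm.ScalSign h ℓ (· < 0)) ∨
       (Herm.Ric1Sign g ℓ (0 < ·) ∧ Herm.ScalSign h ℓ (· ≤ 0))) →
        Herm.mapRank m n f < (ℓ : ℕ∞)) ∧
    -- (c)
    (∀ ℓ : ℕ, 1 ≤ ℓ → ℓ ≤ m →
      ((Herm.Ric2Sign g ℓ (0 < ·) ∧ Herm.RealBisecSign h (· ≤ 0)) ∨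
       (Herm.Ric2Sign g ℓ (0 ≤ ·) ∧ Herm.RealBisecSign h (· < 0))) →
        ∃ c : N, ∀ x : M, f x = c) := by
  refine ⟨fun H => ?_, fun ℓ hℓ _ _ H => ?_, fun ℓ hℓ hℓm H => ?_⟩
  -- Part (a) is the rank bound with ℓ = m, where the partial curvatures of M are its Chern scalar
  -- and Ricci curvatures.
  · refine Herm.isDegenerate_of_finrank_range_lt hm hf fun x =>
      Herm.finrank_range_lt (g := g) (h := h) hf hm ?_ x
    exact H.imp (.imp_left fun a => a.scalSign) (.imp (.imp_left fun a => a.scalSign)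
      (.imp (.imp_left fun a => a.ric1Sign) (.imp_left fun a => a.ric1Sign)))
  · exact Herm.mapRank_lt hℓ fun x => Herm.finrank_range_lt hf hℓ H x
  · exact Herm.exists_eq_const hf fun x => Herm.tangentMapAt_eq_zero hf hmn hℓ hℓm H x
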